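/- Let $d\in(0,\infty]$, let $f,g:\mathbb R\to\mathbb R$ be continuous on $(-d,d)$, and put $F(x)=\int_0^x f(u)\,du$, $G(x)=\int_0^x g(u)\,du$. Consider the Liénard equation $$\ddot x+f(x)\dot x+g(x)=0,\qquad |x|<d,\tag{1}$$ and the Liénard system $\dot x=y-F(x),\ \dot y=-g(x)$ on $(-d,d)\times\mathbb R$. A limit cycle is an isolated (nonconstant) periodic orbit in $(-d,d)\times\mathbb R$; its amplitude is the maximum of $|x|$ on it. For $0<\alpha<d$ put $Q=Q(\alpha)=(\alpha,F(\alpha))$. Follow the orbit of the Liénard system through $Q$, within $x>0$, backward and forward until it first meets the $y$-axis. If the backward meeting point is $Y=(0,y_+(0))$ with $y_+(0)>0$, we say that $y_+(0)$ is defined for $\alpha$; if the forward meeting point is $Y'=(0,y_-(0))$ with $y_-(0)<0$, we say that $y_-(0)$ is defined for $\alpha$. With $v(x,y)=G(x)+\tfrac12y^2$ write $V_{YQ}=v(Q)-v(Y)$ and $V_{QY'}=v(Y')-v(Q)$. Let $\alpha'$ be a root of $G(\alpha)=\tfrac12y_+(0)^2-\tfrac12F(\alpha)^2$ (that is, $V_{YQ}=0$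 for $Q=Q(\alpha')$), and $\alpha''$ a root of $G(\alpha)=\tfrac12y_-(0)^2-\tfrac12F(\alpha)^2$ (that is, $V_{QY'}=0$ for $Q=Q(\alpha'')$), where $y_\pm(0)$ belong to the orbit through $Q(\alpha)$. We say that $\bar\alpha=\max\{\alpha',\alpha''\}$ is admissible if on the orbit through $Q(\bar\alpha)$, for which $y_\pm(0)$ are both defined, either $V_{YQ}=0$ and $V_{QY'}\le 0$, or $V_{QY'}=0$ and $V_{YQ}\le 0$. Theorem. Suppose that (i) $f$ and $g$ are continuous on $(-d,d)$; (ii) $F$ and $g$ are odd on $(-d,d)$, and $g(x)>0$ for $0<x<d$; (iii) the zeros of $F$ in $(-d,d)$ are exactly $0,a,-a$, for some $a$ with $0<a<d$; (iv) there is an admissible $\bar\alpha$, as above, such that $F$ is (strictly) increasing on $(a,\bar\alpha]$ and nondecreasing on $(\bar\alpha,d)$. Then equation (1) has a unique limit cycle, both in the Liénard plane, as an orbit of the Liénard system, and in the phase plane $(x,\dot x)$, and its amplitude is at most $\bar\alpha$. (No growth of $F$ is required: for $d=\infty$, $F$ may stay bounded as $x\to\infty$.) -/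

import Mathlib

open Set

noncomputable section

namespace Lienard

/-- The symmetric open interval `(-d, d)`; `d = ⊤` gives the whole real line. -/
def symInterval (d : EReal) : Set ℝ := {x | ((|x| : ℝ) : EReal) < d}

/-- The vertical strip `(-d, d) × ℝ` of the plane. -/
def strip (d : EReal) : Set (ℝ × ℝ) := {p | p.1 ∈ symInterval d}

/-- The primitive `x ↦ ∫₀ˣ h(u) du`. With `h = f` this is `F`, with `h = g` this is `G`. -/
def primitive (h : ℝ → ℝ) (x : ℝ) : ℝ := ∫ u in (0 : ℝ)..x, h u

/-- The vector field of the Liénard system `x' = y - F(x)`, `y' = -g(x)` in the Liénard plane. -/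
def lienardField (f g : ℝ → ℝ) (p : ℝ × ℝ) : ℝ × ℝ := (p.2 - primitive f p.1, -g p.1)

/-- The vector field `x' = u`, `u' = -f(x) u - g(x)` of the equation `x'' + f(x) x' + g(x) = 0`
in the `(x, x')` phase plane. -/
def phaseField (f g : ℝ → ℝ) (p : ℝ × ℝ) : ℝ × ℝ := (p.2, -f p.1 * p.2 - g p.1)

/-- `C` is the orbit of a nonconstant periodic solution of `γ' = X(γ)` which stays in `U`. -/
def IsPeriodicOrbit (X : ℝ × ℝ → ℝ × ℝ) (U C : Set (ℝ × ℝ)) : Prop :=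
  ∃ γ : ℝ → ℝ × ℝ,
    (∀ t, γ t ∈ U ∧ HasDerivAt γ (X (γ t)) t) ∧
    (∃ T : ℝ, 0 < T ∧ Function.Periodic γ T) ∧
    (∃ s t, γ s ≠ γ t) ∧
    C = range γ

/-- A limit cycle: an isolated periodic orbit. -/
def IsLimitCycle (X : ℝ × ℝ → ℝ × ℝ) (U C : Set (ℝ × ℝ)) : Prop :=
  IsPeriodicOrbit X U C ∧
    ∃ N : Set (ℝ × ℝ), IsOpen N ∧ C ⊆ N ∧ ∀ C', IsPeriodicOrbit X U C' → C' ⊆ N → C' = C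

/-- The amplitude of a curve is the maximum of `|x|` on it. -/
def IsAmplitude (C : Set (ℝ × ℝ)) (A : ℝ) : Prop :=
  IsGreatest ((fun p : ℝ × ℝ => |p.1|) '' C) A

/-- The energy `v(x, y) = G(x) + y² / 2`. -/
def energy (g : ℝ → ℝ) (p : ℝ × ℝ) : ℝ := primitive g p.1 + p.2 ^ 2 / 2

/-- The point `Q = (α, F(α))` of the curve `y = F(x)`. -/
def curvePoint (f : ℝ → ℝ) (α : ℝ) : ℝ × ℝ := (α, primitive f α)

/-- `γ`, restricted to `[0, T]`, is a path of the Liénard system inside the strip. -/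
def IsPath (f g : ℝ → ℝ) (d : EReal) (T : ℝ) (γ : ℝ → ℝ × ℝ) : Prop :=
  0 < T ∧ ∀ t ∈ Icc 0 T,
    γ t ∈ strip d ∧ HasDerivWithinAt γ (lienardField f g (γ t)) (Icc 0 T) t

/-- `y = y₊(0)` for the path through `Q = (α, F(α))`: going back in time from `Q` within `x > 0`,
the path first meets the `y`-axis at `Y = (0, y)`, a point of the positive half axis. -/
def IsUpperIntercept (f g : ℝ → ℝ) (d : EReal) (α y : ℝ) : Prop :=
  0 < y ∧ ∃ T γ, IsPath f g d T γ ∧ γ 0 = (0, y) ∧ γ T = curvePoint f α ∧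
    ∀ t ∈ Ioc 0 T, 0 < (γ t).1

/-- `y = y₋(0)` for the path through `Q = (α, F(α))`: going forward in time from `Q` within
`x > 0`, the path first meets the `y`-axis at `Y' = (0, y)`, a point of the negative half axis. -/
def IsLowerIntercept (f g : ℝ → ℝ) (d : EReal) (α y : ℝ) : Prop :=
  y < 0 ∧ ∃ T γ, IsPath f g d T γ ∧ γ 0 = curvePoint f α ∧ γ T = (0, y) ∧
    ∀ t ∈ Ico 0 T, 0 < (γ t).1

/-- `α'` is a root of `G(α) = y₊(0)² / 2 - F(α)² / 2`, where `y₊(0)` belongs to the path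
through `(α, F(α))`. -/
def IsUpperRoot (f g : ℝ → ℝ) (d : EReal) (α' : ℝ) : Prop :=
  ∃ y, IsUpperIntercept f g d α' y ∧
    primitive g α' = y ^ 2 / 2 - primitive f α' ^ 2 / 2

/-- `α''` is a root of `G(α) = y₋(0)² / 2 - F(α)² / 2`, where `y₋(0)` belongs to the path
through `(α, F(α))`. -/
def IsLowerRoot (f g : ℝ → ℝ) (d : EReal) (α'' : ℝ) : Prop :=
  ∃ y, IsLowerIntercept f g d α'' y ∧
    primitive g α'' = y ^ 2 / 2 - primitive f α'' ^ 2 / 2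

/-- `αbar = max {α', α''}`, where `α'` is a root of the first and `α''` a root of the second
equation, and where, on the path `Y Q Y'` through `Q = (αbar, F(αbar))`, neither of the energy
differences `V_{YQ} = v(Q) - v(Y)` and `V_{QY'} = v(Y') - v(Q)` is positive. As one of them is zero
at the larger root, this says that there `V_{YQ} = 0` and `V_{QY'} ≤ 0`, or `V_{QY'} = 0` and
`V_{YQ} ≤ 0`. -/
def IsAlphaBar (f g : ℝ → ℝ) (d : EReal) (αbar : ℝ) : Prop :=
  (∃ α' α'', IsUpperRoot f g d α' ∧ IsLowerRoot f g d α'' ∧ αbar = max α' α'') ∧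
  ∃ yp ym, IsUpperIntercept f g d αbar yp ∧ IsLowerIntercept f g d αbar ym ∧
    energy g (curvePoint f αbar) - energy g (0, yp) ≤ 0 ∧
    energy g (0, ym) - energy g (curvePoint f αbar) ≤ 0

end Lienard

end

noncomputable section

open Filter Topology

namespace Lienard

/-! In the half plane `x ≥ 0` put `z = G(x)` and `s = -y`. A half orbit from the positive to the
negative `y`-axis becomes an `Arc`: a solution of `dz/ds = Ψ(z) - s`, `Ψ = -F ∘ G⁻¹`, that vanishes
at both ends. The Liénard field is odd, so an arc with ends `-Y` and `Y`, together with its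
reflection in the origin, is a periodic orbit. The theorem reduces to this: there is exactly one
symmetric arc, and every periodic orbit comes from one.

Existence (`Arc.exists_symmetric`). The energy `u = z + s²/2` satisfies `u' = Ψ(u - s²/2)`.
Admissibility of `αbar` says that the arc through `Q` does not end with more energy than it started
with, so it is an upper solution; a small positive constant is a lower solution because `Ψ ≥ 0` near
`0`. Since `Ψ` need not be Lipschitz at `0`, minimal solutions replace unique ones: their end value
is monotone in the initial value, which suffices for a fixed point, that is, for an arc with equal
energy at both ends. It lies below the upper solution, whence the bound on the amplitude.

Uniqueness (`Arc.not_lt_of_symmetric`). Distinct arcs are nested. On a symmetric arc the total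
change of energy, the integral of `Ψ(z) ds`, is zero. Passing to a larger arc lowers the gain below
the level `G(a)`, where `Ψ > 0`, and does not lower the loss above it, where `Ψ ≤ 0` is
nonincreasing. Two symmetric arcs of different size are therefore impossible.

Every periodic orbit is symmetric (`PeriodicSolution.exists_symmetric_arc`,
`PeriodicSolution.exists_arc`). The half orbits before and after a crossing of the `y`-axis with
extremal `|y|` are nested after reflection, and extremality makes their ends agree. Largest and
smallest `|y|` both yield symmetric arcs, so they coincide. The periodic orbit in the strip is thus
unique, and in particular isolated. -/

/-! ### Calculus on intervals: inverses, one-sided derivatives, sign changes -/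

/-- Extending `f` with slope one outside `[a, b]` gives an increasing bijection of the line; its
inverse, clipped to `[a, b]`, is defined and continuous everywhere. -/
theorem exists_inverse_of_strictMonoOn {f : ℝ → ℝ} {a b : ℝ} (hab : a ≤ b)
    (hc : ContinuousOn f (Icc a b)) (hm : StrictMonoOn f (Icc a b)) :
    ∃ k : ℝ → ℝ, Continuous k ∧ Monotone k ∧ (∀ y, k y ∈ Icc a b) ∧
      (∀ x ∈ Icc a b, k (f x) = x) ∧ (∀ y ∈ Icc (f a) (f b), f (k y) = y) ∧
      (∀ y ∈ Ioo (f a) (f b), k y ∈ Ioo a b) ∧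
      (∀ x ∈ Ioo a b, ∀ f', f' ≠ 0 → HasDerivAt f f' x → HasDerivAt k f'⁻¹ (f x)) := by
  set c : ℝ → ℝ := fun x => (projIcc a b hab x : ℝ) with hcdef
  have hcmem : ∀ x, c x ∈ Icc a b := fun x => (projIcc a b hab x).2
  have hcid : ∀ x ∈ Icc a b, c x = x := fun x hx => by
    simp only [hcdef, projIcc_of_mem hab hx]
  have hccont : Continuous c := continuous_subtype_val.comp continuous_projIcc
  have hcmono : Monotone c := fun x y h => monotone_projIcc hab h
  have hclip : ∀ x y, x ≤ y → c y - c x ≤ y - x := by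
    intro x y h
    simp only [hcdef, coe_projIcc]
    rcases le_total b x with h1 | h1 <;> rcases le_total b y with h2 | h2 <;>
      rcases le_total a x with h3 | h3 <;> rcases le_total a y with h4 | h4 <;>
      simp only [min_eq_left, min_eq_right, max_eq_left, max_eq_right, *] <;> linarith
  set e : ℝ → ℝ := fun x => f (c x) + (x - c x) with hedef
  have hecont : Continuous e :=
    (hc.comp_continuous hccont hcmem).add (continuous_id.sub hccont)
  have heid : ∀ x ∈ Icc a b, e x = f x := fun x hx => by simp [hedef, hcid x hx]
  have hestrict : StrictMono e := by
    intro x y h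
    have h1 := hclip x y h.le
    rcases (hcmono h.le).eq_or_lt with h2 | h2
    · simp only [hedef, h2]; linarith
    · have := hm (hcmem x) (hcmem y) h2
      simp only [hedef]; linarith
  have hsurj : Function.Surjective e := by
    apply hecont.surjective
    · apply tendsto_atTop_mono' _ _ (tendsto_atTop_add_const_left atTop (f b - b) tendsto_id)
      filter_upwards [eventually_ge_atTop b] with x hx
      have : c x = b := by simp [hcdef, projIcc_of_right_le hab hx]
      simp only [hedef, this, id]; linarith
    · apply tendsto_atBot_mono' _ _ (tendsto_atBot_add_const_left atBot (f a - a) tendsto_id)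
      filter_upwards [eventually_le_atBot a] with x hx
      have : c x = a := by simp [hcdef, projIcc_of_le_left hab hx]
      simp only [hedef, this, id]; linarith
  set o := StrictMono.orderIsoOfSurjective e hestrict hsurj with ho
  have hoe : ∀ x, o.symm (e x) = x := fun x => o.symm_apply_apply x
  have heo : ∀ y, e (o.symm y) = y := fun y => o.apply_symm_apply y
  have hocont : Continuous o.symm := o.toHomeomorph.symm.continuous
  have ha : a ∈ Icc a b := left_mem_Icc.2 hab
  have hb : b ∈ Icc a b := right_mem_Icc.2 hab
  have hoIcc : ∀ y ∈ Icc (f a) (f b), o.symm y ∈ Icc a b := by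
    intro y hy
    rw [← heid a ha, ← heid b hb] at hy
    constructor
    · rw [← hoe a]; exact o.symm.monotone hy.1
    · rw [← hoe b]; exact o.symm.monotone hy.2
  have hoIoo : ∀ y ∈ Ioo (f a) (f b), o.symm y ∈ Ioo a b := by
    intro y hy
    rw [← heid a ha, ← heid b hb] at hy
    constructor
    · have := o.symm.strictMono hy.1
      rwa [hoe a] at this
    · have := o.symm.strictMono hy.2
      rwa [hoe b] at this
  have hkid : ∀ x ∈ Icc a b, c (o.symm (f x)) = x := fun x hx => by
    rw [← heid x hx, hoe, hcid x hx]
  have hfk : ∀ y ∈ Icc (f a) (f b), f (c (o.symm y)) = y := fun y hy => by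
    rw [hcid _ (hoIcc y hy), ← heid _ (hoIcc y hy), heo]
  refine ⟨fun y => c (o.symm y), hccont.comp hocont, hcmono.comp o.symm.monotone,
    fun y => hcmem _, hkid, hfk, fun y hy => ?_, ?_⟩
  · simp only [hcid _ (Ioo_subset_Icc_self (hoIoo y hy))]; exact hoIoo y hy
  · intro x hx f' hf' hd
    have hxI := Ioo_subset_Icc_self hx
    have hfx : f x ∈ Ioo (f a) (f b) := ⟨hm ha hxI hx.1, hm hxI hb hx.2⟩
    refine HasDerivAt.of_local_left_inverse (f := f) (hccont.comp hocont).continuousAt ?_ hf' ?_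
    · simp only [hkid x hxI]; exact hd
    · filter_upwards [Ioo_mem_nhds hfx.1 hfx.2] with y hy
      exact hfk y (Ioo_subset_Icc_self hy)

/-- At the endpoints the one-sided derivative is the limit of the interior derivatives. This extends
a differential equation from an open interval to its closure. -/
theorem hasDerivWithinAt_Icc_of_Ioo {E : Type*} [NormedAddCommGroup E] [NormedSpace ℝ E]
    {f φ : ℝ → E} {a b : ℝ} (hab : a < b)
    (hf : ContinuousOn f (Icc a b)) (hφ : ContinuousOn φ (Icc a b))
    (hd : ∀ x ∈ Ioo a b, HasDerivAt f (φ x) x) :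
    ∀ x ∈ Icc a b, HasDerivWithinAt f (φ x) (Icc a b) x := by
  intro x hx
  have hdiff : DifferentiableOn ℝ f (Ioo a b) :=
    fun y hy => (hd y hy).differentiableAt.differentiableWithinAt
  rcases hx.1.eq_or_lt with rfl | h1
  · refine (hasDerivWithinAt_Ici_of_tendsto_deriv hdiff
      ((hf a hx).mono Ioo_subset_Icc_self) (Ioo_mem_nhdsGT hab) ?_).mono Icc_subset_Ici_self
    have : Tendsto φ (𝓝[>] a) (𝓝 (φ a)) := by
      have := (hφ a hx).mono (Ioo_subset_Icc_self)
      rwa [ContinuousWithinAt, nhdsWithin_Ioo_eq_nhdsGT hab] at this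
    refine this.congr' ?_
    filter_upwards [Ioo_mem_nhdsGT hab] with y hy using (hd y hy).deriv.symm
  rcases hx.2.eq_or_lt with rfl | h2
  · refine (hasDerivWithinAt_Iic_of_tendsto_deriv hdiff
      ((hf x hx).mono Ioo_subset_Icc_self) (Ioo_mem_nhdsLT hab) ?_).mono Icc_subset_Iic_self
    have : Tendsto φ (𝓝[<] x) (𝓝 (φ x)) := by
      have := (hφ x hx).mono (Ioo_subset_Icc_self)
      rwa [ContinuousWithinAt, nhdsWithin_Ioo_eq_nhdsLT hab] at this
    refine this.congr' ?_
    filter_upwards [Ioo_mem_nhdsLT hab] with y hy using (hd y hy).deriv.symm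
  · exact (hd x ⟨h1, h2⟩).hasDerivWithinAt

/-- A function on an interval whose derivative is negative at its zeros stays nonpositive. -/
theorem nonpos_of_deriv_neg_at_zeros {f f' : ℝ → ℝ} {a b : ℝ}
    (hf : ContinuousOn f (Icc a b)) (hd : ∀ x ∈ Ico a b, HasDerivWithinAt f (f' x) (Ici x) x)
    (ha : f a ≤ 0) (h0 : ∀ x ∈ Ico a b, f x = 0 → f' x < 0) : ∀ x ∈ Icc a b, f x ≤ 0 :=
  fun _ hx => image_le_of_deriv_right_lt_deriv_boundary' (B := fun _ => 0) (B' := fun _ => 0)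
    hf hd ha continuousOn_const (fun _ _ => hasDerivWithinAt_const _ _ _) h0 hx

/-- A continuous function which is positive at `a`, negative at `b` and has negative derivative at
each zero changes sign exactly once. -/
theorem exists_unique_sign_change {f f' : ℝ → ℝ} {a b : ℝ} (hab : a < b)
    (hf : ContinuousOn f (Icc a b)) (hd : ∀ x ∈ Ioo a b, HasDerivAt f (f' x) x)
    (ha : 0 < f a) (hb : f b < 0) (h0 : ∀ x ∈ Ioo a b, f x = 0 → f' x < 0) :
    ∃ m ∈ Ioo a b, f m = 0 ∧ (∀ x ∈ Ico a m, 0 < f x) ∧ (∀ x ∈ Ioc m b, f x < 0) := by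
  obtain ⟨m, hm, hm0⟩ : ∃ m ∈ Icc a b, f m = 0 := by
    have := intermediate_value_Icc' hab.le hf (show (0 : ℝ) ∈ Icc (f b) (f a) from ⟨hb.le, ha.le⟩)
    obtain ⟨m, hm, h⟩ := this
    exact ⟨m, hm, h⟩
  have hma : a < m := lt_of_le_of_ne hm.1 (by rintro rfl; linarith)
  have hmb : m < b := lt_of_le_of_ne hm.2 (by rintro rfl; linarith)
  have up : ∀ s ∈ Ioo a b, f s ≤ 0 → ∀ x ∈ Icc s b, f x ≤ 0 := by
    intro s hs h
    refine nonpos_of_deriv_neg_at_zeros (f' := f') (hf.mono (Icc_subset_Icc_left hs.1.le)) ?_ h ?_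
    · exact fun x hx => (hd x ⟨hs.1.trans_le hx.1, hx.2⟩).hasDerivWithinAt
    · exact fun x hx => h0 x ⟨hs.1.trans_le hx.1, hx.2⟩
  refine ⟨m, ⟨hma, hmb⟩, hm0, ?_, ?_⟩
  · intro x hx
    by_contra! hneg
    have hxa : a < x := lt_of_le_of_ne hx.1 (by rintro rfl; linarith)
    have hle : ∀ z ∈ Icc x b, f z ≤ 0 := up x ⟨hxa, hx.2.trans hmb⟩ hneg
    have hder : HasDerivAt f (f' m) m := hd m ⟨hma, hmb⟩
    have hmax : IsLocalMax f m := by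
      filter_upwards [Ioo_mem_nhds hx.2 hmb] with z hz
      rw [hm0]; exact hle z ⟨hz.1.le, hz.2.le⟩
    have := hmax.hasDerivAt_eq_zero hder
    linarith [h0 m ⟨hma, hmb⟩ hm0]
  · intro x hx
    rcases hx.2.eq_or_lt with rfl | hxb
    · exact hb
    have hle := up m ⟨hma, hmb⟩ hm0.le
    refine lt_of_le_of_ne (hle x ⟨hx.1.le, hx.2⟩) fun h => ?_
    have hmax : IsLocalMax f x := by
      filter_upwards [Ioo_mem_nhds hx.1 hxb] with z hz
      rw [h]; exact hle z ⟨hz.1.le, hz.2.le⟩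
    have := hmax.hasDerivAt_eq_zero (hd x ⟨hma.trans hx.1, hxb⟩)
    linarith [h0 x ⟨hma.trans hx.1, hxb⟩ h]

/-! ### Minimal solutions of the energy equation without a Lipschitz condition -/

/-- A continuous function that factors through the projection to a compact interval is the
increasing uniform limit of bounded Lipschitz functions lying strictly below it. -/
theorem exists_lipschitz_approx {Ψ : ℝ → ℝ} {l r : ℝ} (hlr : l ≤ r) (hΨ : Continuous Ψ)
    (hproj : ∀ x, Ψ (projIcc l r hlr x) = Ψ x) :
    ∃ φ : ℕ → ℝ → ℝ, (∀ n, ∃ K, LipschitzWith K (φ n)) ∧ (∀ n, ∃ L : NNReal, ∀ x, |φ n x| ≤ L) ∧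
      (∀ n x, φ n x < φ (n + 1) x) ∧ (∀ n x, φ n x < Ψ x) ∧
      ∀ n x, |φ n x - Ψ x| ≤ 4 * (1 / 4) ^ n := by
  -- With the shift `3 · 4⁻ⁿ` and the error `4⁻ⁿ`, the `n`-th polynomial lies between `Ψ - 4 · 4⁻ⁿ`
  -- and `Ψ - 2 · 4⁻ⁿ`. These bands are disjoint for successive `n`, so the approximations increase
  -- strictly.
  have h1 : ∀ n : ℕ, ∃ p : Polynomial ℝ, ∀ x ∈ Icc l r,
      |p.eval x - (Ψ x - 3 * (1 / 4) ^ n)| < (1 / 4) ^ n := fun n =>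
    exists_polynomial_near_of_continuousOn l r (fun x => Ψ x - 3 * (1 / 4) ^ n)
      (by fun_prop) _ (by positivity)
  choose p hp using h1
  have hp' : ∀ n x, |(p n).eval (projIcc l r hlr x : ℝ) - (Ψ x - 3 * (1 / 4) ^ n)| < (1 / 4) ^ n :=
    fun n x => by have := hp n _ (projIcc l r hlr x).2; rwa [hproj] at this
  have hpos : ∀ n : ℕ, (0 : ℝ) < (1 / 4) ^ n := fun n => by positivity
  refine ⟨fun n x => (p n).eval (projIcc l r hlr x : ℝ), fun n => ?_, fun n => ?_, fun n x => ?_,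
    fun n x => ?_, fun n x => ?_⟩
  · obtain ⟨K, hK⟩ := (show ContDiff ℝ 1 fun x => (p n).eval x from by
      simpa only [Polynomial.coe_aeval_eq_eval] using (p n).contDiff_aeval (𝕜 := ℝ) 1).contDiffOn.exists_lipschitzOnWith (s := Icc l r)
      one_ne_zero (convex_Icc l r) isCompact_Icc
    refine ⟨K * 1, ?_⟩
    intro x y
    refine (hK (projIcc l r hlr x).2 (projIcc l r hlr y).2).trans ?_
    rw [mul_one]
    gcongr
    have h := LipschitzWith.projIcc hlr x y
    rwa [ENNReal.coe_one, one_mul] at h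
  · obtain ⟨C, hC⟩ := isCompact_Icc.exists_bound_of_continuousOn
      (f := fun x => (p n).eval x) (s := Icc l r) (by fun_prop)
    refine ⟨⟨max C 0, le_max_right _ _⟩, fun x => ?_⟩
    exact (hC _ (projIcc l r hlr x).2).trans (le_max_left _ _)
  · have a1 := abs_lt.1 (hp' n x)
    have a2 := abs_lt.1 (hp' (n + 1) x)
    rw [pow_succ] at a2
    dsimp only
    linarith [a1.1, a1.2, a2.1, a2.2, hpos n]
  · have a1 := abs_lt.1 (hp' n x)
    dsimp only
    linarith [a1.1, a1.2, hpos n]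
  · have a1 := abs_lt.1 (hp' n x)
    rw [abs_le]
    constructor <;> dsimp only <;> linarith [a1.1, a1.2, hpos n]

/-- The right side is bounded by `L` everywhere, so a ball of radius `2 M L` lets the
Picard–Lindelöf theorem cover all of `[-M, M]`. -/
theorem exists_solution_of_lipschitz {φ : ℝ → ℝ} {K L : NNReal} (hφ : LipschitzWith K φ)
    (hL : ∀ x, |φ x| ≤ L) {M : ℝ} (hM : 0 ≤ M) (k : ℝ) :
    ∃ u : ℝ → ℝ, u (-M) = k ∧
      ∀ s ∈ Icc (-M) M, HasDerivWithinAt u (φ (u s - s ^ 2 / 2)) (Icc (-M) M) s := by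
  have h : IsPicardLindelof (fun s x => φ (x - s ^ 2 / 2))
      (⟨-M, by constructor <;> linarith⟩ : Icc (-M) M) k (L * ⟨2 * M, by positivity⟩) 0 L K := by
    refine ⟨fun t _ => ?_, fun x _ => ?_, fun t _ x _ => ?_, ?_⟩
    · intro x _ y _
      have := hφ (x - t ^ 2 / 2) (y - t ^ 2 / 2)
      rwa [edist_sub_right] at this
    · exact (hφ.continuous.comp (by fun_prop)).continuousOn
    · exact hL _
    · have h1 : max (M - -M) (-M - -M) ≤ 2 * M := max_le (by linarith) (by linarith)
      rw [NNReal.coe_zero, sub_zero]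
      exact mul_le_mul_of_nonneg_left h1 L.2
  exact h.exists_eq_forall_mem_Icc_hasDerivWithinAt₀

theorem hasDerivWithinAt_Ici_of_Icc {f : ℝ → ℝ} {f' a b s : ℝ} (hs : s ∈ Ico a b)
    (h : HasDerivWithinAt f f' (Icc a b) s) : HasDerivWithinAt f f' (Ici s) s :=
  h.mono_of_mem_nhdsWithin (mem_of_superset (Icc_mem_nhdsGE hs.2) (Icc_subset_Icc_left hs.1))

/-- Peano existence for `u' = Ψ (u - s² / 2)`, with a solution that is minimal and therefore
monotone in the initial value. -/
theorem exists_minimal_solution {Ψ : ℝ → ℝ} {l r : ℝ} (hlr : l ≤ r) (hΨ : Continuous Ψ)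
    (hproj : ∀ x, Ψ (projIcc l r hlr x) = Ψ x) {M : ℝ} (hM : 0 < M) :
    ∃ U : ℝ → ℝ → ℝ,
      (∀ k, U k (-M) = k ∧
        ∀ s ∈ Icc (-M) M, HasDerivWithinAt (U k) (Ψ (U k s - s ^ 2 / 2)) (Icc (-M) M) s) ∧
      (∀ k v, k ≤ v (-M) → ContinuousOn v (Icc (-M) M) →
        (∀ s ∈ Ico (-M) M, HasDerivWithinAt v (Ψ (v s - s ^ 2 / 2)) (Ici s) s) →
        ∀ s ∈ Icc (-M) M, U k s ≤ v s) := by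
  obtain ⟨φ, hlip, hbdd, hlt, hltΨ, hapx⟩ := exists_lipschitz_approx hlr hΨ hproj
  have hex : ∀ n k, ∃ u : ℝ → ℝ, u (-M) = k ∧
      ∀ s ∈ Icc (-M) M, HasDerivWithinAt u (φ n (u s - s ^ 2 / 2)) (Icc (-M) M) s := by
    intro n k
    obtain ⟨K, hK⟩ := hlip n
    obtain ⟨L, hL⟩ := hbdd n
    exact exists_solution_of_lipschitz hK hL hM.le k
  choose u hu0 hu using hex
  have hucont : ∀ n k, ContinuousOn (u n k) (Icc (-M) M) :=
    fun n k s hs => (hu n k s hs).continuousWithinAt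
  -- At a contact point the derivatives are strictly ordered because `φ n < Ψ`. Comparison therefore
  -- needs no uniqueness, and it survives the limit.
  have hmin : ∀ n k v, k ≤ v (-M) → ContinuousOn v (Icc (-M) M) →
      (∀ s ∈ Ico (-M) M, HasDerivWithinAt v (Ψ (v s - s ^ 2 / 2)) (Ici s) s) →
      ∀ s ∈ Icc (-M) M, u n k s ≤ v s := by
    intro n k v h0 hv hv' s hs
    refine image_le_of_deriv_right_lt_deriv_boundary' (hucont n k)
      (fun s hs => hasDerivWithinAt_Ici_of_Icc hs (hu n k s (Ico_subset_Icc_self hs)))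
      (by rw [hu0]; exact h0) hv hv' (fun s _ h => ?_) hs
    rw [h]; exact hltΨ n _
  have hmono : ∀ n k, ∀ s ∈ Icc (-M) M, u n k s ≤ u (n + 1) k s := by
    intro n k s hs
    refine image_le_of_deriv_right_lt_deriv_boundary' (hucont n k)
      (fun s hs => hasDerivWithinAt_Ici_of_Icc hs (hu n k s (Ico_subset_Icc_self hs)))
      (by rw [hu0, hu0]) (hucont (n + 1) k)
      (fun s hs => hasDerivWithinAt_Ici_of_Icc hs (hu (n + 1) k s (Ico_subset_Icc_self hs)))
      (fun s _ h => ?_) hs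
    rw [h]; exact hlt n _
  obtain ⟨B, hB⟩ : ∃ B, ∀ x, |Ψ x| ≤ B := by
    obtain ⟨B, hB⟩ := isCompact_Icc.exists_bound_of_continuousOn (hΨ.continuousOn (s := Icc l r))
    exact ⟨B, fun x => by rw [← hproj]; exact hB _ (projIcc l r hlr x).2⟩
  have hle4 : ∀ n : ℕ, 4 * ((1 : ℝ) / 4) ^ n ≤ 4 := fun n => by
    have : ((1 : ℝ) / 4) ^ n ≤ 1 := pow_le_one₀ (by norm_num) (by norm_num)
    linarith
  have hφB : ∀ n x, |φ n x| ≤ B + 4 := by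
    intro n x
    have h1 := abs_le.1 ((hapx n x).trans (hle4 n))
    have h2 := abs_le.1 (hB x)
    rw [abs_le]; constructor <;> linarith [h1.1, h1.2, h2.1, h2.2]
  have hφcont : ∀ n, Continuous (φ n) := fun n => by
    obtain ⟨K, hK⟩ := hlip n; exact hK.continuous
  have hcomp : ∀ n k, ContinuousOn (fun s => φ n (u n k s - s ^ 2 / 2)) (Icc (-M) M) :=
    fun n k => (hφcont n).comp_continuousOn ((hucont n k).sub (by fun_prop))
  have hint : ∀ n k, ∀ s ∈ Icc (-M) M,
      ∫ x in (-M)..s, φ n (u n k x - x ^ 2 / 2) = u n k s - k := by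
    intro n k s hs
    have hsub : Icc (-M) s ⊆ Icc (-M) M := Icc_subset_Icc_right hs.2
    rw [intervalIntegral.integral_eq_sub_of_hasDerivAt_of_le hs.1 ((hucont n k).mono hsub)
      (fun x hx => (hu n k x ⟨hx.1.le, hx.2.le.trans hs.2⟩).hasDerivAt
        (Icc_mem_nhds hx.1 (hx.2.trans_le hs.2)))
      (((hcomp n k).mono hsub).intervalIntegrable_of_Icc hs.1), hu0]
  have hbound : ∀ n k, ∀ s ∈ Icc (-M) M, u n k s ≤ k + (B + 4) * (2 * M) := by
    intro n k s hs
    have h1 := hint n k s hs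
    have h2 : ‖∫ x in (-M)..s, φ n (u n k x - x ^ 2 / 2)‖ ≤ (B + 4) * |s - -M| :=
      intervalIntegral.norm_integral_le_of_norm_le_const fun x _ => hφB n _
    rw [h1, Real.norm_eq_abs] at h2
    have h3 : |s - -M| ≤ 2 * M := by rw [abs_le]; constructor <;> linarith [hs.1, hs.2]
    have h4 : 0 ≤ B + 4 := (abs_nonneg _).trans (hφB 0 0)
    nlinarith [le_abs_self (u n k s - k)]
  -- The approximate solutions increase with `n` and stay below every solution starting at or above
  -- `k`. Their supremum is the minimal solution once the integral equation passes to the limit.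
  set V : ℝ → ℝ → ℝ := fun k s => ⨆ n, u n k s with hV
  have hbddA : ∀ k, ∀ s ∈ Icc (-M) M, BddAbove (range fun n => u n k s) :=
    fun k s hs => ⟨_, by rintro _ ⟨n, rfl⟩; exact hbound n k s hs⟩
  have hlim : ∀ k, ∀ s ∈ Icc (-M) M, Tendsto (fun n => u n k s) atTop (𝓝 (V k s)) :=
    fun k s hs => tendsto_atTop_ciSup
      (monotone_nat_of_le_succ fun n => hmono n k s hs) (hbddA k s hs)
  have hpow : Tendsto (fun n : ℕ => 4 * ((1 : ℝ) / 4) ^ n) atTop (𝓝 0) := by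
    have := (tendsto_pow_atTop_nhds_zero_of_lt_one (r := (1 : ℝ) / 4) (by norm_num)
      (by norm_num)).const_mul 4
    simpa using this
  have hlimφ : ∀ k, ∀ s ∈ Icc (-M) M, Tendsto (fun n => φ n (u n k s - s ^ 2 / 2)) atTop
      (𝓝 (Ψ (V k s - s ^ 2 / 2))) := by
    intro k s hs
    have h1 : Tendsto (fun n => Ψ (u n k s - s ^ 2 / 2)) atTop (𝓝 (Ψ (V k s - s ^ 2 / 2))) :=
      (hΨ.tendsto _).comp ((hlim k s hs).sub_const _)
    have h2 : Tendsto (fun n => φ n (u n k s - s ^ 2 / 2) - Ψ (u n k s - s ^ 2 / 2)) atTop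
        (𝓝 0) := squeeze_zero_norm (fun n => hapx n _) hpow
    simpa using h2.add h1
  have hVint : ∀ k, ∀ s ∈ Icc (-M) M,
      ∫ x in (-M)..s, Ψ (V k x - x ^ 2 / 2) = V k s - k := by
    intro k s hs
    have h1 : Tendsto (fun n => ∫ x in (-M)..s, φ n (u n k x - x ^ 2 / 2)) atTop
        (𝓝 (∫ x in (-M)..s, Ψ (V k x - x ^ 2 / 2))) := by
      refine intervalIntegral.tendsto_integral_filter_of_dominated_convergence (fun _ => B + 4)
        ?_ ?_ ?_ ?_
      · refine Eventually.of_forall fun n => ?_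
        rw [uIoc_of_le hs.1]
        refine (((hcomp n k).mono ?_).aestronglyMeasurable measurableSet_Ioc)
        exact fun x hx => ⟨hx.1.le, hx.2.trans hs.2⟩
      · exact Eventually.of_forall fun n => Eventually.of_forall fun x _ => hφB n _
      · exact intervalIntegrable_const
      · refine Eventually.of_forall fun x hx => ?_
        rw [uIoc_of_le hs.1] at hx
        exact hlimφ k x ⟨hx.1.le, hx.2.trans hs.2⟩
    have h2 : Tendsto (fun n => u n k s - k) atTop (𝓝 (V k s - k)) :=
      (hlim k s hs).sub_const k
    exact tendsto_nhds_unique (h1.congr fun n => hint n k s hs) h2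
  -- The approximations share the Lipschitz constant `B + 4`, which the pointwise limit inherits.
  have hVcont : ∀ k, ContinuousOn (V k) (Icc (-M) M) := by
    intro k
    have hlipV : LipschitzOnWith ⟨B + 4, (abs_nonneg _).trans (hφB 0 0)⟩ (V k) (Icc (-M) M) := by
      refine LipschitzOnWith.of_dist_le_mul fun x hx y hy => ?_
      have hn : ∀ n, dist (u n k x) (u n k y) ≤ (B + 4) * dist x y := by
        intro n
        have h1 := Convex.norm_image_sub_le_of_norm_hasDerivWithin_le (f := u n k)
          (fun z hz => hu n k z hz) (fun z _ => hφB n _) (convex_Icc (-M) M) hy hx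
        rwa [← dist_eq_norm, ← dist_eq_norm] at h1
      exact le_of_tendsto ((hlim k x hx).dist (hlim k y hy)) (Eventually.of_forall hn)
    exact hlipV.continuousOn
  refine ⟨V, fun k => ⟨?_, fun s hs => ?_⟩, fun k v h0 hv hv' s hs => ?_⟩
  · have := hVint k (-M) ⟨le_rfl, by linarith⟩
    rw [intervalIntegral.integral_same] at this
    linarith
  · have hc : ContinuousOn (fun x => Ψ (V k x - x ^ 2 / 2)) (Icc (-M) M) :=
      hΨ.comp_continuousOn ((hVcont k).sub (by fun_prop))
    refine hasDerivWithinAt_Icc_of_Ioo (φ := fun x => Ψ (V k x - x ^ 2 / 2)) (by linarith)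
      (hVcont k) hc (fun x hx => ?_) s hs
    have hx' := Ioo_subset_Icc_self hx
    have h1 : HasDerivAt (fun y => ∫ x in (-M)..y, Ψ (V k x - x ^ 2 / 2))
        (Ψ (V k x - x ^ 2 / 2)) x := by
      refine intervalIntegral.integral_hasDerivAt_right ?_ ?_ ?_
      · exact (hc.mono (Icc_subset_Icc_right hx.2.le)).intervalIntegrable_of_Icc hx.1.le
      · exact (hc.mono Ioo_subset_Icc_self).stronglyMeasurableAtFilter isOpen_Ioo x hx
      · exact hc.continuousAt (Icc_mem_nhds hx.1 hx.2)
    have h2 := h1.add_const k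
    refine h2.congr_of_eventuallyEq ?_
    filter_upwards [Icc_mem_nhds hx.1 hx.2] with y hy
    rw [hVint k y hy]; ring
  · exact ciSup_le fun n => hmin n k v h0 hv hv' s hs

/-! ### Arcs and the existence of a symmetric one -/

/-- A solution `z` of `z' = Ψ z - s` on `[p, q]` with `p < 0 < q` that is positive inside and
vanishes at both ends. In the coordinates `z = G(x)`, `s = -y` it is the half `x ≥ 0` of an orbit
of the Liénard system. -/
structure Arc (Ψ : ℝ → ℝ) (p q : ℝ) (z : ℝ → ℝ) : Prop where
  neg : p < 0
  pos : 0 < q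
  cont : ContinuousOn z (Icc p q)
  left : z p = 0
  right : z q = 0
  posIoo : ∀ s ∈ Ioo p q, 0 < z s
  deriv : ∀ s ∈ Ioo p q, HasDerivAt z (Ψ (z s) - s) s

/-- Reversing `s` exchanges the two ends at the price of the sign of `Ψ`, so statements about the
left part of an arc also serve for the right part. -/
theorem Arc.reflect {Ψ : ℝ → ℝ} {p q : ℝ} {z : ℝ → ℝ} (A : Arc Ψ p q z) :
    Arc (fun x => -Ψ x) (-q) (-p) (fun s => z (-s)) where
  neg := by linarith [A.pos]
  pos := by linarith [A.neg]
  cont := A.cont.comp continuousOn_neg fun s hs => ⟨by linarith [hs.2], by linarith [hs.1]⟩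
  left := by rw [neg_neg]; exact A.right
  right := by rw [neg_neg]; exact A.left
  posIoo s hs := A.posIoo _ ⟨by linarith [hs.2], by linarith [hs.1]⟩
  deriv s hs := by
    have h1 := A.deriv (-s) ⟨by linarith [hs.2], by linarith [hs.1]⟩
    have h2 := h1.comp s (hasDerivAt_neg s)
    exact h2.congr_deriv (by ring)

theorem Arc.lt {Ψ : ℝ → ℝ} {p q : ℝ} {z : ℝ → ℝ} (A : Arc Ψ p q z) : p < q := A.neg.trans A.pos

theorem Arc.nonneg {Ψ : ℝ → ℝ} {p q : ℝ} {z : ℝ → ℝ} (A : Arc Ψ p q z) :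
    ∀ s ∈ Icc p q, 0 ≤ z s := by
  intro s hs
  rcases hs.1.eq_or_lt with rfl | h1
  · exact A.left.ge
  rcases hs.2.eq_or_lt with rfl | h2
  · exact A.right.ge
  exact (A.posIoo s ⟨h1, h2⟩).le

/-- While `z = u - s²/2` is negative, `Ψ` vanishes and `u` keeps its initial value `k`; hence `z`
first reaches zero at `s = -Y`. After that, `dz/ds = -s > 0` at a zero with `s < 0`, so `z` cannot
return to zero before `s = 0`. -/
theorem left_half_of_solution {Ψ : ℝ → ℝ} (h0 : ∀ x ≤ 0, Ψ x = 0) {M k : ℝ} (hM : 0 < M)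
    (hkM : k ≤ M ^ 2 / 2) {u : ℝ → ℝ}
    (hu : ∀ s ∈ Icc (-M) M, HasDerivWithinAt u (Ψ (u s - s ^ 2 / 2)) (Icc (-M) M) s)
    (huM : u (-M) = k) (hu0 : 0 < u 0) {Y : ℝ} (hY : 0 < Y) (hYk : Y ^ 2 / 2 = k) :
    u (-Y) - (-Y) ^ 2 / 2 = 0 ∧ ∀ s ∈ Ioc (-Y) 0, 0 < u s - s ^ 2 / 2 := by
  have hYM : Y ≤ M := by nlinarith
  have hcont : ContinuousOn u (Icc (-M) M) := fun s hs => (hu s hs).continuousWithinAt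
  have hzcont : ContinuousOn (fun s => u s - s ^ 2 / 2) (Icc (-M) M) := hcont.sub (by fun_prop)
  have hconst : ∀ b ∈ Icc (-M) (-Y), (∀ s ∈ Ico (-M) b, u s - s ^ 2 / 2 < 0) → u b = k := by
    intro b hb hneg
    have hbM : b ≤ M := by linarith [hb.2]
    rw [← huM]
    refine constant_of_has_deriv_right_zero (hcont.mono (Icc_subset_Icc_right hbM))
      (fun s hs => ?_) b (right_mem_Icc.2 hb.1)
    have h1 := hasDerivWithinAt_Ici_of_Icc ⟨hs.1, hs.2.trans_le hbM⟩
      (hu s ⟨hs.1, hs.2.le.trans hbM⟩)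
    rwa [h0 _ (hneg s hs).le] at h1
  have hneg : ∀ s ∈ Ico (-M) (-Y), u s - s ^ 2 / 2 < 0 := by
    intro s1 hs1
    by_contra! hge
    set S := {s ∈ Icc (-M) s1 | 0 ≤ u s - s ^ 2 / 2} with hS
    have hsub : Icc (-M) s1 ⊆ Icc (-M) M := Icc_subset_Icc_right (by linarith [hs1.2])
    have hSc : IsClosed S :=
      (hzcont.mono hsub).preimage_isClosed_of_isClosed isClosed_Icc isClosed_Ici
    have hSne : S.Nonempty := ⟨s1, ⟨hs1.1, le_rfl⟩, hge⟩
    have hSb : BddBelow S := ⟨-M, fun s hs => hs.1.1⟩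
    have hmem : sInf S ∈ S := hSc.csInf_mem hSne hSb
    have hk' := hconst (sInf S) ⟨hmem.1.1, hmem.1.2.trans hs1.2.le⟩ fun s hs => by
      by_contra! hge'
      exact absurd (csInf_le hSb (show s ∈ S from ⟨⟨hs.1, hs.2.le.trans hmem.1.2⟩, hge'⟩))
        (not_le.2 hs.2)
    have h1 := hmem.2
    have h2 : sInf S < -Y := hmem.1.2.trans_lt hs1.2
    rw [hk'] at h1
    nlinarith
  have hzY : u (-Y) - (-Y) ^ 2 / 2 = 0 := by
    rw [hconst (-Y) ⟨by linarith, le_rfl⟩ hneg, neg_sq, hYk, sub_self]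
  have hzd : ∀ s ∈ Icc (-M) M, HasDerivWithinAt (fun s => -(u s - s ^ 2 / 2))
      (-(Ψ (u s - s ^ 2 / 2) - s)) (Icc (-M) M) s := by
    intro s hs
    have h2 : HasDerivAt (fun s : ℝ => s ^ 2 / 2) s s := by
      have := (hasDerivAt_pow 2 s).div_const 2
      exact this.congr_deriv (by simp)
    exact ((hu s hs).sub h2.hasDerivWithinAt).neg
  have hnn : ∀ s ∈ Icc (-Y) 0, -(u s - s ^ 2 / 2) ≤ 0 := by
    refine nonpos_of_deriv_neg_at_zeros (f' := fun s => -(Ψ (u s - s ^ 2 / 2) - s)) ?_ ?_ ?_ ?_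
    · exact (hzcont.mono (Icc_subset_Icc (by linarith) hM.le)).neg
    · exact fun s hs => hasDerivWithinAt_Ici_of_Icc ⟨by linarith [hs.1], by linarith [hs.2]⟩
        (hzd s ⟨by linarith [hs.1], by linarith [hs.2]⟩)
    · linarith
    · intro s hs h
      rw [h0 _ (by linarith)]
      linarith [hs.2]
  refine ⟨hzY, fun s hs => ?_⟩
  rcases hs.2.eq_or_lt with rfl | hs0
  · simpa using hu0
  refine lt_of_le_of_ne (by linarith [hnn s ⟨hs.1.le, hs.2⟩]) fun h => ?_
  have hd := (hzd s ⟨by linarith [hs.1], by linarith⟩).hasDerivAt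
    (Icc_mem_nhds (by linarith [hs.1]) (by linarith))
  have hmax : IsLocalMax (fun s => -(u s - s ^ 2 / 2)) s := by
    filter_upwards [Ioo_mem_nhds hs.1 hs0] with t ht
    rw [← h, neg_zero]
    exact hnn t (Ioo_subset_Icc_self ht)
  have := hmax.hasDerivAt_eq_zero hd
  rw [h0 _ h.ge] at this
  linarith

/-- The supremum of the `k` with `k ≤ P k` is fixed, by monotonicity alone. Continuity would be
unavailable, as minimal solutions need not depend continuously on the initial value. -/
theorem exists_fixed_point_of_monotoneOn {P : ℝ → ℝ} {c K : ℝ} (hcK : c ≤ K)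
    (hP : ∀ k k', k ≤ k' → P k ≤ P k') (hc : c ≤ P c) (hK : P K ≤ K) : ∃ k ∈ Icc c K, P k = k := by
  set S := {k ∈ Icc c K | k ≤ P k}
  have hSne : c ∈ S := ⟨⟨le_rfl, hcK⟩, hc⟩
  have hSb : BddAbove S := ⟨K, fun k hk => hk.1.2⟩
  have h1 : sSup S ≤ P (sSup S) :=
    csSup_le ⟨c, hSne⟩ fun k hk => hk.2.trans (hP _ _ (le_csSup hSb hk))
  have h2 : sSup S ≤ K := csSup_le ⟨c, hSne⟩ fun k hk => hk.1.2
  have h3 : c ≤ sSup S := le_csSup hSb hSne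
  refine ⟨sSup S, ⟨h3, h2⟩, le_antisymm (le_csSup hSb ⟨⟨h3.trans h1, ?_⟩, hP _ _ h1⟩) h1⟩
  exact (hP _ _ h2).trans hK

/-- The sought arc is a solution of the energy equation on `[-M, M]` with equal values at both ends.
It is a fixed point of the end-value map of minimal solutions, trapped between a constant and the
energy of the given arc. -/
theorem Arc.exists_symmetric {Ψ : ℝ → ℝ} {l r : ℝ} (hlr : l ≤ r) (hΨ : Continuous Ψ)
    (hproj : ∀ x, Ψ (projIcc l r hlr x) = Ψ x) (h0 : ∀ x ≤ 0, Ψ x = 0) {a : ℝ} (ha : 0 < a)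
    (hpos : ∀ x ∈ Icc 0 a, 0 ≤ Ψ x) {p q R : ℝ} {ζ : ℝ → ℝ} (A : Arc Ψ p q ζ) (hqp : q ≤ -p)
    (hR : ∀ s ∈ Icc p q, ζ s ≤ R) :
    ∃ Y z, Arc Ψ (-Y) Y z ∧ ∀ s ∈ Icc (-Y) Y, z s ≤ R := by
  obtain ⟨M, rfl⟩ : ∃ M, p = -M := ⟨-p, by ring⟩
  rw [neg_neg] at hqp
  have hM : 0 < M := by linarith [A.pos]
  have hq := A.pos
  have hnonneg : ∀ x ≤ a, 0 ≤ Ψ x := fun x hx => by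
    rcases le_total x 0 with h | h
    · exact (h0 x h).ge
    · exact hpos x ⟨h, hx⟩
  obtain ⟨U, hU, hUmin⟩ := exists_minimal_solution hlr hΨ hproj hM
  have hUcont : ∀ k, ContinuousOn (U k) (Icc (-M) M) :=
    fun k s hs => ((hU k).2 s hs).continuousWithinAt
  have hUr : ∀ k, ∀ s ∈ Ico (-M) M, HasDerivWithinAt (U k) (Ψ (U k s - s ^ 2 / 2)) (Ici s) s :=
    fun k s hs => hasDerivWithinAt_Ici_of_Icc hs ((hU k).2 s (Ico_subset_Icc_self hs))
  -- the upper solution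
  set w : ℝ → ℝ := fun s => ζ s + s ^ 2 / 2 with hw
  have hwcont : ContinuousOn w (Icc (-M) q) := A.cont.add (by fun_prop)
  have hwd : ∀ s ∈ Icc (-M) q, HasDerivWithinAt w (Ψ (ζ s)) (Icc (-M) q) s := by
    refine hasDerivWithinAt_Icc_of_Ioo A.lt hwcont (hΨ.comp_continuousOn A.cont) fun s hs => ?_
    have h2 : HasDerivAt (fun s : ℝ => s ^ 2 / 2) s s := by
      have := (hasDerivAt_pow 2 s).div_const 2
      exact this.congr_deriv (by simp)
    exact ((A.deriv s hs).add h2).congr_deriv (by ring)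
  -- Beyond `q` the energy is continued by the constant `q²/2`. There `u - s²/2 ≤ 0`, so `Ψ`
  -- vanishes and `v` still solves the equation.
  set v : ℝ → ℝ := fun s => w (min s q) with hv
  have hvmem : ∀ s ∈ Icc (-M) M, min s q ∈ Icc (-M) q :=
    fun s hs => ⟨le_min hs.1 A.lt.le, min_le_right _ _⟩
  have hvcont : ContinuousOn v (Icc (-M) M) := hwcont.comp (by fun_prop) hvmem
  have hvd : ∀ s ∈ Ico (-M) M, HasDerivWithinAt v (Ψ (v s - s ^ 2 / 2)) (Ici s) s := by
    intro s hs
    rcases lt_or_ge s q with h | h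
    · have hvs : v s - s ^ 2 / 2 = ζ s := by simp [hv, hw, min_eq_left h.le]
      rw [hvs]
      refine (hasDerivWithinAt_Ici_of_Icc ⟨hs.1, h⟩ (hwd s ⟨hs.1, h.le⟩)).congr_of_eventuallyEq
        ?_ ?_
      · filter_upwards [Icc_mem_nhdsGE h] with t ht
        simp [hv, min_eq_left ht.2]
      · simp [hv, min_eq_left h.le]
    · have hvs : ∀ t ∈ Ici s, v t = q ^ 2 / 2 := fun t ht => by
        simp [hv, hw, min_eq_right (h.trans ht), A.right]
      have hz : Ψ (v s - s ^ 2 / 2) = 0 := by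
        rw [hvs s self_mem_Ici]; apply h0; nlinarith
      rw [hz]
      exact (hasDerivWithinAt_const s (Ici s) (q ^ 2 / 2)).congr hvs (hvs s self_mem_Ici)
  have hvM : v (-M) = M ^ 2 / 2 := by
    simp [hv, hw, min_eq_left A.lt.le, A.left]
  have hvM' : v M = q ^ 2 / 2 := by
    simp [hv, hw, min_eq_right hqp, A.right]
  -- the constant lower solution
  obtain ⟨c, hc0, hca, hcv⟩ : ∃ c, 0 < c ∧ c ≤ a ∧ c ≤ v (-M) := by
    exact ⟨min a (v (-M)), lt_min ha (by rw [hvM]; positivity), min_le_left _ _, min_le_right _ _⟩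
  have hlow : ∀ k, c ≤ k → ∀ s ∈ Icc (-M) M, c ≤ U k s := by
    intro k hk s hs
    -- Tilting the constant `c` downwards makes the comparison strict at a contact, where the
    -- solution has slope `Ψ ≥ 0 > -ε`.
    have key : ∀ ε > 0, c - ε * (s + M) ≤ U k s := by
      intro ε hε
      refine image_le_of_deriv_right_lt_deriv_boundary' (f := fun s => c - ε * (s + M))
        (f' := fun _ => -ε) (by fun_prop) (fun t _ => ?_) ?_ (hUcont k) (hUr k)
        (fun t ht h => ?_) hs
      · have := (((hasDerivAt_id t).add_const M).const_mul ε).const_sub c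
        exact (this.congr_deriv (by ring)).hasDerivWithinAt
      · rw [(hU k).1]; simpa using hk
      · have h1 : U k t - t ^ 2 / 2 ≤ a := by
          rw [← h]; nlinarith [ht.1, sq_nonneg t, mul_nonneg hε.le (by linarith [ht.1] : 0 ≤ t + M)]
        linarith [hnonneg _ h1]
    refine le_of_forall_pos_le_add fun ε hε => ?_
    have h1 := key (ε / (2 * M)) (by positivity)
    have h2 : ε / (2 * M) * (s + M) ≤ ε := by
      rw [div_mul_eq_mul_div, div_le_iff₀ (by positivity)]
      nlinarith [hs.2]
    linarith
  -- The upper end of the range is mapped below itself since `v` ends at `q²/2 ≤ M²/2`, and this is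
  -- where `q ≤ -p` enters.
  obtain ⟨k, hk, hPk⟩ := exists_fixed_point_of_monotoneOn (P := fun k => U k M) hcv
    (fun k k' h => hUmin k (U k') (by rw [(hU k').1]; exact h) (hUcont k') (hUr k') M
      ⟨by linarith, le_rfl⟩)
    (hlow c le_rfl M ⟨by linarith, le_rfl⟩)
    ((hUmin _ v le_rfl hvcont hvd M ⟨by linarith, le_rfl⟩).trans
      (by rw [hvM, hvM']; nlinarith))
  have hk0 : 0 < k := hc0.trans_le hk.1
  have hkM : k ≤ M ^ 2 / 2 := by rw [← hvM]; exact hk.2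
  have huv := hUmin k v hk.2 hvcont hvd
  set u := U k with hudef
  have hu := (hU k).2
  have hu0 : 0 < u 0 := hc0.trans_le (hlow k hk.1 0 ⟨by linarith, hM.le⟩)
  set Y := √(2 * k) with hYdef
  have hY : 0 < Y := Real.sqrt_pos.2 (by linarith)
  have hYk : Y ^ 2 / 2 = k := by rw [hYdef, Real.sq_sqrt (by linarith)]; ring
  have hYM : Y ≤ M := by nlinarith
  obtain ⟨l1, l2⟩ := left_half_of_solution h0 hM hkM hu (hU k).1 hu0 hY hYk
  -- The fixed point property gives the reversed solution the same initial value `k`, so its first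
  -- zero is also at `-Y` and the two halves match.
  have hu' : ∀ s ∈ Icc (-M) M, HasDerivWithinAt (fun s => u (-s))
      ((fun x => -Ψ x) (u (-s) - s ^ 2 / 2)) (Icc (-M) M) s := by
    intro s hs
    have h1 := (hu (-s) ⟨by linarith [hs.2], by linarith [hs.1]⟩).scomp s
      (hasDerivAt_neg s).hasDerivWithinAt
      (fun t (ht : t ∈ Icc (-M) M) => ⟨by linarith [ht.2], by linarith [ht.1]⟩)
    refine h1.congr_deriv ?_
    rw [neg_sq]; simp [hudef]
  obtain ⟨r1, r2⟩ := left_half_of_solution (Ψ := fun x => -Ψ x) (fun x hx => by simp [h0 x hx])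
    hM hkM hu' (by rw [neg_neg]; exact hPk) (by simpa using hu0) hY hYk
  rw [neg_neg] at r1
  refine ⟨Y, fun s => u s - s ^ 2 / 2, ⟨by linarith, hY, ?_, l1, by simpa using r1, ?_, ?_⟩, ?_⟩
  · exact ((hUcont k).mono (Icc_subset_Icc (by linarith) hYM)).sub (by fun_prop)
  · intro s hs
    rcases le_total s 0 with h | h
    · exact l2 s ⟨hs.1, h⟩
    · have := r2 (-s) ⟨by linarith [hs.2], by linarith⟩
      rwa [neg_neg, neg_sq] at this
  · intro s hs
    have h2 : HasDerivAt (fun s : ℝ => s ^ 2 / 2) s s := by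
      have := (hasDerivAt_pow 2 s).div_const 2
      exact this.congr_deriv (by simp)
    exact ((hu s ⟨by linarith [hs.1], by linarith [hs.2]⟩).hasDerivAt
      (Icc_mem_nhds (by linarith [hs.1]) (by linarith [hs.2]))).sub h2
  · intro s hs
    have h1 := huv s ⟨by linarith [hs.1], by linarith [hs.2]⟩
    have h2 : 0 ≤ R := by rw [← A.left]; exact hR _ (left_mem_Icc.2 A.lt.le)
    -- Left of `q` the bound is that of `ζ`; right of it `u - s²/2 ≤ (q² - s²)/2 ≤ 0 ≤ R`.
    rcases le_total s q with h | h
    · have h3 := hR s ⟨by linarith [hs.1], h⟩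
      simp only [hv, hw, min_eq_left h] at h1
      linarith
    · simp only [hv, hw, min_eq_right h, A.right] at h1
      nlinarith

/-! ### Branches, and uniqueness and nesting of arcs -/

/-- A solution of `dσ/dz = 1 / (Ψ z - σ)` below the graph of `Ψ`. -/
structure Branch (Ψ : ℝ → ℝ) (R : ℝ) (σ : ℝ → ℝ) : Prop where
  cont : ContinuousOn σ (Icc 0 R)
  lt : ∀ r ∈ Ico 0 R, σ r < Ψ r
  deriv : ∀ r ∈ Ioo 0 R, HasDerivAt σ (Ψ r - σ r)⁻¹ r

theorem Branch.mono {Ψ : ℝ → ℝ} {R R' : ℝ} {σ : ℝ → ℝ} (b : Branch Ψ R σ) (h : R' ≤ R) :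
    Branch Ψ R' σ where
  cont := b.cont.mono (Icc_subset_Icc_right h)
  lt r hr := b.lt r ⟨hr.1, hr.2.trans_le h⟩
  deriv r hr := b.deriv r ⟨hr.1, hr.2.trans_le h⟩

/-- With `z` as the independent variable the equation `σ' = 1 / (Ψ - σ)` is locally Lipschitz in the
unknown strictly below the graph of `Ψ`, whatever the behaviour of `Ψ` at `0`. This supplies the
uniqueness that the equation for `z(s)` lacks. -/
theorem Branch.eqOn_of_eq {Ψ : ℝ → ℝ} (hΨ : Continuous Ψ) {R : ℝ} {σ τ : ℝ → ℝ}
    (b : Branch Ψ R σ) (c : Branch Ψ R τ) {r : ℝ} (hr : r ∈ Icc 0 R) (h : σ r = τ r) :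
    EqOn σ τ (Icc 0 R) := by
  have hd : ∀ x ∈ Ioo 0 R, HasDerivAt (fun x => (τ x - σ x) ^ 2)
      (2 * (τ x - σ x) ^ 2 * ((Ψ x - σ x) * (Ψ x - τ x))⁻¹) x := by
    intro x hx
    have h1 := b.lt x ⟨hx.1.le, hx.2⟩
    have h2 := c.lt x ⟨hx.1.le, hx.2⟩
    have h1' : Ψ x - σ x ≠ 0 := by linarith
    have h2' : Ψ x - τ x ≠ 0 := by linarith
    refine (((c.deriv x hx).sub (b.deriv x hx)).pow 2).congr_deriv ?_
    simp only [Pi.sub_apply]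
    field_simp
    ring
  have hcont : ContinuousOn (fun x => (τ x - σ x) ^ 2) (Icc 0 R) := (c.cont.sub b.cont).pow 2
  have hR : 0 ≤ R := hr.1.trans hr.2
  have hmono : MonotoneOn (fun x => (τ x - σ x) ^ 2) (Icc 0 R) := by
    refine monotoneOn_of_hasDerivWithinAt_nonneg (convex_Icc 0 R) hcont
      (f' := fun x => 2 * (τ x - σ x) ^ 2 * ((Ψ x - σ x) * (Ψ x - τ x))⁻¹) ?_ ?_
    · rw [interior_Icc]; exact fun x hx => (hd x hx).hasDerivWithinAt
    · rw [interior_Icc]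
      intro x hx
      have h1 := b.lt x ⟨hx.1.le, hx.2⟩
      have h2 := c.lt x ⟨hx.1.le, hx.2⟩
      have : 0 < (Ψ x - σ x) * (Ψ x - τ x) := mul_pos (by linarith) (by linarith)
      positivity
  -- The square of the difference is nondecreasing, so a zero at `r` forces a zero at `0`.
  have h00 : τ 0 - σ 0 = 0 := by
    have h1 := hmono ⟨le_rfl, hR⟩ hr hr.1
    simp only [h, sub_self] at h1
    exact pow_eq_zero_iff two_ne_zero |>.1 (le_antisymm (by simpa using h1) (sq_nonneg _))
  have hIco : ∀ x ∈ Ico 0 R, τ x - σ x = 0 := by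
    intro x hx
    have hsub : Icc 0 x ⊆ Icc 0 R := Icc_subset_Icc_right hx.2.le
    have hcq : ContinuousOn (fun x => ((Ψ x - σ x) * (Ψ x - τ x))⁻¹) (Icc 0 x) := by
      refine ContinuousOn.inv₀ ((hΨ.continuousOn.sub (b.cont.mono hsub)).mul
        (hΨ.continuousOn.sub (c.cont.mono hsub))) fun y hy => ?_
      have h1 := b.lt y ⟨hy.1, hy.2.trans_lt hx.2⟩
      have h2 := c.lt y ⟨hy.1, hy.2.trans_lt hx.2⟩
      exact (mul_pos (by linarith) (by linarith)).ne'
    obtain ⟨K, hK⟩ := isCompact_Icc.exists_bound_of_continuousOn hcq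
    -- Grönwall's argument moves the zero upwards on `[0, x]` with `x < R`, where the coefficient is
    -- bounded. At `R` itself a denominator may vanish, and only continuity is left.
    have hanti : AntitoneOn (fun y => (τ y - σ y) ^ 2 * Real.exp (-2 * K * y)) (Icc 0 x) := by
      refine antitoneOn_of_hasDerivWithinAt_nonpos (convex_Icc 0 x)
        ((hcont.mono hsub).mul (by fun_prop))
        (f' := fun y => 2 * (τ y - σ y) ^ 2 * ((Ψ y - σ y) * (Ψ y - τ y))⁻¹ *
          Real.exp (-2 * K * y) + (τ y - σ y) ^ 2 * (Real.exp (-2 * K * y) * (-2 * K))) ?_ ?_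
      · rw [interior_Icc]
        intro y hy
        have h1 := hd y ⟨hy.1, hy.2.trans hx.2⟩
        have h2 : HasDerivAt (fun y => Real.exp (-2 * K * y))
            (Real.exp (-2 * K * y) * (-2 * K)) y := by
          have := ((hasDerivAt_id y).const_mul (-2 * K)).exp
          exact this.congr_deriv (by simp)
        exact (h1.mul h2).hasDerivWithinAt
      · rw [interior_Icc]
        intro y hy
        have h1 := (abs_le.1 (hK y (Ioo_subset_Icc_self hy))).2
        have h2 : 0 ≤ (τ y - σ y) ^ 2 * Real.exp (-2 * K * y) := by positivity
        nlinarith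
    have h1 := hanti (left_mem_Icc.2 hx.1) (right_mem_Icc.2 hx.1) hx.1
    simp only [h00] at h1
    have h2 : (τ x - σ x) ^ 2 ≤ 0 := by
      have := Real.exp_pos (-2 * K * x)
      by_contra! h3
      have := mul_pos h3 this
      rw [zero_pow two_ne_zero, zero_mul] at h1
      linarith
    exact pow_eq_zero_iff two_ne_zero |>.1 (le_antisymm h2 (sq_nonneg _))
  intro x hx
  rcases hx.2.eq_or_lt with rfl | hxR
  · rcases hx.1.eq_or_lt with h0 | h0
    · rw [← h0]; linarith
    · have h1 : Tendsto (fun y => τ y - σ y) (𝓝[<] x) (𝓝 (τ x - σ x)) := by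
        have := ((c.cont.sub b.cont) x hx).mono Ioo_subset_Icc_self
        rwa [ContinuousWithinAt, nhdsWithin_Ioo_eq_nhdsLT h0] at this
      have h2 : Tendsto (fun y => τ y - σ y) (𝓝[<] x) (𝓝 0) := by
        refine tendsto_const_nhds.congr' ?_
        filter_upwards [Ioo_mem_nhdsLT h0] with y hy
        exact (hIco y ⟨hy.1.le, hy.2⟩).symm
      linarith [tendsto_nhds_unique h1 h2]
  · linarith [hIco x ⟨hx.1, hxR⟩]

/-- For ordered branches, `σ² - τ²` is strictly increasing where `Ψ > 0`. -/
theorem Branch.sq_sub_sq_lt {Ψ : ℝ → ℝ} {R : ℝ} (hR : 0 < R) {σ τ : ℝ → ℝ}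
    (b : Branch Ψ R σ) (c : Branch Ψ R τ) (hlt : ∀ r ∈ Ioo 0 R, τ r < σ r)
    (hpos : ∀ r ∈ Ioo 0 R, 0 < Ψ r) : σ 0 ^ 2 - τ 0 ^ 2 < σ R ^ 2 - τ R ^ 2 := by
  have hm : StrictMonoOn (fun r => σ r ^ 2 - τ r ^ 2) (Icc 0 R) := by
    refine strictMonoOn_of_hasDerivWithinAt_pos (convex_Icc 0 R)
      ((b.cont.pow 2).sub (c.cont.pow 2))
      (f' := fun r => 2 * σ r * (Ψ r - σ r)⁻¹ - 2 * τ r * (Ψ r - τ r)⁻¹) ?_ ?_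
    · rw [interior_Icc]
      intro x hx
      refine (((b.deriv x hx).pow 2).sub ((c.deriv x hx).pow 2)).hasDerivWithinAt.congr_deriv ?_
      simp
    · rw [interior_Icc]
      intro x hx
      have h1 := b.lt x ⟨hx.1.le, hx.2⟩
      have h2 := c.lt x ⟨hx.1.le, hx.2⟩
      have h1' : 0 < Ψ x - σ x := by linarith
      have h2' : 0 < Ψ x - τ x := by linarith
      have h3 : 2 * σ x * (Ψ x - σ x)⁻¹ - 2 * τ x * (Ψ x - τ x)⁻¹ =
          2 * Ψ x * (σ x - τ x) / ((Ψ x - σ x) * (Ψ x - τ x)) := by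
        field_simp; ring
      rw [h3]
      have := hpos x hx
      have h4 := hlt x hx
      have h5 : 0 < σ x - τ x := by linarith
      positivity
  exact hm ⟨le_rfl, hR.le⟩ ⟨hR.le, le_rfl⟩ hR

/-- For ordered branches, `σ² - τ²` is strictly decreasing where `Ψ < 0`. -/
theorem Branch.lt_sq_sub_sq {Ψ : ℝ → ℝ} {R : ℝ} (hR : 0 < R) {σ τ : ℝ → ℝ}
    (b : Branch Ψ R σ) (c : Branch Ψ R τ) (hlt : ∀ r ∈ Ioo 0 R, τ r < σ r)
    (hneg : ∀ r ∈ Ioo 0 R, Ψ r < 0) : σ R ^ 2 - τ R ^ 2 < σ 0 ^ 2 - τ 0 ^ 2 := by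
  have hm : StrictAntiOn (fun r => σ r ^ 2 - τ r ^ 2) (Icc 0 R) := by
    refine strictAntiOn_of_hasDerivWithinAt_neg (convex_Icc 0 R)
      ((b.cont.pow 2).sub (c.cont.pow 2))
      (f' := fun r => 2 * σ r * (Ψ r - σ r)⁻¹ - 2 * τ r * (Ψ r - τ r)⁻¹) ?_ ?_
    · rw [interior_Icc]
      intro x hx
      refine (((b.deriv x hx).pow 2).sub ((c.deriv x hx).pow 2)).hasDerivWithinAt.congr_deriv ?_
      simp
    · rw [interior_Icc]
      intro x hx
      have h1 := b.lt x ⟨hx.1.le, hx.2⟩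
      have h2 := c.lt x ⟨hx.1.le, hx.2⟩
      have h1' : 0 < Ψ x - σ x := by linarith
      have h2' : 0 < Ψ x - τ x := by linarith
      have h3 : 2 * σ x * (Ψ x - σ x)⁻¹ - 2 * τ x * (Ψ x - τ x)⁻¹ =
          2 * Ψ x * (σ x - τ x) / ((Ψ x - σ x) * (Ψ x - τ x)) := by
        field_simp; ring
      rw [h3]
      have := hneg x hx
      have h4 := hlt x hx
      exact div_neg_of_neg_of_pos (mul_neg_of_neg_of_pos (by linarith) (by linarith))
        (mul_pos h1' h2')
  exact hm ⟨le_rfl, hR.le⟩ ⟨hR.le, le_rfl⟩ hR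

/-- The regularity of `Ψ` that makes arcs of height less than `R` unique. -/
structure Regular (Ψ : ℝ → ℝ) (R : ℝ) : Prop where
  cont : Continuous Ψ
  zero : Ψ 0 = 0
  diff : ∀ x ∈ Ioo 0 R, DifferentiableAt ℝ Ψ x

theorem Regular.neg {Ψ : ℝ → ℝ} {R : ℝ} (h : Regular Ψ R) : Regular (fun x => -Ψ x) R where
  cont := h.cont.neg
  zero := by rw [h.zero, neg_zero]
  diff x hx := (h.diff x hx).neg

section

variable {Ψ : ℝ → ℝ} {R p q : ℝ} {z : ℝ → ℝ}

/-- Where `Ψ(z) - s` vanishes, `z' = 0`, so its derivative is `-1` there and it changes sign only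
once. The vertex is the image of the point `Q` on the curve `y = F(x)`. -/
theorem Arc.exists_vertex (hΨ : Regular Ψ R) (A : Arc Ψ p q z) (hR : ∀ s ∈ Ioo p q, z s < R) :
    ∃ m ∈ Ioo p q, Ψ (z m) = m ∧ (∀ s ∈ Ico p m, s < Ψ (z s)) ∧ ∀ s ∈ Ioc m q, Ψ (z s) < s := by
  have hd : ∀ s ∈ Ioo p q, HasDerivAt (fun s => Ψ (z s) - s)
      (_root_.deriv Ψ (z s) * (Ψ (z s) - s) - 1) s := fun s hs =>
    ((hΨ.diff (z s) ⟨A.posIoo s hs, hR s hs⟩).hasDerivAt.comp s (A.deriv s hs)).sub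
      (hasDerivAt_id s)
  have hc : ContinuousOn (fun s => Ψ (z s) - s) (Icc p q) :=
    (hΨ.cont.comp_continuousOn A.cont).sub continuousOn_id
  obtain ⟨m, hm, h1, h2, h3⟩ := exists_unique_sign_change A.lt hc hd
    (by simp only [A.left, hΨ.zero]; linarith [A.neg])
    (by simp only [A.right, hΨ.zero]; linarith [A.pos])
    (fun s _ h => by rw [h, mul_zero]; norm_num)
  exact ⟨m, hm, by linarith, fun s hs => by linarith [h2 s hs], fun s hs => by linarith [h3 s hs]⟩

/-- Left of the vertex `z` increases strictly, so `s` is a function of `z` there. -/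
theorem Arc.exists_branch (A : Arc Ψ p q z) {m : ℝ} (hm : m ∈ Ioo p q)
    (hlt : ∀ s ∈ Ico p m, s < Ψ (z s)) :
    ∃ σ, Branch Ψ (z m) σ ∧ (∀ s ∈ Icc p m, σ (z s) = s) ∧
      (∀ r ∈ Icc 0 (z m), σ r ∈ Icc p m ∧ z (σ r) = r) ∧ StrictMonoOn z (Icc p m) := by
  have hsub : Icc p m ⊆ Icc p q := Icc_subset_Icc_right hm.2.le
  have hmono : StrictMonoOn z (Icc p m) := by
    refine strictMonoOn_of_hasDerivWithinAt_pos (convex_Icc p m) (A.cont.mono hsub)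
      (f' := fun s => Ψ (z s) - s) ?_ ?_
    · rw [interior_Icc]
      exact fun s hs => (A.deriv s ⟨hs.1, hs.2.trans hm.2⟩).hasDerivWithinAt
    · rw [interior_Icc]
      exact fun s hs => by linarith [hlt s ⟨hs.1.le, hs.2⟩]
  obtain ⟨σ, hσc, hσm, hσI, hσz, hzσ, hσo, hσd⟩ :=
    exists_inverse_of_strictMonoOn hm.1.le (A.cont.mono hsub) hmono
  rw [A.left] at hzσ hσo
  have hσlt : ∀ r ∈ Ico 0 (z m), σ r ∈ Ico p m := by
    intro r hr
    refine ⟨(hσI r).1, lt_of_le_of_ne (hσI r).2 fun h => ?_⟩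
    have := hzσ r ⟨hr.1, hr.2.le⟩
    rw [h] at this
    exact hr.2.ne this.symm
  refine ⟨σ, ⟨hσc.continuousOn, fun r hr => ?_, fun r hr => ?_⟩, hσz,
    fun r hr => ⟨hσI r, hzσ r hr⟩, hmono⟩
  · have := hlt _ (hσlt r hr)
    rwa [hzσ r ⟨hr.1, hr.2.le⟩] at this
  · have h1 := hσo r hr
    have h2 := hlt _ ⟨h1.1.le, h1.2⟩
    have h3 := hσd _ h1 _ (by linarith) (A.deriv _ ⟨h1.1, h1.2.trans hm.2⟩)
    rwa [hzσ r (Ioo_subset_Icc_self hr)] at h3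

end

section

variable {Ψ : ℝ → ℝ} {R p q p' q' : ℝ} {z z' : ℝ → ℝ}

/-- The branches left of the vertices coincide up to the lower of the two tops. The common vertex is
part of the conclusion because it carries the coincidence over to the right halves. -/
theorem Arc.eq_left_of_meet (hΨ : Regular Ψ R) (A : Arc Ψ p q z) (hA : ∀ s ∈ Ioo p q, z s < R)
    (B : Arc Ψ p' q' z') (hB : ∀ s ∈ Ioo p' q', z' s < R) {s : ℝ} (hs : s ∈ Icc p q)
    (hs' : s ∈ Icc p' q') (heq : z s = z' s) (hle : s ≤ Ψ (z s)) :
    p = p' ∧ (∃ m ∈ Ioo p q, m ∈ Ioo p' q' ∧ Ψ (z m) = m ∧ z m = z' m) ∧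
      ∀ t ∈ Icc p q, t ≤ Ψ (z t) → z t = z' t := by
  obtain ⟨m, hm, hm0, hm1, hm2⟩ := A.exists_vertex hΨ hA
  obtain ⟨n, hn, hn0, hn1, hn2⟩ := B.exists_vertex hΨ hB
  obtain ⟨σ, bσ, hσz, hzσ, hzm⟩ := A.exists_branch hm hm1
  obtain ⟨τ, bτ, hτz, hzτ, hzm'⟩ := B.exists_branch hn hn1
  have hsm : s ≤ m := by
    by_contra! h; linarith [hm2 s ⟨h, hs.2⟩]
  have hsn : s ≤ n := by
    by_contra! h; have := hn2 s ⟨h, hs'.2⟩; rw [← heq] at this; linarith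
  have hr0 : 0 ≤ z s := A.nonneg s hs
  have hr1 : z s ≤ z m := hzm.monotoneOn ⟨hs.1, hsm⟩ ⟨hm.1.le, le_rfl⟩ hsm
  have hr2 : z s ≤ z' n := by
    rw [heq]; exact hzm'.monotoneOn ⟨hs'.1, hsn⟩ ⟨hn.1.le, le_rfl⟩ hsn
  have hst : σ (z s) = τ (z s) := by
    rw [hσz s ⟨hs.1, hsm⟩, heq, hτz s ⟨hs'.1, hsn⟩]
  have hmin := (bσ.mono (min_le_left _ (z' n))).eqOn_of_eq hΨ.cont (bτ.mono (min_le_right (z m) _))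
    ⟨hr0, le_min hr1 hr2⟩ hst
  have hσm : σ (z m) = m := hσz m ⟨hm.1.le, le_rfl⟩
  have hτn : τ (z' n) = n := hτz n ⟨hn.1.le, le_rfl⟩
  have hzm0 : 0 ≤ z m := hr0.trans hr1
  have hzn0 : 0 ≤ z' n := hr0.trans hr2
  -- At the lower top its own branch reaches the graph of `Ψ`, whereas the other branch would still
  -- be strictly below it.
  have htop : z m = z' n := by
    rcases lt_trichotomy (z m) (z' n) with h | h | h
    · have h1 := hmin ⟨hzm0, le_min le_rfl h.le⟩
      have h2 := bτ.lt (z m) ⟨hzm0, h⟩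
      rw [← h1, hσm, hm0] at h2
      exact absurd h2 (lt_irrefl _)
    · exact h
    · have h1 := hmin ⟨hzn0, le_min h.le le_rfl⟩
      have h2 := bσ.lt (z' n) ⟨hzn0, h⟩
      rw [h1, hτn, hn0] at h2
      exact absurd h2 (lt_irrefl _)
  rw [← htop, min_self] at hmin
  have hmn : m = n := by
    rw [← hσm, ← hτn, ← htop]; exact hmin ⟨hzm0, le_rfl⟩
  subst hmn
  refine ⟨?_, ⟨m, hm, hn, hm0, htop⟩, fun t ht htle => ?_⟩
  · have h1 := hmin ⟨le_rfl, hzm0⟩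
    have h2 := hσz p ⟨le_rfl, hm.1.le⟩
    have h3 := hτz p' ⟨le_rfl, hn.1.le⟩
    rw [A.left] at h2
    rw [B.left] at h3
    rw [← h2, ← h3]; exact h1
  · have htm : t ≤ m := by
      by_contra! h; linarith [hm2 t ⟨h, ht.2⟩]
    have hzt : z t ∈ Icc 0 (z m) :=
      ⟨A.nonneg t ht, hzm.monotoneOn ⟨ht.1, htm⟩ ⟨hm.1.le, le_rfl⟩ htm⟩
    have h1 := hmin hzt
    rw [hσz t ⟨ht.1, htm⟩] at h1
    have h2 := (hzτ (z t) (by rw [← htop]; exact hzt)).2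
    rw [← h1] at h2
    exact h2.symm

theorem Arc.eq_of_meet (hΨ : Regular Ψ R) (A : Arc Ψ p q z) (hA : ∀ s ∈ Ioo p q, z s < R)
    (B : Arc Ψ p' q' z') (hB : ∀ s ∈ Ioo p' q', z' s < R) {s : ℝ} (hs : s ∈ Icc p q)
    (hs' : s ∈ Icc p' q') (heq : z s = z' s) :
    p = p' ∧ q = q' ∧ EqOn z z' (Icc p q) := by
  have hA' : ∀ s ∈ Ioo (-q) (-p), z (-s) < R :=
    fun s hs => hA (-s) ⟨by linarith [hs.2], by linarith [hs.1]⟩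
  have hB' : ∀ s ∈ Ioo (-q') (-p'), z' (-s) < R :=
    fun s hs => hB (-s) ⟨by linarith [hs.2], by linarith [hs.1]⟩
  -- Depending on the side on which the arcs meet, one half is settled directly; the shared vertex
  -- then serves as the meeting point for the other half, treated by reflection.
  have both : (p = p' ∧ ∀ t ∈ Icc p q, t ≤ Ψ (z t) → z t = z' t) ∧
      (-q = -q' ∧ ∀ t ∈ Icc (-q) (-p), t ≤ -Ψ (z (-t)) → z (-t) = z' (-t)) := by
    rcases le_total s (Ψ (z s)) with h | h
    · obtain ⟨h1, ⟨m, hm, hm', hm0, hmeq⟩, h2⟩ := A.eq_left_of_meet hΨ hA B hB hs hs' heq h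
      obtain ⟨h3, -, h4⟩ := A.reflect.eq_left_of_meet hΨ.neg hA' B.reflect hB' (s := -m)
        ⟨by linarith [hm.2], by linarith [hm.1]⟩ ⟨by linarith [hm'.2], by linarith [hm'.1]⟩
        (by simpa using hmeq) (by simp [hm0])
      exact ⟨⟨h1, h2⟩, h3, h4⟩
    · obtain ⟨h1, ⟨m, hm, hm', hm0, hmeq⟩, h2⟩ := A.reflect.eq_left_of_meet hΨ.neg hA'
        B.reflect hB' (s := -s) ⟨by linarith [hs.2], by linarith [hs.1]⟩
        ⟨by linarith [hs'.2], by linarith [hs'.1]⟩ (by simpa using heq) (by simpa using h)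
      obtain ⟨h3, -, h4⟩ := A.eq_left_of_meet hΨ hA B hB (s := -m)
        ⟨by linarith [hm.2], by linarith [hm.1]⟩ ⟨by linarith [hm'.2], by linarith [hm'.1]⟩
        hmeq (by linarith)
      exact ⟨⟨h3, h4⟩, h1, h2⟩
  refine ⟨both.1.1, neg_inj.1 both.2.1, fun t ht => ?_⟩
  rcases le_total t (Ψ (z t)) with h | h
  · exact both.1.2 t ht h
  · have := both.2.2 (-t) ⟨by linarith [ht.2], by linarith [ht.1]⟩ (by simpa using h)
    simpa using this

/-- Arcs are nested: the outer one at the left end is the outer one everywhere. -/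
theorem Arc.lt_of_lt (hΨ : Regular Ψ R) (A : Arc Ψ p q z) (hA : ∀ s ∈ Ioo p q, z s < R)
    (B : Arc Ψ p' q' z') (hB : ∀ s ∈ Ioo p' q', z' s < R) (hlt : p' < p) :
    q < q' ∧ ∀ s ∈ Icc p q, z s < z' s := by
  have hne : ∀ s ∈ Icc p q, s ∈ Icc p' q' → z s ≠ z' s := fun s hs hs' h =>
    hlt.ne' (A.eq_of_meet hΨ hA B hB hs hs' h).1
  have hp0 : z p < z' p := by
    rw [A.left]; exact B.posIoo p ⟨hlt, A.neg.trans B.pos⟩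
  have hlt_on : ∀ b ∈ Icc p q, b ≤ q' → z b < z' b := by
    intro b hb hbq
    by_contra! hge
    have hc : ContinuousOn (fun s => z s - z' s) (Icc p b) :=
      (A.cont.mono (Icc_subset_Icc_right hb.2)).sub (B.cont.mono (Icc_subset_Icc hlt.le hbq))
    obtain ⟨s, hs, hs0⟩ := intermediate_value_Icc hb.1 hc
      (show (0 : ℝ) ∈ Icc (z p - z' p) (z b - z' b) from ⟨by linarith, by linarith⟩)
    exact hne s ⟨hs.1, hs.2.trans hb.2⟩ ⟨hlt.le.trans hs.1, hs.2.trans hbq⟩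
      (sub_eq_zero.1 hs0)
  have hq : q < q' := by
    by_contra! h
    have hmem : q' ∈ Icc p q := ⟨(A.neg.trans B.pos).le, h⟩
    have h1 := hlt_on q' hmem le_rfl
    rw [B.right] at h1
    linarith [A.nonneg q' hmem]
  exact ⟨hq, fun s hs => hlt_on s hs (hs.2.trans hq.le)⟩

end

section

variable {Ψ : ℝ → ℝ} {R p q : ℝ} {z : ℝ → ℝ}

/-- The right half is the left half of the reflected arc. Hence `τ` is a branch for `-Ψ`, and the
point at level `r` on the right is `-τ r`. -/
theorem Arc.exists_branches (hΨ : Regular Ψ R) (A : Arc Ψ p q z) (hR : ∀ s ∈ Ioo p q, z s < R) :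
    ∃ m ∈ Ioo p q, ∃ σ τ, Ψ (z m) = m ∧ (∀ s ∈ Icc p q, z s ≤ z m) ∧
      Branch Ψ (z m) σ ∧ Branch (fun x => -Ψ x) (z m) τ ∧ σ 0 = p ∧ τ 0 = -q ∧
      ∀ r ∈ Icc 0 (z m), σ r ∈ Icc p m ∧ -τ r ∈ Icc m q ∧ z (σ r) = r ∧ z (-τ r) = r ∧
        ∀ s ∈ Icc (σ r) (-τ r), r ≤ z s := by
  obtain ⟨m, hm, hm0, hm1, hm2⟩ := A.exists_vertex hΨ hR
  obtain ⟨σ, bσ, hσz, hzσ, hmono⟩ := A.exists_branch hm hm1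
  obtain ⟨τ, bτ, hτz, hzτ, hmono'⟩ := A.reflect.exists_branch (m := -m)
    ⟨by linarith [hm.2], by linarith [hm.1]⟩
    (fun s hs => by linarith [hm2 (-s) ⟨by linarith [hs.2], by linarith [hs.1]⟩])
  rw [neg_neg] at bτ hzτ
  have hanti : ∀ s ∈ Icc m q, ∀ t ∈ Icc m q, s ≤ t → z t ≤ z s := by
    intro s hs t ht h
    have := hmono'.monotoneOn (a := -t) (b := -s) ⟨by linarith [ht.2], by linarith [ht.1]⟩
      ⟨by linarith [hs.2], by linarith [hs.1]⟩ (by linarith)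
    simpa using this
  refine ⟨m, hm, σ, τ, hm0, fun s hs => ?_, bσ, bτ, ?_, ?_, fun r hr => ?_⟩
  · rcases le_total s m with h | h
    · exact hmono.monotoneOn ⟨hs.1, h⟩ ⟨hm.1.le, le_rfl⟩ h
    · exact hanti m ⟨le_rfl, hm.2.le⟩ s ⟨h, hs.2⟩ h
  · have := hσz p ⟨le_rfl, hm.1.le⟩
    rwa [A.left] at this
  · have := hτz (-q) ⟨le_rfl, by linarith [hm.2]⟩
    rwa [neg_neg, A.right] at this
  · obtain ⟨h1, h2⟩ := hzσ r hr
    obtain ⟨h3, h4⟩ := hzτ r hr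
    have h3' : -τ r ∈ Icc m q := ⟨by linarith [h3.2], by linarith [h3.1]⟩
    refine ⟨h1, h3', h2, h4, fun s hs => ?_⟩
    rcases le_total s m with h | h
    · rw [← h2]; exact hmono.monotoneOn h1 ⟨h1.1.trans hs.1, h⟩ hs.1
    · rw [← h4]; exact hanti s ⟨h, hs.2.trans h3'.2⟩ _ h3' hs.2

theorem Arc.hasDerivAt_energy (A : Arc Ψ p q z) {s : ℝ} (hs : s ∈ Ioo p q) :
    HasDerivAt (fun s => z s + s ^ 2 / 2) (Ψ (z s)) s := by
  have h2 : HasDerivAt (fun s : ℝ => s ^ 2 / 2) s s := by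
    have := (hasDerivAt_pow 2 s).div_const 2
    exact this.congr_deriv (by simp)
  exact ((A.deriv s hs).add h2).congr_deriv (by ring)

theorem Arc.continuousOn_energy (A : Arc Ψ p q z) :
    ContinuousOn (fun s => z s + s ^ 2 / 2) (Icc p q) := A.cont.add (by fun_prop)

end

/-! ### The energy comparison: at most one symmetric arc -/

section

variable {Ψ : ℝ → ℝ} {a R Y Y' : ℝ} {z z' : ℝ → ℝ}

/-- A symmetric arc must leave the region where `Ψ` is positive. -/
theorem Arc.lt_top_of_symmetric (A : Arc Ψ (-Y) Y z) (hpos : ∀ x ∈ Ioo 0 a, 0 < Ψ x) {m : ℝ}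
    (hm : m ∈ Ioo (-Y) Y) (htop : ∀ s ∈ Ioo (-Y) Y, s ≠ m → z s < z m) : a < z m := by
  by_contra! h
  -- The energy `z + s²/2` has derivative `Ψ(z) > 0` except perhaps at the vertex, where `z` may
  -- equal `a`; the two sides are treated apart. But the energy at both ends is `Y²/2`.
  have hlt : (-Y) ^ 2 / 2 + z (-Y) < Y ^ 2 / 2 + z Y := by
    have hmono : ∀ b c, -Y ≤ b → b < c → c ≤ Y → (∀ s ∈ Ioo b c, s ≠ m) →
        z b + b ^ 2 / 2 < z c + c ^ 2 / 2 := by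
      intro b c hb hbc hc hne
      have : StrictMonoOn (fun s => z s + s ^ 2 / 2) (Icc b c) := by
        refine strictMonoOn_of_hasDerivWithinAt_pos (convex_Icc b c)
          (A.continuousOn_energy.mono (Icc_subset_Icc hb hc)) (f' := fun s => Ψ (z s)) ?_ ?_
        · rw [interior_Icc]
          exact fun s hs => (A.hasDerivAt_energy
            ⟨hb.trans_lt hs.1, hs.2.trans_le hc⟩).hasDerivWithinAt
        · rw [interior_Icc]
          intro s hs
          have hs' : s ∈ Ioo (-Y) Y := ⟨hb.trans_lt hs.1, hs.2.trans_le hc⟩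
          exact hpos _ ⟨A.posIoo s hs', (htop s hs' (hne s hs)).trans_le h⟩
      exact this ⟨le_rfl, hbc.le⟩ ⟨hbc.le, le_rfl⟩ hbc
    have h1 := hmono (-Y) m le_rfl hm.1 hm.2.le fun s hs => hs.2.ne
    have h2 := hmono m Y hm.1.le hm.2 le_rfl fun s hs => hs.1.ne'
    linarith
  rw [A.left, A.right] at hlt
  nlinarith

theorem Arc.exists_top_gt (hΨ : Regular Ψ R) (A : Arc Ψ (-Y) Y z)
    (hR : ∀ s ∈ Ioo (-Y) Y, z s < R) (hpos : ∀ x ∈ Ioo 0 a, 0 < Ψ x) :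
    ∃ s ∈ Ioo (-Y) Y, a < z s := by
  obtain ⟨m, hm, hm0, hm1, hm2⟩ := A.exists_vertex hΨ hR
  refine ⟨m, hm, A.lt_top_of_symmetric hpos hm fun s hs hne => ?_⟩
  rcases lt_or_gt_of_ne hne with h | h
  · obtain ⟨σ, -, -, -, hmono⟩ := A.exists_branch hm hm1
    exact hmono ⟨hs.1.le, h.le⟩ ⟨hm.1.le, le_rfl⟩ h
  · obtain ⟨τ, -, -, -, hmono⟩ := A.reflect.exists_branch (m := -m)
      ⟨by linarith [hm.2], by linarith [hm.1]⟩
      (fun s hs => by linarith [hm2 (-s) ⟨by linarith [hs.2], by linarith [hs.1]⟩])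
    have := hmono (a := -s) (b := -m) ⟨by linarith [hs.2], by linarith⟩
      ⟨by linarith [hm.2], le_rfl⟩ (by linarith)
    simpa using this

/-- If `A` lay inside `B`, then `B` would gain less energy than `A` below the level `a`, on either
side. Above that level `B` changes by at most as much as `A` over the `s`-interval of `A`, and does
not gain on the two extra pieces. So the total changes would differ, while both are zero. -/
theorem Arc.not_lt_of_symmetric (hΨ : Regular Ψ R) (ha : 0 < a) (hpos : ∀ x ∈ Ioo 0 a, 0 < Ψ x)
    (hneg : ∀ x ∈ Ico a R, Ψ x ≤ 0) (hanti : AntitoneOn Ψ (Ico a R))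
    (A : Arc Ψ (-Y) Y z) (hA : ∀ s ∈ Ioo (-Y) Y, z s < R)
    (B : Arc Ψ (-Y') Y' z') (hB : ∀ s ∈ Ioo (-Y') Y', z' s < R) : ¬ Y < Y' := by
  intro hlt
  obtain ⟨-, hord⟩ := A.lt_of_lt hΨ hA B hB (by linarith)
  obtain ⟨s₀, hs₀, has₀⟩ := A.exists_top_gt hΨ hA hpos
  obtain ⟨m, hm, σ, τ, -, hmax, bσ, bτ, hσ0, hτ0, hb⟩ := A.exists_branches hΨ hA
  obtain ⟨m', hm', σ', τ', -, hmax', bσ', bτ', hσ0', hτ0', hb'⟩ := B.exists_branches hΨ hB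
  have haz : a < z m := has₀.trans_le (hmax _ (Ioo_subset_Icc_self hs₀))
  have haz' : a < z' m' := by
    have h1 := hord s₀ (Ioo_subset_Icc_self hs₀)
    have h2 := hmax' s₀ ⟨by linarith [hs₀.1], by linarith [hs₀.2]⟩
    linarith
  -- Branches ordered at `0` cannot cross, since a common value would force equality at `0`.
  have key : ∀ {Φ : ℝ → ℝ} {α β : ℝ → ℝ}, Continuous Φ → Branch Φ a α → Branch Φ a β →
      β 0 < α 0 → ∀ r ∈ Icc 0 a, β r < α r := by
    intro Φ α β hΦ bα bβ h0 r hr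
    by_contra! hge
    have hc : ContinuousOn (fun s => β s - α s) (Icc 0 r) :=
      (bβ.cont.sub bα.cont).mono (Icc_subset_Icc_right hr.2)
    obtain ⟨t, ht, ht0⟩ := intermediate_value_Icc hr.1 hc
      (show (0 : ℝ) ∈ Icc (β 0 - α 0) (β r - α r) from ⟨by linarith, by linarith⟩)
    have := bβ.eqOn_of_eq hΦ bα (r := t) ⟨ht.1, ht.2.trans hr.2⟩ (sub_eq_zero.1 ht0)
      ⟨le_rfl, ha.le⟩
    linarith
  have cσ := bσ.mono haz.le
  have cτ := bτ.mono haz.le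
  have cσ' := bσ'.mono haz'.le
  have cτ' := bτ'.mono haz'.le
  have oσ := key hΨ.cont cσ cσ' (by rw [hσ0, hσ0']; linarith)
  have oτ := key hΨ.cont.neg cτ cτ' (by rw [hτ0, hτ0']; linarith)
  -- At equal levels `z` the energies differ by half the difference of the squares of `s`; `g1` and
  -- `g2` compare the gains on the rising and on the falling sides.
  have g1 := cσ.sq_sub_sq_lt ha cσ' (fun r hr => oσ r (Ioo_subset_Icc_self hr)) hpos
  have g2 := cτ.lt_sq_sub_sq ha cτ' (fun r hr => oτ r (Ioo_subset_Icc_self hr))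
    (fun r hr => by linarith [hpos r hr])
  rw [hσ0, hσ0'] at g1
  rw [hτ0, hτ0'] at g2
  obtain ⟨i1, i2, i3, i4, i5⟩ := hb a ⟨ha.le, haz.le⟩
  obtain ⟨j1, j2, j3, j4, j5⟩ := hb' a ⟨ha.le, haz'.le⟩
  have o1 := oσ a ⟨ha.le, le_rfl⟩
  have o2 := oτ a ⟨ha.le, le_rfl⟩
  -- the energy of `B` decreases above the level `a`
  have dB : ∀ b c, σ' a ≤ b → b ≤ c → c ≤ -τ' a → z' c + c ^ 2 / 2 ≤ z' b + b ^ 2 / 2 := by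
    intro b c hb1 hbc hc1
    have : AntitoneOn (fun s => z' s + s ^ 2 / 2) (Icc b c) := by
      refine antitoneOn_of_hasDerivWithinAt_nonpos (convex_Icc b c)
        (B.continuousOn_energy.mono (Icc_subset_Icc (j1.1.trans hb1) (hc1.trans j2.2)))
        (f' := fun s => Ψ (z' s)) ?_ ?_
      · rw [interior_Icc]
        exact fun s hs => (B.hasDerivAt_energy ⟨by linarith [hs.1, j1.1],
          by linarith [hs.2, j2.2]⟩).hasDerivWithinAt
      · rw [interior_Icc]
        exact fun s hs => hneg _ ⟨j5 s ⟨by linarith [hs.1], by linarith [hs.2]⟩,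
          hB s ⟨by linarith [hs.1, j1.1], by linarith [hs.2, j2.2]⟩⟩
    exact this ⟨le_rfl, hbc⟩ ⟨hbc, le_rfl⟩ hbc
  -- Here both arcs are compared at the same `s`, where `z ≤ z'` and `Ψ` is nonincreasing.
  have hAB : (z' (-τ a) + (-τ a) ^ 2 / 2) - (z (-τ a) + (-τ a) ^ 2 / 2) ≤
      (z' (σ a) + (σ a) ^ 2 / 2) - (z (σ a) + (σ a) ^ 2 / 2) := by
    have hle : σ a ≤ -τ a := i1.2.trans i2.1
    have : AntitoneOn (fun s => (z' s + s ^ 2 / 2) - (z s + s ^ 2 / 2)) (Icc (σ a) (-τ a)) := by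
      refine antitoneOn_of_hasDerivWithinAt_nonpos (convex_Icc _ _)
        ((B.continuousOn_energy.mono (Icc_subset_Icc (by linarith [i1.1]) (by linarith [i2.2]))).sub
          (A.continuousOn_energy.mono (Icc_subset_Icc i1.1 i2.2)))
        (f' := fun s => Ψ (z' s) - Ψ (z s)) ?_ ?_
      · rw [interior_Icc]
        exact fun s hs => ((B.hasDerivAt_energy ⟨by linarith [hs.1, i1.1],
          by linarith [hs.2, i2.2]⟩).sub (A.hasDerivAt_energy ⟨by linarith [hs.1, i1.1],
          by linarith [hs.2, i2.2]⟩)).hasDerivWithinAt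
      · rw [interior_Icc]
        intro s hs
        have hsA : s ∈ Ioo (-Y) Y := ⟨by linarith [hs.1, i1.1], by linarith [hs.2, i2.2]⟩
        have hsB : s ∈ Ioo (-Y') Y' := ⟨by linarith [hsA.1], by linarith [hsA.2]⟩
        have h1 := i5 s (Ioo_subset_Icc_self hs)
        have h2 := hord s (Ioo_subset_Icc_self hsA)
        linarith [hanti ⟨h1, hA s hsA⟩ ⟨h1.trans h2.le, hB s hsB⟩ h2.le]
    exact this ⟨le_rfl, hle⟩ ⟨hle, le_rfl⟩ hle
  have d1 := dB (σ' a) (σ a) le_rfl o1.le (by linarith [i1.2, i2.1])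
  have d2 := dB (-τ a) (-τ' a) (by linarith [i1.2, i2.1]) (by linarith) le_rfl
  rw [i3, i4] at hAB
  rw [j3] at d1
  rw [j4] at d2
  nlinarith

/-- There is at most one symmetric arc. -/
theorem Arc.symmetric_unique (hΨ : Regular Ψ R) (ha : 0 < a) (hpos : ∀ x ∈ Ioo 0 a, 0 < Ψ x)
    (hneg : ∀ x ∈ Ico a R, Ψ x ≤ 0) (hanti : AntitoneOn Ψ (Ico a R))
    (A : Arc Ψ (-Y) Y z) (hA : ∀ s ∈ Ioo (-Y) Y, z s < R)
    (B : Arc Ψ (-Y') Y' z') (hB : ∀ s ∈ Ioo (-Y') Y', z' s < R) :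
    Y = Y' ∧ EqOn z z' (Icc (-Y) Y) := by
  have h1 := A.not_lt_of_symmetric hΨ ha hpos hneg hanti hA B hB
  have h2 := B.not_lt_of_symmetric hΨ ha hpos hneg hanti hB A hA
  obtain rfl : Y = Y' := le_antisymm (not_lt.1 h2) (not_lt.1 h1)
  exact ⟨rfl, (A.eq_of_meet hΨ hA B hB (left_mem_Icc.2 A.lt.le) (left_mem_Icc.2 A.lt.le)
    (by rw [A.left, B.left])).2.2⟩

end

/-! ### From the Liénard plane to arcs -/

theorem isOpen_symInterval (d : EReal) : IsOpen (symInterval d) :=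
  isOpen_lt (continuous_coe_real_ereal.comp continuous_abs) continuous_const

theorem mem_symInterval_of_abs_le {d : EReal} {x y : ℝ} (hy : y ∈ symInterval d)
    (h : |x| ≤ |y|) : x ∈ symInterval d :=
  lt_of_le_of_lt (EReal.coe_le_coe_iff.2 h) hy

theorem mem_symInterval_iff_of_nonneg {d : EReal} {x : ℝ} (hx : 0 ≤ x) :
    x ∈ symInterval d ↔ (x : EReal) < d := by
  rw [symInterval, mem_ofPred_eq, abs_of_nonneg hx]

theorem neg_mem_symInterval {d : EReal} {x : ℝ} (hx : x ∈ symInterval d) : -x ∈ symInterval d :=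
  mem_symInterval_of_abs_le hx (abs_neg x).le

theorem Icc_subset_symInterval {d : EReal} {b : ℝ} (hb : b ∈ symInterval d) :
    Icc 0 b ⊆ symInterval d := fun _ hx =>
  mem_symInterval_of_abs_le hb (abs_le_abs_of_nonneg hx.1 hx.2)

@[simp] theorem primitive_zero (h : ℝ → ℝ) : primitive h 0 = 0 := by simp [primitive]

theorem hasDerivAt_primitive {h : ℝ → ℝ} {d : EReal} (hh : ContinuousOn h (symInterval d)) {x : ℝ}
    (hx : x ∈ symInterval d) : HasDerivAt (primitive h) (h x) x := by
  have hsub : uIcc 0 x ⊆ symInterval d := by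
    intro t ht
    refine mem_symInterval_of_abs_le hx ?_
    have := abs_sub_left_of_mem_uIcc ht
    simpa using this
  refine intervalIntegral.integral_hasDerivAt_right ?_ ?_ ?_
  · exact (hh.mono hsub).intervalIntegrable
  · exact hh.stronglyMeasurableAtFilter (isOpen_symInterval d) x hx
  · exact hh.continuousAt ((isOpen_symInterval d).mem_nhds hx)

/-- The standing regularity, symmetry and sign hypotheses on the Liénard equation. -/
structure Hyp (f g : ℝ → ℝ) (d : EReal) : Prop where
  f_cont : ContinuousOn f (symInterval d)
  g_cont : ContinuousOn g (symInterval d)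
  F_odd : ∀ x ∈ symInterval d, primitive f (-x) = -primitive f x
  g_odd : ∀ x ∈ symInterval d, g (-x) = -g x
  g_pos : ∀ x ∈ symInterval d, 0 < x → 0 < g x

/-- `X` inverts the potential `G` on `[0, b]` and is constant outside `[0, G b]`. -/
structure PotentialInverse (g : ℝ → ℝ) (b : ℝ) (X : ℝ → ℝ) : Prop where
  cont : Continuous X
  mem : ∀ r, X r ∈ Icc 0 b
  left_inv : ∀ x ∈ Icc 0 b, X (primitive g x) = x
  right_inv : ∀ r ∈ Icc 0 (primitive g b), primitive g (X r) = r
  mem_Ioo : ∀ r ∈ Ioo 0 (primitive g b), X r ∈ Ioo 0 b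
  of_nonpos : ∀ r ≤ 0, X r = 0
  of_ge : ∀ r, primitive g b ≤ r → X r = b
  deriv : ∀ r ∈ Ioo 0 (primitive g b), HasDerivAt X (g (X r))⁻¹ r

section

variable {f g : ℝ → ℝ} {d : EReal} {b : ℝ} {X : ℝ → ℝ}

theorem Hyp.hasDerivAt_F (H : Hyp f g d) {x : ℝ} (hx : x ∈ symInterval d) :
    HasDerivAt (primitive f) (f x) x := hasDerivAt_primitive H.f_cont hx

theorem Hyp.hasDerivAt_G (H : Hyp f g d) {x : ℝ} (hx : x ∈ symInterval d) :
    HasDerivAt (primitive g) (g x) x := hasDerivAt_primitive H.g_cont hx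

theorem Hyp.continuousOn_F (H : Hyp f g d) : ContinuousOn (primitive f) (symInterval d) :=
  fun _ hx => (H.hasDerivAt_F hx).continuousAt.continuousWithinAt

theorem Hyp.continuousOn_G (H : Hyp f g d) : ContinuousOn (primitive g) (symInterval d) :=
  fun _ hx => (H.hasDerivAt_G hx).continuousAt.continuousWithinAt

theorem Hyp.strictMonoOn_G (H : Hyp f g d) (hb : b ∈ symInterval d) :
    StrictMonoOn (primitive g) (Icc 0 b) := by
  have hsub := Icc_subset_symInterval hb
  refine strictMonoOn_of_hasDerivWithinAt_pos (convex_Icc 0 b) (H.continuousOn_G.mono hsub)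
    (f' := g) ?_ ?_
  · rw [interior_Icc]
    exact fun x hx => (H.hasDerivAt_G (hsub (Ioo_subset_Icc_self hx))).hasDerivWithinAt
  · rw [interior_Icc]
    exact fun x hx => H.g_pos x (hsub (Ioo_subset_Icc_self hx)) hx.1

theorem Hyp.G_pos (H : Hyp f g d) (hb : b ∈ symInterval d) (h0 : 0 < b) : 0 < primitive g b := by
  have := H.strictMonoOn_G hb ⟨le_rfl, h0.le⟩ ⟨h0.le, le_rfl⟩ h0
  rwa [primitive_zero] at this

theorem Hyp.G_neg (H : Hyp f g d) (hb : b ∈ symInterval d) :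
    primitive g (-b) = primitive g b := by
  have h1 : ∀ x ∈ uIcc 0 (-b), g x = -g (-x) := by
    intro x hx
    have h2 : x ∈ symInterval d := by
      refine mem_symInterval_of_abs_le (neg_mem_symInterval hb) ?_
      have := abs_sub_left_of_mem_uIcc hx
      simpa using this
    rw [H.g_odd x h2, neg_neg]
  rw [primitive, intervalIntegral.integral_congr h1, intervalIntegral.integral_neg,
    intervalIntegral.integral_comp_neg (fun x => g x), neg_neg, neg_zero,
    intervalIntegral.integral_symm, neg_neg, primitive]

theorem Hyp.exists_potentialInverse (H : Hyp f g d) (h0 : 0 < b) (hb : b ∈ symInterval d) :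
    ∃ X, PotentialInverse g b X := by
  have hsub := Icc_subset_symInterval hb
  obtain ⟨X, hXc, hXm, hXI, hl, hr, ho, hd⟩ := exists_inverse_of_strictMonoOn h0.le
    (H.continuousOn_G.mono hsub) (H.strictMonoOn_G hb)
  rw [primitive_zero] at hr ho
  have hX0 : X 0 = 0 := by
    have := hl 0 ⟨le_rfl, h0.le⟩
    rwa [primitive_zero] at this
  refine ⟨X, hXc, hXI, hl, hr, ho, fun r h => ?_, fun r h => ?_, fun r h => ?_⟩
  · exact le_antisymm ((hXm h).trans hX0.le) (hXI r).1
  · refine le_antisymm (hXI r).2 ?_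
    have := hXm h
    rwa [hl b ⟨h0.le, le_rfl⟩] at this
  · have h1 := ho r h
    have h2 := hsub (Ioo_subset_Icc_self h1)
    have h3 := hd _ h1 _ (H.g_pos _ h2 h1.1).ne' (H.hasDerivAt_G h2)
    rwa [hr r (Ioo_subset_Icc_self h)] at h3

/-- The function `Ψ = -F ∘ G⁻¹` of the transformed equation `dz/ds = Ψ z - s`. -/
def transform (f : ℝ → ℝ) (X : ℝ → ℝ) (r : ℝ) : ℝ := -primitive f (X r)

theorem Hyp.continuous_transform (H : Hyp f g d) (hb : b ∈ symInterval d)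
    (hX : PotentialInverse g b X) : Continuous (transform f X) :=
  (H.continuousOn_F.comp_continuous hX.cont
    fun r => Icc_subset_symInterval hb (hX.mem r)).neg

theorem PotentialInverse.transform_of_nonpos (hX : PotentialInverse g b X) :
    ∀ r ≤ 0, transform f X r = 0 := fun r hr => by
  simp [transform, hX.of_nonpos r hr]

/-- Inside the interval `Ψ' = -f/g` at `X r`. The quotient may blow up at `0`, where `g` vanishes,
so `Ψ` is only claimed to be continuous there. -/
theorem Hyp.regular_transform (H : Hyp f g d) (hb : b ∈ symInterval d)
    (hX : PotentialInverse g b X) : Regular (transform f X) (primitive g b) where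
  cont := H.continuous_transform hb hX
  zero := hX.transform_of_nonpos 0 le_rfl
  diff r hr := by
    have h1 := Icc_subset_symInterval hb (hX.mem r)
    exact ((H.hasDerivAt_F h1).comp r (hX.deriv r hr)).differentiableAt.neg

theorem PotentialInverse.transform_projIcc (hX : PotentialInverse g b X)
    (h : 0 ≤ primitive g b) (r : ℝ) :
    transform f X (projIcc 0 (primitive g b) h r) = transform f X r := by
  simp only [transform]
  rcases le_total r 0 with h1 | h1
  · rw [projIcc_of_le_left h h1, hX.of_nonpos r h1, hX.of_nonpos 0 le_rfl]
  rcases le_total (primitive g b) r with h2 | h2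
  · rw [projIcc_of_right_le h h2, hX.of_ge r h2, hX.of_ge _ le_rfl]
  · rw [projIcc_of_mem h ⟨h1, h2⟩]

theorem PotentialInverse.transform_apply (hX : PotentialInverse g b X) {x : ℝ}
    (hx : x ∈ Icc 0 b) : transform f X (primitive g x) = -primitive f x := by
  rw [transform, hX.left_inv x hx]

/-- A half orbit in `x ≥ 0` is an arc of the transformed equation. -/
theorem Hyp.exists_arc_of_half_orbit (H : Hyp f g d) (hb : b ∈ symInterval d)
    (hX : PotentialInverse g b X) {t₀ t₁ : ℝ} (ht : t₀ < t₁) {γ : ℝ → ℝ × ℝ}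
    (hγ : ∀ t ∈ Icc t₀ t₁, HasDerivWithinAt γ (lienardField f g (γ t)) (Icc t₀ t₁) t)
    (h0 : (γ t₀).1 = 0) (h1 : (γ t₁).1 = 0) (hpos : ∀ t ∈ Ioo t₀ t₁, 0 < (γ t).1)
    (hlt : ∀ t ∈ Icc t₀ t₁, (γ t).1 < b) (hy0 : 0 < (γ t₀).2) (hy1 : (γ t₁).2 < 0) :
    ∃ z, Arc (transform f X) (-(γ t₀).2) (-(γ t₁).2) z ∧
      (∀ t ∈ Icc t₀ t₁, -(γ t).2 ∈ Icc (-(γ t₀).2) (-(γ t₁).2) ∧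
        z (-(γ t).2) = primitive g (γ t).1) ∧
      (∀ t ∈ Ioo t₀ t₁, -(γ t).2 ∈ Ioo (-(γ t₀).2) (-(γ t₁).2)) ∧
      (∀ s ∈ Ioo (-(γ t₀).2) (-(γ t₁).2), ∃ t ∈ Ioo t₀ t₁, -(γ t).2 = s) ∧
      ∀ s ∈ Icc (-(γ t₀).2) (-(γ t₁).2), z s < primitive g b := by
  have hcont : ContinuousOn γ (Icc t₀ t₁) := fun t ht => (hγ t ht).continuousWithinAt
  have hmem : ∀ t ∈ Icc t₀ t₁, (γ t).1 ∈ Icc 0 b := by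
    intro t ht'
    refine ⟨?_, (hlt t ht').le⟩
    rcases ht'.1.eq_or_lt with rfl | h2
    · exact h0.ge
    rcases ht'.2.eq_or_lt with rfl | h3
    · exact h1.ge
    · exact (hpos t ⟨h2, h3⟩).le
  have hd : ∀ t ∈ Ioo t₀ t₁, HasDerivAt γ (lienardField f g (γ t)) t := fun t ht' =>
    (hγ t (Ioo_subset_Icc_self ht')).hasDerivAt (Icc_mem_nhds ht'.1 ht'.2)
  have hdx : ∀ t ∈ Ioo t₀ t₁, HasDerivAt (fun t => (γ t).1) ((γ t).2 - primitive f (γ t).1) t :=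
    fun t ht' => (hd t ht').fst
  have hdy : ∀ t ∈ Ioo t₀ t₁, HasDerivAt (fun t => -(γ t).2) (g (γ t).1) t :=
    fun t ht' => HasDerivAt.congr_deriv (HasDerivAt.neg
      (show HasDerivAt (fun t => (γ t).2) (-g (γ t).1) t from (hd t ht').snd)) (neg_neg _)
  have hyc : ContinuousOn (fun t => -(γ t).2) (Icc t₀ t₁) :=
    (continuous_snd.comp_continuousOn hcont).neg
  have hsym : ∀ t ∈ Icc t₀ t₁, (γ t).1 ∈ symInterval d :=
    fun t ht' => Icc_subset_symInterval hb (hmem t ht')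
  have hgp : ∀ t ∈ Ioo t₀ t₁, 0 < g (γ t).1 :=
    fun t ht' => H.g_pos _ (hsym t (Ioo_subset_Icc_self ht')) (hpos t ht')
  -- Since `y' = -g(x) < 0` for `x > 0`, time can be replaced by the parameter `s = -y`.
  have hmono : StrictMonoOn (fun t => -(γ t).2) (Icc t₀ t₁) := by
    refine strictMonoOn_of_hasDerivWithinAt_pos (convex_Icc t₀ t₁) hyc
      (f' := fun t => g (γ t).1) ?_ ?_
    · rw [interior_Icc]; exact fun t ht' => (hdy t ht').hasDerivWithinAt
    · rw [interior_Icc]; exact hgp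
  obtain ⟨k, hkc, -, hkI, hkl, hkr, hko, hkd⟩ := exists_inverse_of_strictMonoOn ht.le hyc hmono
  have l0 : t₀ ∈ Icc t₀ t₁ := ⟨le_rfl, ht.le⟩
  have l1 : t₁ ∈ Icc t₀ t₁ := ⟨ht.le, le_rfl⟩
  have hb0 : b ∈ Icc 0 b := ⟨(hmem t₀ l0).1.trans (hmem t₀ l0).2, le_rfl⟩
  have hkd' : ∀ s ∈ Ioo (-(γ t₀).2) (-(γ t₁).2), HasDerivAt k (g (γ (k s)).1)⁻¹ s := by
    intro s hs
    have h2 := hkd _ (hko s hs) _ (hgp _ (hko s hs)).ne' (hdy _ (hko s hs))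
    have h3 := hkr s (Ioo_subset_Icc_self hs)
    rwa [h3] at h2
  refine ⟨fun s => primitive g (γ (k s)).1, ⟨by linarith, by linarith, ?_, ?_, ?_, ?_, ?_⟩,
    fun t ht' => ⟨?_, ?_⟩, fun t ht' => ?_, fun s hs => ?_, fun s hs => ?_⟩
  · refine H.continuousOn_G.comp ?_ (fun s hs => hsym _ (hkI s))
    exact (continuous_fst.comp_continuousOn hcont).comp hkc.continuousOn fun s _ => hkI s
  · rw [hkl t₀ l0, h0, primitive_zero]
  · rw [hkl t₁ l1, h1, primitive_zero]
  · intro s hs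
    exact H.G_pos (hsym _ (hkI s)) (hpos _ (hko s hs))
  · intro s hs
    have h2 := ((H.hasDerivAt_G (hsym _ (hkI s))).comp s
      ((hdx _ (hko s hs)).comp s (hkd' s hs)))
    refine h2.congr_deriv ?_
    have h3 := (hgp _ (hko s hs)).ne'
    rw [hX.transform_apply (hmem _ (hkI s))]
    have h4 : -(γ (k s)).2 = s := hkr s (Ioo_subset_Icc_self hs)
    rw [mul_comm, mul_assoc, inv_mul_cancel₀ h3, mul_one]
    linarith
  · exact ⟨hmono.monotoneOn l0 ht' ht'.1, hmono.monotoneOn ht' l1 ht'.2⟩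
  · dsimp only
    rw [hkl t ht']
  · exact ⟨hmono l0 (Ioo_subset_Icc_self ht') ht'.1, hmono (Ioo_subset_Icc_self ht') l1 ht'.2⟩
  · exact ⟨k s, hko s hs, hkr s (Ioo_subset_Icc_self hs)⟩
  · exact H.strictMonoOn_G hb (hmem _ (hkI s)) hb0 (hlt _ (hkI s))

end

/-! ### From arcs back to periodic orbits -/

/-- Time is recovered from `dt = ds / g(x)`, and `1/g` blows up at the ends of an arc. It is
integrable there because `dx/ds = (1/g) · φ` is, with `φ` bounded away from zero. -/
theorem integrableOn_of_hasDerivAt_mul {x ζ φ : ℝ → ℝ} {c e δ : ℝ} (hx : ContinuousOn x (Icc c e))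
    (hd : ∀ s ∈ Ioo c e, HasDerivAt x (ζ s * φ s) s) (hζ : ∀ s ∈ Ioo c e, 0 < ζ s)
    (hζc : ContinuousOn ζ (Ioo c e)) (hδ : 0 < δ) (hφ : ∀ s ∈ Ioo c e, δ ≤ φ s) :
    MeasureTheory.IntegrableOn ζ (Ioo c e) := by
  have h1 : MeasureTheory.IntegrableOn (fun s => ζ s * φ s) (Ioo c e) :=
    (intervalIntegral.integrableOn_deriv_of_nonneg hx hd
      fun s hs => mul_nonneg (hζ s hs).le (hδ.le.trans (hφ s hs))).mono_set Ioo_subset_Ioc_self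
  refine (h1.const_mul δ⁻¹).mono' (hζc.aestronglyMeasurable measurableSet_Ioo) ?_
  rw [MeasureTheory.ae_restrict_iff' measurableSet_Ioo]
  refine Eventually.of_forall fun s hs => ?_
  rw [Real.norm_of_nonneg (hζ s hs).le, le_inv_mul_iff₀ hδ, mul_comm]
  exact mul_le_mul_of_nonneg_left (hφ s hs) (hζ s hs).le

/-- Near `p` the factor `φ` is bounded below, near `q` its negative is, and in between `ζ` is
continuous on a compact interval. -/
theorem integrableOn_of_hasDerivAt_mul_of_sign {x ζ φ : ℝ → ℝ} {p q : ℝ} (hpq : p < q)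
    (hx : ContinuousOn x (Icc p q)) (hd : ∀ s ∈ Ioo p q, HasDerivAt x (ζ s * φ s) s)
    (hζ : ∀ s ∈ Ioo p q, 0 < ζ s) (hζc : ContinuousOn ζ (Ioo p q))
    (hφ : ContinuousOn φ (Icc p q)) (hp : 0 < φ p) (hq : φ q < 0) :
    MeasureTheory.IntegrableOn ζ (Ioo p q) := by
  obtain ⟨c, hc, hcφ⟩ : ∃ c ∈ Ioo p q, ∀ s ∈ Ioo p c, φ p / 2 ≤ φ s := by
    have h1 : Tendsto φ (𝓝[>] p) (𝓝 (φ p)) := by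
      have := (hφ p ⟨le_rfl, hpq.le⟩).mono Ioo_subset_Icc_self
      rwa [ContinuousWithinAt, nhdsWithin_Ioo_eq_nhdsGT hpq] at this
    have h2 := (h1.eventually_const_lt (half_lt_self hp)).and (Ioo_mem_nhdsGT hpq)
    obtain ⟨c, hc, hsub⟩ := mem_nhdsGT_iff_exists_Ioc_subset.1 h2
    exact ⟨c, (hsub ⟨hc, le_rfl⟩).2, fun s hs => (hsub ⟨hs.1, hs.2.le⟩).1.le⟩
  obtain ⟨e, he, heφ⟩ : ∃ e ∈ Ioo p q, ∀ s ∈ Ioo e q, -φ q / 2 ≤ -φ s := by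
    have h1 : Tendsto φ (𝓝[<] q) (𝓝 (φ q)) := by
      have := (hφ q ⟨hpq.le, le_rfl⟩).mono Ioo_subset_Icc_self
      rwa [ContinuousWithinAt, nhdsWithin_Ioo_eq_nhdsLT hpq] at this
    have h2 := (h1.eventually_lt_const (show φ q < φ q / 2 by linarith)).and (Ioo_mem_nhdsLT hpq)
    obtain ⟨e, he, hsub⟩ := mem_nhdsLT_iff_exists_Ico_subset.1 h2
    refine ⟨e, (hsub ⟨le_rfl, he⟩).2, fun s hs => ?_⟩
    have := (hsub ⟨hs.1.le, hs.2⟩).1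
    linarith
  have i1 := integrableOn_of_hasDerivAt_mul (hx.mono (Icc_subset_Icc_right hc.2.le))
    (fun s hs => hd s ⟨hs.1, hs.2.trans hc.2⟩) (fun s hs => hζ s ⟨hs.1, hs.2.trans hc.2⟩)
    (hζc.mono (Ioo_subset_Ioo_right hc.2.le)) (half_pos hp) hcφ
  have i3 := integrableOn_of_hasDerivAt_mul (x := fun s => -x s) (φ := fun s => -φ s)
    (hx.mono (Icc_subset_Icc_left he.1.le)).neg
    (fun s hs => (hd s ⟨he.1.trans hs.1, hs.2⟩).neg.congr_deriv (by ring))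
    (fun s hs => hζ s ⟨he.1.trans hs.1, hs.2⟩)
    (hζc.mono (Ioo_subset_Ioo_left he.1.le)) (show 0 < -φ q / 2 by linarith) heφ
  have i2 : MeasureTheory.IntegrableOn ζ (Icc c e) :=
    (hζc.mono fun s hs => ⟨hc.1.trans_le hs.1, hs.2.trans_lt he.2⟩).integrableOn_Icc
  refine ((i1.union i2).union i3).mono_set fun s hs => ?_
  rcases lt_or_ge s c with h | h
  · exact Or.inl (Or.inl ⟨hs.1, h⟩)
  rcases le_or_gt s e with h' | h'
  · exact Or.inl (Or.inr ⟨h, h'⟩)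
  · exact Or.inr ⟨h', hs.2⟩

/-- A positive function, integrable on `(p, q)` and continuous there, is the derivative of a
time change. -/
theorem exists_time_change {ζ : ℝ → ℝ} {p q : ℝ} (hpq : p < q)
    (hint : MeasureTheory.IntegrableOn ζ (Ioo p q)) (hζ : ∀ s ∈ Ioo p q, 0 < ζ s)
    (hζc : ContinuousOn ζ (Ioo p q)) :
    ∃ T > 0, ∃ S : ℝ → ℝ, Continuous S ∧ (∀ t, S t ∈ Icc p q) ∧ S 0 = p ∧ S T = q ∧
      ∀ t ∈ Ioo 0 T, S t ∈ Ioo p q ∧ HasDerivAt S (ζ (S t))⁻¹ t := by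
  have hI : IntervalIntegrable ζ MeasureTheory.volume p q := by
    rw [intervalIntegrable_iff_integrableOn_Ioo_of_le hpq.le]; exact hint
  set τ : ℝ → ℝ := fun s => ∫ r in p..s, ζ r with hτ
  have hτc : ContinuousOn τ (Icc p q) := by
    have := intervalIntegral.continuousOn_primitive_interval' hI left_mem_uIcc
    rwa [uIcc_of_le hpq.le] at this
  have hτd : ∀ s ∈ Ioo p q, HasDerivAt τ (ζ s) s := by
    intro s hs
    refine intervalIntegral.integral_hasDerivAt_right ?_ ?_ ?_
    · refine hI.mono_set ?_
      rw [uIcc_of_le hs.1.le, uIcc_of_le hpq.le]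
      exact Icc_subset_Icc_right hs.2.le
    · exact hζc.stronglyMeasurableAtFilter isOpen_Ioo s hs
    · exact hζc.continuousAt (Ioo_mem_nhds hs.1 hs.2)
  have hmono : StrictMonoOn τ (Icc p q) := by
    refine strictMonoOn_of_hasDerivWithinAt_pos (convex_Icc p q) hτc (f' := ζ) ?_ ?_
    · rw [interior_Icc]; exact fun s hs => (hτd s hs).hasDerivWithinAt
    · rw [interior_Icc]; exact hζ
  have hτp : τ p = 0 := by simp [hτ]
  obtain ⟨S, hSc, -, hSI, hSl, hSr, hSo, hSd⟩ := exists_inverse_of_strictMonoOn hpq.le hτc hmono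
  have l0 : p ∈ Icc p q := ⟨le_rfl, hpq.le⟩
  have l1 : q ∈ Icc p q := ⟨hpq.le, le_rfl⟩
  rw [hτp] at hSr hSo
  refine ⟨τ q, by rw [← hτp]; exact hmono l0 l1 hpq, S, hSc, hSI, by rw [← hτp]; exact hSl p l0,
    hSl q l1, fun t ht => ⟨hSo t ht, ?_⟩⟩
  have h1 := hSd _ (hSo t ht) _ (hζ _ (hSo t ht)).ne' (hτd _ (hSo t ht))
  rwa [hSr t (Ioo_subset_Icc_self ht)] at h1

/-- Antiperiodic extension of a solution of an odd autonomous equation. -/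
theorem exists_antiperiodic_extension {E : Type*} [NormedAddCommGroup E] [NormedSpace ℝ E]
    {V : E → E} {γ : ℝ → E} {T : ℝ} (hT : 0 < T)
    (hγ : ∀ t ∈ Icc 0 T, HasDerivWithinAt γ (V (γ t)) (Icc 0 T) t) (hanti : γ T = -γ 0)
    (hodd : ∀ t ∈ Icc 0 T, V (-γ t) = -V (γ t)) :
    ∃ η : ℝ → E, (∀ t, HasDerivAt η (V (η t)) t) ∧ Function.Periodic η (2 * T) ∧
      (∀ t ∈ Icc 0 T, η t = γ t) ∧ ∀ t, ∃ s ∈ Icc 0 T, η t = γ s ∨ η t = -γ s := by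
  set η : ℝ → E := fun t => ((-1 : ℝ) ^ ⌊t / T⌋) • γ (t - ⌊t / T⌋ * T) with hη
  have hpiece : ∀ n : ℤ, ∀ t ∈ Icc (n * T) ((n + 1) * T),
      η t = ((-1 : ℝ) ^ n) • γ (t - n * T) := by
    intro n t ht
    rcases ht.2.eq_or_lt with h | h
    -- At the right end of a piece the floor has already jumped; `γ T = -γ 0` reconciles the two
    -- formulas.
    · have hfl : ⌊t / T⌋ = n + 1 := by
        rw [h, mul_div_cancel_right₀ _ hT.ne']
        exact_mod_cast Int.floor_intCast (n + 1)
      simp only [hη, hfl]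
      rw [zpow_add_one₀ (by norm_num), h]
      have e1 : ((n : ℝ) + 1) * T - n * T = T := by ring
      have e2 : ((n : ℝ) + 1) * T - ((n + 1 : ℤ) : ℝ) * T = 0 := by push_cast; ring
      rw [e1, e2, hanti]
      simp
    · have hfl : ⌊t / T⌋ = n := by
        rw [Int.floor_eq_iff, le_div_iff₀ hT, div_lt_iff₀ hT]
        exact ⟨ht.1, h⟩
      simp only [hη, hfl]
  have hsign : ∀ n : ℤ, ((-1 : ℝ) ^ n) = 1 ∨ ((-1 : ℝ) ^ n) = -1 := fun n => by
    rcases Int.even_or_odd n with h | h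
    · exact Or.inl h.neg_one_zpow
    · exact Or.inr h.neg_one_zpow
  have hV : ∀ n : ℤ, ∀ t ∈ Icc 0 T, V (((-1 : ℝ) ^ n) • γ t) = ((-1 : ℝ) ^ n) • V (γ t) := by
    intro n t ht
    rcases hsign n with h | h <;> rw [h]
    · simp
    · simpa using hodd t ht
  have hmap : ∀ n : ℤ, ∀ t ∈ Icc (n * T) ((n + 1) * T), t - n * T ∈ Icc 0 T := by
    intro n t ht
    constructor <;> nlinarith [ht.1, ht.2]
  have hd : ∀ n : ℤ, ∀ t ∈ Icc (n * T) ((n + 1) * T),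
      HasDerivWithinAt η (V (η t)) (Icc (n * T) ((n + 1) * T)) t := by
    intro n t ht
    have h1 : HasDerivWithinAt (fun t => ((-1 : ℝ) ^ n) • γ (t - n * T))
        (((-1 : ℝ) ^ n) • V (γ (t - n * T))) (Icc (n * T) ((n + 1) * T)) t := by
      have h2 := (hγ _ (hmap n t ht)).scomp t
        ((hasDerivAt_id t).sub_const (n * T)).hasDerivWithinAt (hmap n)
      rw [one_smul] at h2
      exact h2.const_smul _
    rw [hpiece n t ht, hV n _ (hmap n t ht)]
    exact h1.congr (hpiece n) (hpiece n t ht)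
  have hfloor : ∀ t : ℝ, t ∈ Ico (⌊t / T⌋ * T) ((⌊t / T⌋ + 1) * T) := by
    intro t
    rw [mem_Ico, ← le_div_iff₀ hT, ← div_lt_iff₀ hT]
    exact ⟨Int.floor_le _, Int.lt_floor_add_one _⟩
  refine ⟨η, fun t => ?_, fun t => ?_, fun t ht => ?_, fun t => ?_⟩
  · obtain ⟨h1, h2⟩ := hfloor t
    set n := ⌊t / T⌋
    -- At a multiple of `T` the one-sided derivatives from the two adjacent pieces are glued.
    rcases h1.eq_or_lt with h | h
    · have a1 := hd n t ⟨h1, h2.le⟩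
      have e1 : (((n - 1 : ℤ) : ℝ) + 1) * T = t := by push_cast; rw [← h]; ring
      have e2 : ((n - 1 : ℤ) : ℝ) * T < t := by push_cast; nlinarith
      have a2 := hd (n - 1) t ⟨e2.le, e1.ge⟩
      refine (a2.union a1).hasDerivAt ?_
      rw [e1, ← h, h, Icc_union_Icc_eq_Icc e2.le h2.le]
      exact Icc_mem_nhds e2 h2
    · exact (hd n t ⟨h1, h2.le⟩).hasDerivAt (Icc_mem_nhds h h2)
  · have hfl : ⌊(t + 2 * T) / T⌋ = ⌊t / T⌋ + 2 := by
      rw [add_div, mul_div_cancel_right₀ _ hT.ne']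
      exact_mod_cast Int.floor_add_intCast (t / T) 2
    simp only [hη, hfl]
    rw [zpow_add₀ (by norm_num)]
    have e1 : t + 2 * T - ((⌊t / T⌋ + 2 : ℤ) : ℝ) * T = t - ⌊t / T⌋ * T := by push_cast; ring
    rw [e1]
    norm_num
  · have := hpiece 0 t (by simpa using ht)
    simpa using this
  · have h := hfloor t
    have h' : t ∈ Icc (⌊t / T⌋ * T) ((⌊t / T⌋ + 1) * T) := Ico_subset_Icc_self h
    refine ⟨_, hmap _ t h', ?_⟩
    rw [hpiece _ t h']
    rcases hsign ⌊t / T⌋ with h3 | h3 <;> rw [h3]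
    · left; simp
    · right; simp

section

variable {f g : ℝ → ℝ} {d : EReal} {b : ℝ} {X : ℝ → ℝ}

theorem Hyp.lienardField_neg (H : Hyp f g d) {P : ℝ × ℝ} (hP : P ∈ strip d) :
    lienardField f g (-P) = -lienardField f g P := by
  have h : P.1 ∈ symInterval d := hP
  ext
  · simp only [lienardField, Prod.fst_neg, Prod.snd_neg, H.F_odd _ h]; ring
  · simp only [lienardField, Prod.fst_neg, Prod.snd_neg, H.g_odd _ h]

theorem Hyp.continuousOn_lienardField (H : Hyp f g d) :
    ContinuousOn (lienardField f g) (strip d) :=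
  (continuousOn_snd.sub (H.continuousOn_F.comp continuousOn_fst fun _ h => h)).prodMk
    (H.g_cont.comp continuousOn_fst fun _ h => h).neg

/-- Along the arc `x = X(z)` satisfies `dx/ds = (Ψ(z) - s) / g(x)`. The numerator is `-p > 0` at the
start and `-q < 0` at the end, which makes the total time finite. -/
theorem Hyp.exists_half_orbit_of_arc (H : Hyp f g d) (hb : b ∈ symInterval d)
    (hX : PotentialInverse g b X) {p q : ℝ} {z : ℝ → ℝ} (A : Arc (transform f X) p q z)
    (hz : ∀ s ∈ Icc p q, z s < primitive g b) :
    ∃ T > 0, ∃ γ : ℝ → ℝ × ℝ,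
      (∀ t ∈ Icc 0 T, HasDerivWithinAt γ (lienardField f g (γ t)) (Icc 0 T) t) ∧
      γ 0 = (0, -p) ∧ γ T = (0, -q) ∧
      ∀ t ∈ Icc 0 T, ∃ s ∈ Icc p q, γ t = (X (z s), -s) := by
  have hzI : ∀ s ∈ Ioo p q, z s ∈ Ioo 0 (primitive g b) :=
    fun s hs => ⟨A.posIoo s hs, hz s (Ioo_subset_Icc_self hs)⟩
  have hXsym : ∀ r, X r ∈ symInterval d := fun r => Icc_subset_symInterval hb (hX.mem r)
  have hgp : ∀ s ∈ Ioo p q, 0 < g (X (z s)) :=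
    fun s hs => H.g_pos _ (hXsym _) (hX.mem_Ioo _ (hzI s hs)).1
  have hXz : ContinuousOn (fun s => X (z s)) (Icc p q) := hX.cont.comp_continuousOn A.cont
  have hgc : ContinuousOn (fun s => g (X (z s))) (Icc p q) :=
    H.g_cont.comp hXz fun s _ => hXsym _
  have hζc : ContinuousOn (fun s => (g (X (z s)))⁻¹) (Ioo p q) :=
    (hgc.mono Ioo_subset_Icc_self).inv₀ fun s hs => (hgp s hs).ne'
  have hΨ := H.continuous_transform hb hX
  have hΨ0 := (H.regular_transform hb hX).zero
  obtain ⟨T, hT, S, hSc, hSI, hS0, hST, hSd⟩ := exists_time_change A.lt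
    (integrableOn_of_hasDerivAt_mul_of_sign (x := fun s => X (z s))
      (ζ := fun s => (g (X (z s)))⁻¹) (φ := fun s => transform f X (z s) - s) A.lt hXz
      (fun s hs => (hX.deriv _ (hzI s hs)).comp s (A.deriv s hs))
      (fun s hs => inv_pos.2 (hgp s hs)) hζc ((hΨ.comp_continuousOn A.cont).sub continuousOn_id)
      (by simp only [A.left, hΨ0]; linarith [A.neg])
      (by simp only [A.right, hΨ0]; linarith [A.pos]))
    (fun s hs => inv_pos.2 (hgp s hs)) hζc
  set γ : ℝ → ℝ × ℝ := fun t => (X (z (S t)), -S t) with hγ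
  have hγc : ContinuousOn γ (Icc 0 T) :=
    (hXz.comp hSc.continuousOn fun t _ => hSI t).prodMk hSc.neg.continuousOn
  have hγs : ∀ t ∈ Icc 0 T, γ t ∈ strip d := fun t _ => hXsym _
  refine ⟨T, hT, γ, ?_, ?_, ?_, fun t _ => ⟨S t, hSI t, rfl⟩⟩
  · refine hasDerivWithinAt_Icc_of_Ioo hT hγc (H.continuousOn_lienardField.comp hγc hγs)
      fun t ht => ?_
    obtain ⟨h1, h2⟩ := hSd t ht
    have h3 : HasDerivAt (fun t => X (z (S t))) ((g (X (z (S t))))⁻¹ *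
        (transform f X (z (S t)) - S t) * ((g (X (z (S t))))⁻¹)⁻¹) t :=
      ((hX.deriv _ (hzI _ h1)).comp _ (A.deriv _ h1)).comp t h2
    have h4 := (hgp _ h1).ne'
    have h5 : HasDerivAt γ ((g (X (z (S t))))⁻¹ *
        (transform f X (z (S t)) - S t) * ((g (X (z (S t))))⁻¹)⁻¹,
        -((g (X (z (S t))))⁻¹)⁻¹) t := h3.prodMk h2.neg
    refine h5.congr_deriv ?_
    ext
    · simp only [lienardField, hγ, transform]
      field_simp
      ring
    · simp only [lienardField, hγ, inv_inv]
  · simp only [hγ, hS0, A.left, hX.of_nonpos 0 le_rfl]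
  · simp only [hγ, hST, A.right, hX.of_nonpos 0 le_rfl]

theorem Hyp.exists_periodicOrbit_of_arc (H : Hyp f g d) (hb : b ∈ symInterval d)
    (hX : PotentialInverse g b X) {Y R : ℝ} {z : ℝ → ℝ} (A : Arc (transform f X) (-Y) Y z)
    (hz : ∀ s ∈ Icc (-Y) Y, z s < primitive g b) (hR : ∀ s ∈ Icc (-Y) Y, z s ≤ primitive g R)
    (hR0 : R ∈ Icc 0 b) :
    ∃ C, IsPeriodicOrbit (lienardField f g) (strip d) C ∧ ∀ P ∈ C, |P.1| ≤ R := by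
  obtain ⟨T, hT, γ, hγ, hγ0, hγT, hγz⟩ := H.exists_half_orbit_of_arc hb hX A hz
  have hXsym : ∀ r, X r ∈ symInterval d := fun r => Icc_subset_symInterval hb (hX.mem r)
  have hstrip : ∀ t ∈ Icc 0 T, γ t ∈ strip d := fun t ht => by
    obtain ⟨s, -, hs⟩ := hγz t ht
    rw [hs]; exact hXsym _
  have hle : ∀ t ∈ Icc 0 T, |(γ t).1| ≤ R := fun t ht => by
    obtain ⟨s, hs, hs'⟩ := hγz t ht
    rw [hs']
    dsimp only
    rw [abs_of_nonneg (hX.mem _).1]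
    rw [← (H.strictMonoOn_G hb).le_iff_le (hX.mem _) hR0,
      hX.right_inv _ ⟨A.nonneg s hs, (hz s hs).le⟩]
    exact hR s hs
  obtain ⟨η, hη, hper, hext, hval⟩ := exists_antiperiodic_extension hT hγ
    (by rw [hγ0, hγT]; simp) (fun t ht => H.lienardField_neg (hstrip t ht))
  refine ⟨range η, ⟨η, fun t => ⟨?_, hη t⟩, ⟨2 * T, by linarith, hper⟩, ⟨0, T, ?_⟩, rfl⟩, ?_⟩
  · obtain ⟨s, hs, h | h⟩ := hval t <;> rw [h]
    · exact hstrip s hs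
    · exact neg_mem_symInterval (hstrip s hs)
  · rw [hext 0 ⟨le_rfl, hT.le⟩, hext T ⟨hT.le, le_rfl⟩, hγ0, hγT]
    intro h
    have := congrArg Prod.snd h
    dsimp only at this
    linarith [A.pos]
  · rintro _ ⟨t, rfl⟩
    obtain ⟨s, hs, h | h⟩ := hval t <;> rw [h]
    · exact hle s hs
    · rw [Prod.fst_neg, abs_neg]; exact hle s hs

end

/-! ### The sign of `F` and the arc through `Q` -/

/-- `F` is negative on `(0, a)` and nonnegative and nondecreasing on `[a, d)`. -/
structure SignHyp (f : ℝ → ℝ) (d : EReal) (a : ℝ) : Prop where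
  pos : 0 < a
  mem : a ∈ symInterval d
  zero : primitive f a = 0
  neg : ∀ x ∈ Ioo 0 a, primitive f x < 0
  mono : MonotoneOn (primitive f) {x | a ≤ x ∧ x ∈ symInterval d}

theorem SignHyp.nonneg {f : ℝ → ℝ} {d : EReal} {a x : ℝ} (S : SignHyp f d a) (hx : a ≤ x)
    (hxd : x ∈ symInterval d) : 0 ≤ primitive f x := by
  rw [← S.zero]; exact S.mono ⟨le_rfl, S.mem⟩ ⟨hx, hxd⟩ hx

section

variable {f g : ℝ → ℝ} {d : EReal} {a α : ℝ}

theorem Hyp.hasDerivAt_energy_aux (H : Hyp f g d) {s : Set ℝ} {γ : ℝ → ℝ × ℝ} {t : ℝ}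
    (hs : γ t ∈ strip d) (hγ : HasDerivWithinAt γ (lienardField f g (γ t)) s t) :
    HasDerivWithinAt (fun t => energy g (γ t)) (-(primitive f (γ t).1 * g (γ t).1)) s t := by
  have hx : HasDerivWithinAt (fun t => (γ t).1) ((γ t).2 - primitive f (γ t).1) s t := hγ.fst
  have hy : HasDerivWithinAt (fun t => (γ t).2) (-g (γ t).1) s t := hγ.snd
  have h1 := (H.hasDerivAt_G hs).comp_hasDerivWithinAt t hx
  have h2 := (hy.pow 2).div_const 2
  exact (h1.add h2).congr_deriv (by simp; ring)

/-- On the path from the `y`-axis to `(α, F α)`, `x` does not exceed `α`. -/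
theorem Hyp.path_fst_le (H : Hyp f g d) {T : ℝ} {γ : ℝ → ℝ × ℝ} (hγ : IsPath f g d T γ)
    (hγT : γ T = curvePoint f α) (hpos : ∀ t ∈ Ioc 0 T, 0 < (γ t).1) :
    ∀ t ∈ Icc 0 T, (γ t).1 ≤ α := by
  obtain ⟨hT, hγ⟩ := hγ
  have hx : ∀ t ∈ Icc 0 T, HasDerivWithinAt (fun t => (γ t).1) ((γ t).2 - primitive f (γ t).1)
      (Icc 0 T) t := fun t ht => (hγ t ht).2.fst
  have hy : ∀ t ∈ Icc 0 T, HasDerivWithinAt (fun t => (γ t).2) (-g (γ t).1) (Icc 0 T) t :=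
    fun t ht => (hγ t ht).2.snd
  have hφ : ∀ t ∈ Icc 0 T, HasDerivWithinAt (fun t => (γ t).2 - primitive f (γ t).1)
      (-g (γ t).1 - f (γ t).1 * ((γ t).2 - primitive f (γ t).1)) (Icc 0 T) t := fun t ht => by
    have h1 := (H.hasDerivAt_F (hγ t ht).1).comp_hasDerivWithinAt t (hx t ht)
    exact (hy t ht).sub h1
  have hmap : MapsTo (fun r => T - r) (Icc 0 T) (Icc 0 T) :=
    fun r hr => ⟨by linarith [hr.2], by linarith [hr.1]⟩
  have hψ : ∀ r ∈ Icc 0 T, HasDerivWithinAt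
      (fun r => -((γ (T - r)).2 - primitive f (γ (T - r)).1))
      (-g (γ (T - r)).1 - f (γ (T - r)).1 * ((γ (T - r)).2 - primitive f (γ (T - r)).1))
      (Icc 0 T) r := by
    intro r hr
    have h1 := (hφ (T - r) (hmap hr)).scomp r
      ((hasDerivAt_id r).const_sub T).hasDerivWithinAt hmap
    exact h1.neg.congr_deriv (by rw [smul_eq_mul]; ring)
  -- In reversed time from `Q`, where `y - F = 0`, the quantity `F - y` starts at zero and has
  -- derivative `-g < 0` at each of its zeros. Hence `y ≥ F` and `x` is nondecreasing on the way to
  -- `Q`.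
  have hnn : ∀ r ∈ Icc 0 T, -((γ (T - r)).2 - primitive f (γ (T - r)).1) ≤ 0 := by
    refine nonpos_of_deriv_neg_at_zeros (fun r hr => (hψ r hr).continuousWithinAt)
      (fun r hr => hasDerivWithinAt_Ici_of_Icc hr (hψ r (Ico_subset_Icc_self hr))) ?_ ?_
    · simp [hγT, curvePoint]
    · intro r hr h
      have h0 : (γ (T - r)).2 - primitive f (γ (T - r)).1 = 0 := by linarith
      have ht : T - r ∈ Ioc 0 T := ⟨by linarith [hr.2], by linarith [hr.1]⟩
      have := H.g_pos _ (hγ _ (Ioc_subset_Icc_self ht)).1 (hpos _ ht)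
      rw [h0]; linarith
  have hmono : MonotoneOn (fun t => (γ t).1) (Icc 0 T) := by
    refine monotoneOn_of_hasDerivWithinAt_nonneg (convex_Icc 0 T)
      (fun t ht => (hx t ht).continuousWithinAt)
      (f' := fun t => (γ t).2 - primitive f (γ t).1) ?_ ?_
    · exact fun t ht => (hx t (interior_subset ht)).mono interior_subset
    · intro t ht
      have h1 := hnn (T - t) (hmap (interior_subset ht))
      rw [sub_sub_cancel] at h1
      linarith
  intro t ht
  have := hmono ht ⟨hT.le, le_rfl⟩ ht.2
  simpa [hγT, curvePoint] using this

/-- If the energy is the same at both ends of a path, `F` changes sign along it. -/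
theorem Hyp.sign_change_of_upperRoot (H : Hyp f g d) (ha : 0 < a)
    (hzero : ∀ x ∈ symInterval d, primitive f x = 0 → x = 0 ∨ x = a ∨ x = -a)
    (hα : IsUpperRoot f g d α) :
    ¬ (∀ x ∈ Ioc 0 α, 0 ≤ primitive f x) ∧ ¬ (∀ x ∈ Ioc 0 α, primitive f x ≤ 0) := by
  obtain ⟨y, ⟨hy, T, γ, hγ, hγ0, hγT, hpos⟩, hroot⟩ := hα
  have hle := H.path_fst_le hγ hγT hpos
  obtain ⟨hT, hγ⟩ := hγ
  have hmem : ∀ t ∈ Ioo 0 T, (γ t).1 ∈ Ioc 0 α := fun t ht =>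
    ⟨hpos t (Ioo_subset_Ioc_self ht), hle t (Ioo_subset_Icc_self ht)⟩
  have hE : ∀ t ∈ Icc 0 T, HasDerivWithinAt (fun t => energy g (γ t))
      (-(primitive f (γ t).1 * g (γ t).1)) (Icc 0 T) t :=
    fun t ht => H.hasDerivAt_energy_aux (hγ t ht).1 (hγ t ht).2
  have hEc : ContinuousOn (fun t => energy g (γ t)) (Icc 0 T) :=
    fun t ht => (hE t ht).continuousWithinAt
  have hEq : energy g (γ 0) = energy g (γ T) := by
    rw [hγ0, hγT]; simp only [energy, curvePoint, primitive_zero]; linarith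
  have l0 : (0 : ℝ) ∈ Icc 0 T := ⟨le_rfl, hT.le⟩
  have l1 : T ∈ Icc 0 T := ⟨hT.le, le_rfl⟩
  -- Constant energy would give `F = 0`, hence `x = a`, at all interior times, but the path starts
  -- at `x = 0`. If `F` had one sign, the energy would be monotone with equal end values, hence
  -- constant.
  have key : ¬ ∀ t ∈ Icc 0 T, energy g (γ t) = energy g (γ 0) := by
    intro hconst
    have hxa : ∀ t ∈ Ioo 0 T, (γ t).1 = a := by
      intro t ht
      have hd := (hE t (Ioo_subset_Icc_self ht)).hasDerivAt (Icc_mem_nhds ht.1 ht.2)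
      have hd0 : HasDerivAt (fun t => energy g (γ t)) 0 t := by
        refine (hasDerivAt_const t (energy g (γ 0))).congr_of_eventuallyEq ?_
        filter_upwards [Icc_mem_nhds ht.1 ht.2] with r hr using hconst r hr
      have h1 := hd.unique hd0
      have hxs := (hγ t (Ioo_subset_Icc_self ht)).1
      have hx0 := (hmem t ht).1
      have h2 := H.g_pos _ hxs hx0
      have h3 : primitive f (γ t).1 = 0 := by
        rcases mul_eq_zero.1 (neg_eq_zero.1 h1) with h | h
        · exact h
        · exact absurd h h2.ne'
      rcases hzero _ hxs h3 with h | h | h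
      · linarith
      · exact h
      · linarith
    have hxc : ContinuousOn (fun t => (γ t).1) (Icc 0 T) :=
      fun t ht => (hγ t ht).2.continuousWithinAt.fst
    have h1 : Tendsto (fun t => (γ t).1) (𝓝[>] 0) (𝓝 (γ 0).1) := by
      have := (hxc 0 l0).mono Ioo_subset_Icc_self
      rwa [ContinuousWithinAt, nhdsWithin_Ioo_eq_nhdsGT hT] at this
    have h2 : Tendsto (fun t => (γ t).1) (𝓝[>] 0) (𝓝 a) := by
      refine tendsto_const_nhds.congr' ?_
      filter_upwards [Ioo_mem_nhdsGT hT] with t ht using (hxa t ht).symm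
    have h3 := tendsto_nhds_unique h1 h2
    rw [hγ0] at h3
    exact ha.ne h3
  have hgnn : ∀ t ∈ Ioo 0 T, 0 < g (γ t).1 := fun t ht =>
    H.g_pos _ (hγ t (Ioo_subset_Icc_self ht)).1 (hmem t ht).1
  constructor
  · intro hF
    refine key fun t ht => ?_
    have hanti : AntitoneOn (fun t => energy g (γ t)) (Icc 0 T) := by
      refine antitoneOn_of_hasDerivWithinAt_nonpos (convex_Icc 0 T) hEc
        (f' := fun t => -(primitive f (γ t).1 * g (γ t).1))
        (fun t ht => (hE t (interior_subset ht)).mono interior_subset) ?_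
      rw [interior_Icc]
      intro t ht
      have := mul_nonneg (hF _ (hmem t ht)) (hgnn t ht).le
      linarith
    have h1 := hanti l0 ht ht.1
    have h2 := hanti ht l1 ht.2
    dsimp only at h1 h2
    linarith
  · intro hF
    refine key fun t ht => ?_
    have hmono : MonotoneOn (fun t => energy g (γ t)) (Icc 0 T) := by
      refine monotoneOn_of_hasDerivWithinAt_nonneg (convex_Icc 0 T) hEc
        (f' := fun t => -(primitive f (γ t).1 * g (γ t).1))
        (fun t ht => (hE t (interior_subset ht)).mono interior_subset) ?_
      rw [interior_Icc]
      intro t ht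
      have := mul_nonneg (neg_nonneg.2 (hF _ (hmem t ht))) (hgnn t ht).le
      linarith
    have h1 := hmono l0 ht ht.1
    have h2 := hmono ht l1 ht.2
    dsimp only at h1 h2
    linarith

/-- The monotonicity hypotheses concern intervals without their left endpoints; continuity carries
the bounds to `a` and `αbar`. -/
theorem Hyp.F_le_of_right (H : Hyp f g d) {c x v : ℝ} (hc : c ∈ symInterval d) (hcx : c < x)
    (h : ∀ y ∈ Ioo c x, primitive f y ≤ v) : primitive f c ≤ v := by
  have h1 : Tendsto (primitive f) (𝓝[>] c) (𝓝 (primitive f c)) :=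
    (H.hasDerivAt_F hc).continuousAt.tendsto.mono_left nhdsWithin_le_nhds
  refine le_of_tendsto h1 ?_
  filter_upwards [Ioo_mem_nhdsGT hcx] with y hy using h y hy

/-- The sign of `F` on `(0, a)` is not assumed. Since `F` must change sign on `(0, α']`, the root
`α'` exceeds `a`, and `F > 0` on `(0, a)` is excluded because `F ≥ 0` beyond `a`. -/
theorem Hyp.signHyp (H : Hyp f g d) (ha : 0 < a) (had : a ∈ symInterval d)
    (hzero : ∀ x ∈ symInterval d, primitive f x = 0 ↔ x = 0 ∨ x = a ∨ x = -a)
    {α' : ℝ} (hα' : IsUpperRoot f g d α') (hle : α' ≤ α) (hαd : α ∈ symInterval d)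
    (hinc : StrictMonoOn (primitive f) (Ioc a α))
    (hmono : MonotoneOn (primitive f) {x : ℝ | α < x ∧ (x : EReal) < d}) :
    a < α ∧ SignHyp f d a := by
  obtain ⟨hnn, hnp⟩ := H.sign_change_of_upperRoot ha (fun x hx => (hzero x hx).1) hα'
  have hFa : primitive f a = 0 := (hzero a had).2 (Or.inr (Or.inl rfl))
  have hconst : (∀ x ∈ Ioo 0 a, primitive f x < 0) ∨ ∀ x ∈ Ioo 0 a, 0 < primitive f x := by
    by_contra! hcon
    obtain ⟨⟨x, hx, hx'⟩, y, hy, hy'⟩ := hcon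
    have hc : ContinuousOn (primitive f) (Ioo 0 a) :=
      H.continuousOn_F.mono fun z hz => Icc_subset_symInterval had (Ioo_subset_Icc_self hz)
    obtain ⟨z, hz, hz0⟩ := isPreconnected_Ioo.intermediate_value hy hx hc
      (show (0 : ℝ) ∈ Icc (primitive f y) (primitive f x) from ⟨hy', hx'⟩)
    rcases (hzero z (Icc_subset_symInterval had (Ioo_subset_Icc_self hz))).1 hz0 with h | h | h
    · linarith [hz.1]
    · linarith [hz.2]
    · linarith [hz.1]
  have haα' : a < α' := by
    by_contra! h
    rcases hconst with hs | hs
    · refine hnp fun x hx => ?_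
      rcases (hx.2.trans h).eq_or_lt with rfl | h2
      · exact hFa.le
      · exact (hs x ⟨hx.1, h2⟩).le
    · refine hnn fun x hx => ?_
      rcases (hx.2.trans h).eq_or_lt with rfl | h2
      · exact hFa.ge
      · exact (hs x ⟨hx.1, h2⟩).le
  have haα : a < α := haα'.trans_le hle
  have hF0 : ∀ x ∈ Ioc a α, 0 ≤ primitive f x := by
    intro x hx
    rw [← hFa]
    exact H.F_le_of_right had hx.1 fun y hy =>
      (hinc ⟨hy.1, hy.2.le.trans hx.2⟩ hx hy.2).le
  have hFα : ∀ x, α ≤ x → x ∈ symInterval d → primitive f α ≤ primitive f x := by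
    intro x hx hxd
    rcases hx.eq_or_lt with rfl | h
    · exact le_rfl
    have hxd' := (mem_symInterval_iff_of_nonneg (by linarith)).1 hxd
    exact H.F_le_of_right hαd h fun y hy => hmono
      ⟨hy.1, (EReal.coe_lt_coe_iff.2 hy.2).trans hxd'⟩ ⟨h, hxd'⟩ hy.2.le
  refine ⟨haα, ha, had, hFa, ?_, ?_⟩
  · rcases hconst with hs | hs
    · exact hs
    · refine absurd (fun x hx => ?_) hnn
      rcases lt_trichotomy x a with h | rfl | h
      · exact (hs x ⟨hx.1, h⟩).le
      · exact hFa.ge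
      · exact hF0 x ⟨h, hx.2.trans hle⟩
  · rintro x ⟨hx, hxd⟩ y ⟨hy, hyd⟩ hxy
    rcases hx.eq_or_lt with rfl | hx
    · rw [hFa]
      rcases hy.eq_or_lt with rfl | hy
      · exact hFa.ge
      rcases le_total y α with h | h
      · exact hF0 y ⟨hy, h⟩
      · exact (hF0 α ⟨haα, le_rfl⟩).trans (hFα y h hyd)
    rcases le_total y α with h | h
    · exact hinc.monotoneOn ⟨hx, hxy.trans h⟩ ⟨hx.trans_le hxy, h⟩ hxy
    rcases le_or_gt x α with h' | h'
    · exact (hinc.monotoneOn ⟨hx, h'⟩ ⟨haα, le_rfl⟩ h').trans (hFα y h hyd)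
    · exact hmono ⟨h', (mem_symInterval_iff_of_nonneg (by linarith)).1 hxd⟩
        ⟨h'.trans_le hxy, (mem_symInterval_iff_of_nonneg (by linarith)).1 hyd⟩ hxy

theorem exists_gt_mem_symInterval {x : ℝ} (hx : x ∈ symInterval d) :
    ∃ b ∈ symInterval d, x < b := by
  have h1 : ∀ᶠ y in 𝓝[>] x, y ∈ symInterval d :=
    nhdsWithin_le_nhds ((isOpen_symInterval d).mem_nhds hx)
  obtain ⟨b, hb, hb'⟩ := (h1.and self_mem_nhdsWithin).exists
  exact ⟨b, hb, hb'⟩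

theorem hasDerivWithinAt_concat {E : Type*} [NormedAddCommGroup E] [NormedSpace ℝ E] {V : E → E}
    {γ₁ γ₂ : ℝ → E} {T₁ T₂ : ℝ} (h1 : 0 < T₁) (h2 : 0 < T₂)
    (hγ₁ : ∀ t ∈ Icc 0 T₁, HasDerivWithinAt γ₁ (V (γ₁ t)) (Icc 0 T₁) t)
    (hγ₂ : ∀ t ∈ Icc 0 T₂, HasDerivWithinAt γ₂ (V (γ₂ t)) (Icc 0 T₂) t) (heq : γ₁ T₁ = γ₂ 0) :
    ∃ γ : ℝ → E, (∀ t ∈ Icc 0 (T₁ + T₂), HasDerivWithinAt γ (V (γ t)) (Icc 0 (T₁ + T₂)) t) ∧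
      (∀ t ∈ Icc 0 T₁, γ t = γ₁ t) ∧ ∀ t ∈ Icc T₁ (T₁ + T₂), γ t = γ₂ (t - T₁) := by
  set γ : ℝ → E := fun t => if t ≤ T₁ then γ₁ t else γ₂ (t - T₁) with hγ
  have e1 : ∀ t ∈ Icc 0 T₁, γ t = γ₁ t := fun t ht => by simp [hγ, ht.2]
  have e2 : ∀ t ∈ Icc T₁ (T₁ + T₂), γ t = γ₂ (t - T₁) := by
    intro t ht
    rcases ht.1.eq_or_lt with rfl | h
    · simp [hγ, heq]
    · simp [hγ, not_le.2 h]
  have hmap : MapsTo (fun t => t - T₁) (Icc T₁ (T₁ + T₂)) (Icc 0 T₂) :=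
    fun t ht => ⟨by linarith [ht.1], by linarith [ht.2]⟩
  have d1 : ∀ t ∈ Icc 0 T₁, HasDerivWithinAt γ (V (γ t)) (Icc 0 T₁) t := fun t ht => by
    rw [e1 t ht]; exact (hγ₁ t ht).congr e1 (e1 t ht)
  have d2 : ∀ t ∈ Icc T₁ (T₁ + T₂), HasDerivWithinAt γ (V (γ t)) (Icc T₁ (T₁ + T₂)) t := by
    intro t ht
    have h3 := (hγ₂ _ (hmap ht)).scomp t ((hasDerivAt_id t).sub_const T₁).hasDerivWithinAt hmap
    rw [one_smul] at h3
    rw [e2 t ht]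
    exact h3.congr e2 (e2 t ht)
  refine ⟨γ, fun t ht => ?_, e1, e2⟩
  rcases lt_trichotomy t T₁ with h | rfl | h
  · refine (d1 t ⟨ht.1, h.le⟩).mono_of_mem_nhdsWithin ?_
    filter_upwards [self_mem_nhdsWithin, nhdsWithin_le_nhds (Iio_mem_nhds h)] with r hr hr'
    exact ⟨hr.1, le_of_lt hr'⟩
  · have := (d1 t ⟨h1.le, le_rfl⟩).union (d2 t ⟨le_rfl, by linarith⟩)
    rwa [Icc_union_Icc_eq_Icc h1.le (by linarith)] at this
  · refine (d2 t ⟨h.le, ht.2⟩).mono_of_mem_nhdsWithin ?_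
    filter_upwards [self_mem_nhdsWithin, nhdsWithin_le_nhds (Ioi_mem_nhds h)] with r hr hr'
    exact ⟨le_of_lt hr', hr.2⟩

/-- The paths `YQ` and `QY'` are joined into one half orbit. The point `Q` lies on `y = F(x)`, so it
is the vertex, and the height of the arc is `G(α)`. -/
theorem Hyp.exists_arc_of_intercepts (H : Hyp f g d) {yp ym : ℝ}
    (hp : IsUpperIntercept f g d α yp) (hm : IsLowerIntercept f g d α ym) :
    ∃ b X z, b ∈ symInterval d ∧ 0 < α ∧ α < b ∧ PotentialInverse g b X ∧
      Arc (transform f X) (-yp) (-ym) z ∧ ∀ s ∈ Icc (-yp) (-ym), z s ≤ primitive g α := by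
  obtain ⟨hyp, T₁, γ₁, ⟨hT₁, hγ₁⟩, hγ₁0, hγ₁T, hpos₁⟩ := hp
  obtain ⟨hym, T₂, γ₂, ⟨hT₂, hγ₂⟩, hγ₂0, hγ₂T, hpos₂⟩ := hm
  obtain ⟨γ, hγ, e1, e2⟩ := hasDerivWithinAt_concat hT₁ hT₂ (fun t ht => (hγ₁ t ht).2)
    (fun t ht => (hγ₂ t ht).2) (hγ₁T.trans hγ₂0.symm)
  have hT : 0 < T₁ + T₂ := by linarith
  have hα0 : 0 < α := by
    have := hpos₁ T₁ ⟨hT₁, le_rfl⟩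
    rwa [hγ₁T] at this
  have hstrip : ∀ t ∈ Icc 0 (T₁ + T₂), (γ t).1 ∈ symInterval d := by
    intro t ht
    rcases le_total t T₁ with h | h
    · rw [e1 t ⟨ht.1, h⟩]; exact (hγ₁ t ⟨ht.1, h⟩).1
    · rw [e2 t ⟨h, ht.2⟩]; exact (hγ₂ _ ⟨by linarith, by linarith [ht.2]⟩).1
  have hxc : ContinuousOn (fun t => (γ t).1) (Icc 0 (T₁ + T₂)) :=
    fun t ht => (hγ t ht).continuousWithinAt.fst
  obtain ⟨tm, htm, hmax⟩ := isCompact_Icc.exists_isMaxOn (nonempty_Icc.2 hT.le) hxc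
  have hTm : γ T₁ = curvePoint f α := by rw [e1 T₁ ⟨hT₁.le, le_rfl⟩, hγ₁T]
  have hT₁m : T₁ ∈ Icc 0 (T₁ + T₂) := ⟨hT₁.le, by linarith⟩
  obtain ⟨b, hb, hlt⟩ := exists_gt_mem_symInterval (hstrip tm htm)
  have hltb : ∀ t ∈ Icc 0 (T₁ + T₂), (γ t).1 < b := fun t ht => (hmax ht).trans_lt hlt
  have hαb : α < b := by
    have := hltb T₁ hT₁m
    rwa [hTm] at this
  obtain ⟨X, hX⟩ := H.exists_potentialInverse (hα0.trans hαb) hb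
  have h0 : γ 0 = (0, yp) := by rw [e1 0 ⟨le_rfl, hT₁.le⟩, hγ₁0]
  have hE : γ (T₁ + T₂) = (0, ym) := by
    rw [e2 _ ⟨by linarith, le_rfl⟩, add_sub_cancel_left, hγ₂T]
  obtain ⟨z, A, hz, -, -, hzlt⟩ := H.exists_arc_of_half_orbit hb hX hT hγ (by rw [h0])
    (by rw [hE]) (fun t ht => by
      rcases le_total t T₁ with h | h
      · rw [e1 t ⟨ht.1.le, h⟩]; exact hpos₁ t ⟨ht.1, h⟩
      · rw [e2 t ⟨h, ht.2.le⟩]; exact hpos₂ _ ⟨by linarith, by linarith [ht.2]⟩) hltb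
    (by rw [h0]; exact hyp) (by rw [hE]; exact hym)
  rw [h0, hE] at A hz hzlt
  refine ⟨b, X, z, hb, hα0, hαb, hX, A, ?_⟩
  have hreg := H.regular_transform hb hX
  obtain ⟨m, hm, hm0, hm1, hm2⟩ := A.exists_vertex hreg
    fun s hs => hzlt s (Ioo_subset_Icc_self hs)
  have huniq : ∀ s ∈ Icc (-yp) (-ym), transform f X (z s) = s → s = m := by
    intro s hs h
    rcases lt_trichotomy s m with h1 | h1 | h1
    · linarith [hm1 s ⟨hs.1, h1⟩]
    · exact h1
    · linarith [hm2 s ⟨h1, hs.2⟩]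
  obtain ⟨n, hn, _, _, hn0, hmax', _⟩ := A.exists_branches hreg
    fun s hs => hzlt s (Ioo_subset_Icc_self hs)
  have hnm := huniq n (Ioo_subset_Icc_self hn) hn0
  obtain ⟨hQ, hzQ⟩ := hz T₁ hT₁m
  rw [hTm] at hQ hzQ
  simp only [curvePoint] at hQ hzQ
  have hQm := huniq _ hQ (by rw [hzQ, hX.transform_apply ⟨hα0.le, hαb.le⟩])
  intro s hs
  have := hmax' s hs
  rwa [hnm, ← hQm, hzQ] at this

theorem Hyp.exists_periodicOrbit (H : Hyp f g d) (S : SignHyp f d a) {yp ym : ℝ} (haα : a < α)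
    (hp : IsUpperIntercept f g d α yp) (hm : IsLowerIntercept f g d α ym)
    (h1 : energy g (curvePoint f α) - energy g (0, yp) ≤ 0)
    (h2 : energy g (0, ym) - energy g (curvePoint f α) ≤ 0) :
    ∃ C, IsPeriodicOrbit (lienardField f g) (strip d) C ∧ ∀ P ∈ C, |P.1| ≤ α := by
  obtain ⟨b, X, z, hb, hα0, hαb, hX, A, hz⟩ := H.exists_arc_of_intercepts hp hm
  have hyp := hp.1
  have hym := hm.1
  have hGb := H.G_pos hb (hα0.trans hαb)
  have haI : a ∈ Icc 0 b := ⟨S.pos.le, (haα.trans hαb).le⟩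
  have hGm := H.strictMonoOn_G hb
  have hαI : α ∈ Icc 0 b := ⟨hα0.le, hαb.le⟩
  have hGab : primitive g α < primitive g b := hGm hαI ⟨(hα0.trans hαb).le, le_rfl⟩ hαb
  -- The two energy inequalities add up to `v(Y') ≤ v(Y)`, that is, `|ym| ≤ yp`.
  have hle : -ym ≤ - -yp := by
    rw [neg_neg]
    have h3 : ym ^ 2 ≤ yp ^ 2 := by
      simp only [energy, primitive_zero] at h1 h2
      linarith
    nlinarith
  have hposΨ : ∀ r ∈ Icc 0 (primitive g a), 0 ≤ transform f X r := by
    intro r hr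
    have hrb : r ∈ Icc 0 (primitive g b) :=
      ⟨hr.1, hr.2.trans (hGm.monotoneOn haI ⟨haI.1.trans haI.2, le_rfl⟩ haI.2)⟩
    have hXa : X r ≤ a := by
      rw [← hGm.le_iff_le (hX.mem r) haI, hX.right_inv r hrb]; exact hr.2
    rw [transform, neg_nonneg]
    rcases (hX.mem r).1.eq_or_lt with h | h
    · rw [← h, primitive_zero]
    rcases hXa.eq_or_lt with h' | h'
    · rw [h', S.zero]
    · exact (S.neg _ ⟨h, h'⟩).le
  obtain ⟨Y, ζ, B, hζ⟩ := A.exists_symmetric hGb.le (H.continuous_transform hb hX)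
    (hX.transform_projIcc hGb.le) hX.transform_of_nonpos (H.G_pos S.mem S.pos) hposΨ hle hz
  exact H.exists_periodicOrbit_of_arc hb hX B (fun s hs => (hζ s hs).trans_lt hGab) hζ hαI

end

/-! ### Periodic solutions and their crossings of the `y`-axis -/

theorem exists_first_zero {x : ℝ → ℝ} (hx : Continuous x) {t t' : ℝ} (htt' : t < t')
    (ht : 0 < x t) (ht' : x t' ≤ 0) : ∃ t₁, t < t₁ ∧ x t₁ = 0 ∧ ∀ r ∈ Ico t t₁, 0 < x r := by
  set S := {r ∈ Icc t t' | x r ≤ 0} with hS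
  have hSc : IsClosed S := isClosed_Icc.inter (isClosed_le hx continuous_const)
  have hSb : BddBelow S := ⟨t, fun r hr => hr.1.1⟩
  have hmem : sInf S ∈ S := hSc.csInf_mem ⟨t', ⟨htt'.le, le_rfl⟩, ht'⟩ hSb
  have hpos : ∀ r ∈ Ico t (sInf S), 0 < x r := by
    intro r hr
    by_contra! h
    exact absurd (csInf_le hSb (show r ∈ S from ⟨⟨hr.1, hr.2.le.trans hmem.1.2⟩, h⟩))
      (not_le.2 hr.2)
  have hlt : t < sInf S := lt_of_le_of_ne hmem.1.1 fun h => by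
    have := hmem.2; rw [← h] at this; linarith
  refine ⟨sInf S, hlt, le_antisymm hmem.2 ?_, hpos⟩
  refine ge_of_tendsto (hx.continuousAt.tendsto.mono_left nhdsWithin_le_nhds :
    Tendsto x (𝓝[<] (sInf S)) _) ?_
  filter_upwards [Ioo_mem_nhdsLT hlt] with r hr using (hpos r ⟨hr.1.le, hr.2⟩).le

theorem exists_last_zero {x : ℝ → ℝ} (hx : Continuous x) {t t' : ℝ} (htt' : t' < t)
    (ht : 0 < x t) (ht' : x t' ≤ 0) : ∃ t₁, t₁ < t ∧ x t₁ = 0 ∧ ∀ r ∈ Ioc t₁ t, 0 < x r := by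
  obtain ⟨t₁, h1, h2, h3⟩ := exists_first_zero (x := fun r => x (-r)) (hx.comp continuous_neg)
    (neg_lt_neg htt') (by simpa using ht) (by simpa using ht')
  refine ⟨-t₁, by linarith, h2, fun r hr => ?_⟩
  have := h3 (-r) ⟨by linarith [hr.2], by linarith [hr.1]⟩
  simpa using this

theorem eventually_neg_left_of_deriv_pos {x : ℝ → ℝ} {x' t : ℝ} (h : HasDerivAt x x' t)
    (h0 : x t = 0) (hx' : 0 < x') : ∀ᶠ r in 𝓝[<] t, x r < 0 := by
  have h1 := (h.tendsto_slope.eventually_const_lt hx').filter_mono (nhdsLT_le_nhdsNE t)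
  filter_upwards [h1, self_mem_nhdsWithin] with r hr hr'
  rw [slope_def_field, h0, sub_zero] at hr
  rcases div_pos_iff.1 hr with h2 | h2
  · linarith [h2.2, show r < t from hr']
  · exact h2.1

theorem eventually_pos_right_of_deriv_pos {x : ℝ → ℝ} {x' t : ℝ} (h : HasDerivAt x x' t)
    (h0 : x t = 0) (hx' : 0 < x') : ∀ᶠ r in 𝓝[>] t, 0 < x r := by
  have h1 := (h.tendsto_slope.eventually_const_lt hx').filter_mono (nhdsGT_le_nhdsNE t)
  filter_upwards [h1, self_mem_nhdsWithin] with r hr hr'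
  rw [slope_def_field, h0, sub_zero] at hr
  rcases div_pos_iff.1 hr with h2 | h2
  · exact h2.1
  · linarith [h2.2, show t < r from hr']

/-- A nonconstant solution of the Liénard system of period `T` in the strip. -/
structure PeriodicSolution (f g : ℝ → ℝ) (d : EReal) (T : ℝ) (γ : ℝ → ℝ × ℝ) : Prop where
  pos : 0 < T
  mem : ∀ t, (γ t).1 ∈ symInterval d
  deriv : ∀ t, HasDerivAt γ (lienardField f g (γ t)) t
  periodic : Function.Periodic γ T
  nonconst : ∃ s t, γ s ≠ γ t

/-- Between times `t₀` and `t₁` the curve runs through `x > 0` from the positive to the negative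
half of the `y`-axis. -/
structure RightPassage (γ : ℝ → ℝ × ℝ) (t₀ t₁ : ℝ) : Prop where
  lt : t₀ < t₁
  left : (γ t₀).1 = 0
  right : (γ t₁).1 = 0
  pos : ∀ t ∈ Ioo t₀ t₁, 0 < (γ t).1
  start : 0 < (γ t₀).2
  finish : (γ t₁).2 < 0

section

variable {f g : ℝ → ℝ} {d : EReal} {a b T : ℝ} {X : ℝ → ℝ} {γ : ℝ → ℝ × ℝ}

theorem Hyp.F_mul_g_nonpos (H : Hyp f g d) (S : SignHyp f d a) {x : ℝ} (hx : |x| < a) :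
    primitive f x * g x ≤ 0 := by
  have hpos : ∀ x, 0 ≤ x → x < a → primitive f x * g x ≤ 0 := by
    intro x h0 hxa
    rcases h0.eq_or_lt with rfl | h
    · simp
    · have hxs := Icc_subset_symInterval S.mem ⟨h0, hxa.le⟩
      exact mul_nonpos_of_nonpos_of_nonneg (S.neg x ⟨h, hxa⟩).le (H.g_pos x hxs h).le
  rcases le_total 0 x with h | h
  · exact hpos x h (by rwa [abs_of_nonneg h] at hx)
  · have h1 : -x < a := by rwa [abs_of_nonpos h] at hx
    have hxs : -x ∈ symInterval d := Icc_subset_symInterval S.mem ⟨by linarith, h1.le⟩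
    have h2 := hpos (-x) (by linarith) h1
    have h3 := H.F_odd _ hxs
    have h4 := H.g_odd _ hxs
    rw [neg_neg] at h3 h4
    rw [h3, h4]; linarith

theorem Hyp.G_pos_of_ne (H : Hyp f g d) {x : ℝ} (hx : x ∈ symInterval d) (h0 : x ≠ 0) :
    0 < primitive g x := by
  rcases lt_or_gt_of_ne h0 with h | h
  · rw [← H.G_neg hx]; exact H.G_pos (neg_mem_symInterval hx) (by linarith)
  · exact H.G_pos hx h

theorem Hyp.eq_zero_of_energy_nonpos (H : Hyp f g d) {P : ℝ × ℝ} (hP : P.1 ∈ symInterval d)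
    (h : energy g P ≤ 0) : P = 0 := by
  rw [energy] at h
  have hx : P.1 = 0 := by
    by_contra hne
    have := H.G_pos_of_ne hP hne
    nlinarith [sq_nonneg P.2]
  rw [hx, primitive_zero] at h
  have hy : P.2 = 0 := by nlinarith [sq_nonneg P.2]
  exact Prod.ext hx hy

theorem PeriodicSolution.neg (H : Hyp f g d) (hγ : PeriodicSolution f g d T γ) :
    PeriodicSolution f g d T (fun t => -γ t) where
  pos := hγ.pos
  mem t := neg_mem_symInterval (hγ.mem t)
  deriv t := by
    rw [H.lienardField_neg (hγ.mem t)]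
    exact (hγ.deriv t).neg
  periodic t := by simp only [hγ.periodic t]
  nonconst := by
    obtain ⟨s, t, h⟩ := hγ.nonconst
    exact ⟨s, t, fun h' => h (neg_inj.1 h')⟩

theorem PeriodicSolution.continuous (hγ : PeriodicSolution f g d T γ) : Continuous γ :=
  continuous_iff_continuousAt.2 fun t => (hγ.deriv t).continuousAt

theorem PeriodicSolution.hasDerivAt_fst (hγ : PeriodicSolution f g d T γ) (t : ℝ) :
    HasDerivAt (fun t => (γ t).1) ((γ t).2 - primitive f (γ t).1) t := (hγ.deriv t).fst

theorem PeriodicSolution.hasDerivAt_snd (hγ : PeriodicSolution f g d T γ) (t : ℝ) :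
    HasDerivAt (fun t => (γ t).2) (-g (γ t).1) t := (hγ.deriv t).snd

theorem PeriodicSolution.exists_shift_le (hγ : PeriodicSolution f g d T γ) (t r : ℝ) :
    ∃ t' < r, γ t' = γ t := by
  obtain ⟨n, hn⟩ := exists_nat_gt ((t - r) / T)
  rw [div_lt_iff₀ hγ.pos] at hn
  exact ⟨t - n * T, by linarith, hγ.periodic.sub_nat_mul_eq n⟩

theorem PeriodicSolution.exists_shift_ge (hγ : PeriodicSolution f g d T γ) (t r : ℝ) :
    ∃ t' > r, γ t' = γ t := by
  obtain ⟨n, hn⟩ := exists_nat_gt ((r - t) / T)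
  rw [div_lt_iff₀ hγ.pos] at hn
  exact ⟨t + n * T, by linarith, (hγ.periodic.nat_mul n) t⟩

/-- A nonconstant periodic solution does not pass through the origin. -/
theorem PeriodicSolution.ne_zero (H : Hyp f g d) (S : SignHyp f d a)
    (hγ : PeriodicSolution f g d T γ) (t : ℝ) : γ t ≠ 0 := by
  intro h0
  -- As `g` is merely continuous, uniqueness at the equilibrium is not at hand. Near the origin `F g
  -- ≤ 0`, so the energy does not decrease in time; being zero at the first time `τ` in the origin,
  -- it is at most zero just before, which already forces the origin.
  have hall : ∀ r ≤ t, γ r = 0 := by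
    by_contra! hcon
    obtain ⟨r, hr, hr0⟩ := hcon
    set Z := {s ∈ Icc r t | γ s = 0} with hZ
    have hZc : IsClosed Z := isClosed_Icc.inter (isClosed_eq hγ.continuous continuous_const)
    have hZb : BddBelow Z := ⟨r, fun s hs => hs.1.1⟩
    have hmem : sInf Z ∈ Z := hZc.csInf_mem ⟨t, ⟨hr, le_rfl⟩, h0⟩ hZb
    set τ := sInf Z
    have hrτ : r < τ := lt_of_le_of_ne hmem.1.1 fun h => hr0 (by rw [h]; exact hmem.2)
    have hnear : ∀ᶠ s in 𝓝[<] τ, |(γ s).1| < a := by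
      have hc : Continuous fun s => |(γ s).1| := (continuous_fst.comp hγ.continuous).abs
      have := (hc.tendsto τ).eventually_lt_const (show |(γ τ).1| < a by
        rw [hmem.2]; simpa using S.pos)
      exact this.filter_mono nhdsWithin_le_nhds
    obtain ⟨c, hc, hsub⟩ := mem_nhdsLT_iff_exists_Ico_subset.1
      (hnear.and (Ioo_mem_nhdsLT hrτ))
    have hE : ∀ s, HasDerivAt (fun s => energy g (γ s)) (-(primitive f (γ s).1 * g (γ s).1)) s := by
      intro s
      have := H.hasDerivAt_energy_aux (s := univ) (hγ.mem s) (hγ.deriv s).hasDerivWithinAt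
      rwa [hasDerivWithinAt_univ] at this
    have hmono : MonotoneOn (fun s => energy g (γ s)) (Icc c τ) := by
      refine monotoneOn_of_hasDerivWithinAt_nonneg (convex_Icc c τ)
        (fun s _ => (hE s).continuousAt.continuousWithinAt)
        (f' := fun s => -(primitive f (γ s).1 * g (γ s).1))
        (fun s _ => (hE s).hasDerivWithinAt) ?_
      rw [interior_Icc]
      intro s hs
      have := H.F_mul_g_nonpos S (hsub ⟨hs.1.le, hs.2⟩).1
      linarith
    have hcτ : c < τ := hc
    have h1 := hmono ⟨le_rfl, hcτ.le⟩ ⟨hcτ.le, le_rfl⟩ hcτ.le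
    dsimp only at h1
    rw [hmem.2] at h1
    have h2 : γ c = 0 := H.eq_zero_of_energy_nonpos (hγ.mem c)
      (h1.trans (by simp [energy]))
    have hcr := (hsub ⟨le_rfl, hcτ⟩).2
    exact absurd (csInf_le hZb (show c ∈ Z from ⟨⟨hcr.1.le, hcτ.le.trans hmem.1.2⟩, h2⟩))
      (not_le.2 hcτ)
  obtain ⟨s, s', hne⟩ := hγ.nonconst
  have hz : ∀ s, γ s = 0 := fun s => by
    obtain ⟨s', hs', h⟩ := hγ.exists_shift_le s t
    rw [← h]; exact hall s' hs'.le
  exact hne ((hz s).trans (hz s').symm)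

theorem PeriodicSolution.exists_fst_nonpos (H : Hyp f g d) (hγ : PeriodicSolution f g d T γ) :
    ∃ t, (γ t).1 ≤ 0 := by
  by_contra! hpos
  have hanti : StrictAnti fun t => (γ t).2 := by
    refine strictAnti_of_hasDerivAt_neg hγ.hasDerivAt_snd fun t => ?_
    have := H.g_pos _ (hγ.mem t) (hpos t)
    linarith
  have h1 := hanti hγ.pos
  have h2 := hγ.periodic 0
  rw [zero_add] at h2
  simp only [h2] at h1
  exact absurd h1 (lt_irrefl _)

theorem PeriodicSolution.snd_ne_zero (H : Hyp f g d) (S : SignHyp f d a)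
    (hγ : PeriodicSolution f g d T γ) {t : ℝ} (h : (γ t).1 = 0) : (γ t).2 ≠ 0 := fun h' =>
  hγ.ne_zero H S t (Prod.ext h h')

/-- The passage is bounded by the last zero of `x` before `t` and the first one after it. There `x'
= y ≠ 0`, and the sign of `x` nearby fixes that of `y`. -/
theorem PeriodicSolution.exists_rightPassage (H : Hyp f g d) (S : SignHyp f d a)
    (hγ : PeriodicSolution f g d T γ) {t : ℝ} (ht : 0 < (γ t).1) :
    ∃ t₀ t₁, t ∈ Ioo t₀ t₁ ∧ RightPassage γ t₀ t₁ := by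
  have hc : Continuous fun t => (γ t).1 := continuous_fst.comp hγ.continuous
  obtain ⟨r, hr⟩ := hγ.exists_fst_nonpos H
  obtain ⟨r₁, hr₁, e₁⟩ := hγ.exists_shift_ge r t
  obtain ⟨r₀, hr₀, e₀⟩ := hγ.exists_shift_le r t
  obtain ⟨t₁, ht₁, h1, p1⟩ := exists_first_zero hc hr₁ ht (by rw [e₁]; exact hr)
  obtain ⟨t₀, ht₀, h0, p0⟩ := exists_last_zero hc hr₀ ht (by rw [e₀]; exact hr)
  refine ⟨t₀, t₁, ⟨ht₀, ht₁⟩, ht₀.trans ht₁, h0, h1, fun s hs => ?_, ?_, ?_⟩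
  · rcases le_total s t with h | h
    · exact p0 s ⟨hs.1, h⟩
    · exact p1 s ⟨h, hs.2⟩
  · by_contra! hle
    have hlt : (γ t₀).2 < 0 := lt_of_le_of_ne hle (hγ.snd_ne_zero H S h0)
    have hd := (hγ.hasDerivAt_fst t₀).neg
    rw [h0, primitive_zero, sub_zero] at hd
    have := eventually_pos_right_of_deriv_pos hd (by simp [h0]) (by linarith)
    obtain ⟨s, hs, hs'⟩ := (this.and (Ioo_mem_nhdsGT ht₀)).exists
    have h2 := p0 s ⟨hs'.1, hs'.2.le⟩
    simp only [Pi.neg_apply] at hs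
    linarith
  · by_contra! hle
    have hlt : 0 < (γ t₁).2 := lt_of_le_of_ne hle (hγ.snd_ne_zero H S h1).symm
    have hd := hγ.hasDerivAt_fst t₁
    rw [h1, primitive_zero, sub_zero] at hd
    have := eventually_neg_left_of_deriv_pos hd h1 hlt
    obtain ⟨s, hs, hs'⟩ := (this.and (Ioo_mem_nhdsLT ht₁)).exists
    have h2 := p1 s ⟨hs'.1.le, hs'.2⟩
    linarith

theorem PeriodicSolution.exists_rightPassage_from (H : Hyp f g d) (S : SignHyp f d a)
    (hγ : PeriodicSolution f g d T γ) {t : ℝ} (h0 : (γ t).1 = 0) (hy : 0 < (γ t).2) :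
    ∃ t₁, RightPassage γ t t₁ := by
  have hd := hγ.hasDerivAt_fst t
  rw [h0, primitive_zero, sub_zero] at hd
  have h1 := eventually_pos_right_of_deriv_pos hd h0 hy
  obtain ⟨r, hr, hsub⟩ := mem_nhdsGT_iff_exists_Ioc_subset.1 h1
  have hr : t < r := hr
  obtain ⟨t₀, t₁, hrt, P⟩ := hγ.exists_rightPassage H S (hsub ⟨hr, le_rfl⟩)
  have e : t₀ = t := by
    refine le_antisymm ?_ ?_
    · by_contra! h
      have := hsub ⟨h, hrt.1.le⟩
      exact absurd P.left (ne_of_gt this)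
    · by_contra! h
      have := P.pos t ⟨h, hr.trans hrt.2⟩
      exact absurd h0 (ne_of_gt this)
  exact ⟨t₁, e ▸ P⟩

theorem PeriodicSolution.exists_leftPassage_to (H : Hyp f g d) (S : SignHyp f d a)
    (hγ : PeriodicSolution f g d T γ) {t : ℝ} (h0 : (γ t).1 = 0) (hy : 0 < (γ t).2) :
    ∃ t₀, RightPassage (fun t => -γ t) t₀ t := by
  have hd := hγ.hasDerivAt_fst t
  rw [h0, primitive_zero, sub_zero] at hd
  have h1 := eventually_neg_left_of_deriv_pos hd h0 hy
  obtain ⟨r, hr, hsub⟩ := mem_nhdsLT_iff_exists_Ico_subset.1 h1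
  have hr : r < t := hr
  have hneg : ∀ s ∈ Ico r t, 0 < (-γ s).1 := fun s hs => by
    have h2 : (γ s).1 < 0 := hsub hs
    rw [Prod.fst_neg]; linarith
  obtain ⟨t₀, t₁, hrt, P⟩ := (hγ.neg H).exists_rightPassage H S (hneg r ⟨le_rfl, hr⟩)
  have e : t₁ = t := by
    refine le_antisymm ?_ ?_
    · by_contra! h
      have := P.pos t ⟨hrt.1.trans hr, h⟩
      rw [Prod.fst_neg, h0, neg_zero] at this
      exact absurd this (lt_irrefl _)
    · by_contra! h
      have := hneg t₁ ⟨hrt.2.le, h⟩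
      exact absurd P.right (ne_of_gt this)
  exact ⟨t₀, e ▸ P⟩

theorem PeriodicSolution.exists_fst_eq_zero (H : Hyp f g d) (S : SignHyp f d a)
    (hγ : PeriodicSolution f g d T γ) : ∃ t, (γ t).1 = 0 ∧ 0 < (γ t).2 := by
  obtain ⟨t, ht⟩ : ∃ t, (γ t).1 = 0 := by
    rcases lt_trichotomy (γ 0).1 0 with h | h | h
    · obtain ⟨t₀, _, -, P⟩ := (hγ.neg H).exists_rightPassage H S (t := 0)
        (by rw [Prod.fst_neg]; linarith)
      exact ⟨t₀, neg_eq_zero.1 P.left⟩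
    · exact ⟨0, h⟩
    · obtain ⟨t₀, _, -, P⟩ := hγ.exists_rightPassage H S h
      exact ⟨t₀, P.left⟩
  rcases lt_or_gt_of_ne (hγ.snd_ne_zero H S ht) with h | h
  · obtain ⟨t₁, P⟩ := (hγ.neg H).exists_rightPassage_from H S (t := t)
      (by rw [Prod.fst_neg, ht, neg_zero]) (by rw [Prod.snd_neg]; linarith)
    refine ⟨t₁, neg_eq_zero.1 P.right, ?_⟩
    have := P.finish
    rw [Prod.snd_neg] at this
    linarith
  · exact ⟨t, ht, h⟩

theorem PeriodicSolution.exists_bound (hγ : PeriodicSolution f g d T γ) :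
    ∃ b ∈ symInterval d, 0 < b ∧ ∀ t, |(γ t).1| < b := by
  have hc : Continuous fun t => |(γ t).1| := (continuous_fst.comp hγ.continuous).abs
  obtain ⟨tm, -, hmax⟩ := isCompact_Icc.exists_isMaxOn (nonempty_Icc.2 hγ.pos.le)
    (hc.continuousOn (s := Icc 0 T))
  obtain ⟨b, hb, hlt⟩ := exists_gt_mem_symInterval
    (mem_symInterval_of_abs_le (hγ.mem tm) (abs_abs _).le)
  refine ⟨b, hb, (abs_nonneg _).trans_lt hlt, fun t => ?_⟩
  obtain ⟨r, hr, hr'⟩ := hγ.periodic.exists_mem_Ico₀ hγ.pos t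
  rw [hr']
  exact (hmax (Ico_subset_Icc_self hr)).trans_lt hlt

theorem RightPassage.exists_arc (H : Hyp f g d) (hb : b ∈ symInterval d)
    (hX : PotentialInverse g b X) (hγ : PeriodicSolution f g d T γ) (hlt : ∀ t, |(γ t).1| < b)
    {t₀ t₁ : ℝ} (P : RightPassage γ t₀ t₁) :
    ∃ z, Arc (transform f X) (-(γ t₀).2) (-(γ t₁).2) z ∧
      (∀ s ∈ Icc (-(γ t₀).2) (-(γ t₁).2), z s < primitive g b) ∧
      (∀ t ∈ Ioo t₀ t₁, -(γ t).2 ∈ Ioo (-(γ t₀).2) (-(γ t₁).2) ∧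
        z (-(γ t).2) = primitive g (γ t).1) ∧
      ∀ s ∈ Ioo (-(γ t₀).2) (-(γ t₁).2), ∃ t ∈ Ioo t₀ t₁, -(γ t).2 = s := by
  obtain ⟨z, A, h1, h2, h3, h4⟩ := H.exists_arc_of_half_orbit hb hX P.lt
    (fun t _ => (hγ.deriv t).hasDerivWithinAt) P.left P.right P.pos
    (fun t _ => (le_abs_self _).trans_lt (hlt t)) P.start P.finish
  exact ⟨z, A, h4, fun t ht => ⟨h2 t ht, (h1 t (Ioo_subset_Icc_self ht)).2⟩, h3⟩

/-- At an extremal crossing of the `y`-axis a periodic solution has a symmetric half. -/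
theorem PeriodicSolution.exists_symmetric_arc (H : Hyp f g d) (S : SignHyp f d a)
    (hb : b ∈ symInterval d) (hX : PotentialInverse g b X) (hγ : PeriodicSolution f g d T γ)
    (hlt : ∀ t, |(γ t).1| < b) {t : ℝ} (h0 : (γ t).1 = 0)
    (hext : (∀ r, (γ r).1 = 0 → |(γ r).2| ≤ |(γ t).2|) ∨
      ∀ r, (γ r).1 = 0 → |(γ t).2| ≤ |(γ r).2|) :
    ∃ z, Arc (transform f X) (-|(γ t).2|) |(γ t).2| z ∧
      ∀ s ∈ Icc (-|(γ t).2|) |(γ t).2|, z s < primitive g b := by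
  wlog hy : 0 < (γ t).2 generalizing γ
  · have hy' : 0 < (-γ t).2 := by
      rw [Prod.snd_neg]
      have := lt_of_le_of_ne (not_lt.1 hy) (hγ.snd_ne_zero H S h0)
      linarith
    have := this (hγ.neg H) (fun t => by rw [Prod.fst_neg, abs_neg]; exact hlt t)
      (by rw [Prod.fst_neg, h0, neg_zero])
      (by simpa only [Prod.fst_neg, Prod.snd_neg, abs_neg, neg_eq_zero] using hext) hy'
    simpa only [Prod.snd_neg, abs_neg] using this
  obtain ⟨t₁, P₁⟩ := hγ.exists_rightPassage_from H S h0 hy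
  obtain ⟨t₀, P₀⟩ := hγ.exists_leftPassage_to H S h0 hy
  obtain ⟨z₁, A₁, b₁, -, -⟩ := P₁.exists_arc H hb hX hγ hlt
  obtain ⟨z₀, A₀, b₀, -, -⟩ := P₀.exists_arc H hb hX (hγ.neg H)
    (fun t => by rw [Prod.fst_neg, abs_neg]; exact hlt t)
  simp only [Prod.snd_neg, neg_neg] at A₀ b₀
  have hreg := H.regular_transform hb hX
  have hy0 : (γ t₀).2 < 0 := A₀.neg
  have hy1 : (γ t₁).2 < 0 := P₁.finish
  have hx0 : (γ t₀).1 = 0 := neg_eq_zero.1 P₀.left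
  have c₀ : ∀ s ∈ Ioo (γ t₀).2 (γ t).2, z₀ s < primitive g b :=
    fun s hs => b₀ s (Ioo_subset_Icc_self hs)
  have c₁ : ∀ s ∈ Ioo (-(γ t).2) (-(γ t₁).2), z₁ s < primitive g b :=
    fun s hs => b₁ s (Ioo_subset_Icc_self hs)
  -- The reflected preceding half has ends `y(t₀)` and `y(t)`, the following one `-y(t)` and
  -- `-y(t₁)`. If the left ends differed, nesting would put `|y(t)|` strictly between `|y(t₀)|` and
  -- `|y(t₁)|`, against extremality.
  have heq : (γ t₀).2 = -(γ t).2 := by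
    rw [abs_of_pos hy] at hext
    rcases lt_trichotomy (γ t₀).2 (-(γ t).2) with h | h | h
    · have hq := (A₁.lt_of_lt hreg c₁ A₀ c₀ h).1
      rcases hext with hext | hext
      · have := hext t₀ hx0
        rw [abs_of_neg hy0] at this
        linarith
      · have := hext t₁ P₁.right
        rw [abs_of_neg hy1] at this
        linarith
    · exact h
    · have hq := (A₀.lt_of_lt hreg c₀ A₁ c₁ h).1
      rcases hext with hext | hext
      · have := hext t₁ P₁.right
        rw [abs_of_neg hy1] at this
        linarith
      · have := hext t₀ hx0
        rw [abs_of_neg hy0] at this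
        linarith
  rw [heq] at A₀ b₀
  rw [abs_of_pos hy]
  exact ⟨z₀, A₀, b₀⟩

theorem Hyp.symmetric_arc_unique (H : Hyp f g d) (S : SignHyp f d a) (hb : b ∈ symInterval d)
    (hb0 : 0 < b) (hX : PotentialInverse g b X) {Y Y' : ℝ} {z z' : ℝ → ℝ}
    (A : Arc (transform f X) (-Y) Y z) (hA : ∀ s ∈ Icc (-Y) Y, z s < primitive g b)
    (B : Arc (transform f X) (-Y') Y' z') (hB : ∀ s ∈ Icc (-Y') Y', z' s < primitive g b) :
    Y = Y' ∧ EqOn z z' (Icc (-Y) Y) := by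
  have hGm := H.strictMonoOn_G hb
  have hXsym : ∀ r, X r ∈ symInterval d := fun r => Icc_subset_symInterval hb (hX.mem r)
  have hGa := H.G_pos S.mem S.pos
  have hlow : ∀ r ∈ Ico (primitive g a) (primitive g b), a ≤ X r := by
    intro r hr
    by_contra! h
    have h1 : primitive g (X r) < primitive g a :=
      (H.strictMonoOn_G S.mem) ⟨(hX.mem r).1, h.le⟩ ⟨S.pos.le, le_rfl⟩ h
    rw [hX.right_inv r ⟨hGa.le.trans hr.1, hr.2.le⟩] at h1
    linarith [hr.1]
  refine A.symmetric_unique (H.regular_transform hb hX) hGa ?_ ?_ ?_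
    (fun s hs => hA s (Ioo_subset_Icc_self hs)) B (fun s hs => hB s (Ioo_subset_Icc_self hs))
  · intro r hr
    rw [transform, neg_pos]
    rcases lt_or_ge r (primitive g b) with h | h
    · refine S.neg _ ⟨(hX.mem_Ioo r ⟨hr.1, h⟩).1, ?_⟩
      by_contra! h'
      have h1 : primitive g a ≤ primitive g (X r) :=
        hGm.monotoneOn ⟨S.pos.le, h'.trans (hX.mem r).2⟩ (hX.mem r) h'
      rw [hX.right_inv r ⟨hr.1.le, h.le⟩] at h1
      linarith [hr.2]
    -- Here `G(b) ≤ r < G(a)`, so `b < a` and `Ψ` has the constant value `-F(b) > 0`.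
    · rw [hX.of_ge r h]
      refine S.neg b ⟨hb0, ?_⟩
      by_contra! h'
      have h1 : primitive g a ≤ primitive g b :=
        hGm.monotoneOn ⟨S.pos.le, h'⟩ ⟨hb0.le, le_rfl⟩ h'
      linarith [hr.2]
  · intro r hr
    rw [transform, neg_nonpos]
    exact S.nonneg (hlow r hr) (hXsym r)
  · intro r hr r' hr' hle
    rw [transform, transform, neg_le_neg_iff]
    refine S.mono ⟨hlow r hr, hXsym r⟩ ⟨hlow r' hr', hXsym r'⟩ ?_
    rw [← hGm.le_iff_le (hX.mem r) (hX.mem r'), hX.right_inv r ⟨hGa.le.trans hr.1, hr.2.le⟩,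
      hX.right_inv r' ⟨hGa.le.trans hr'.1, hr'.2.le⟩]
    exact hle

/-- Every half of a periodic solution is the symmetric arc. -/
theorem PeriodicSolution.exists_arc (H : Hyp f g d) (S : SignHyp f d a)
    (hb : b ∈ symInterval d) (hb0 : 0 < b) (hX : PotentialInverse g b X)
    (hγ : PeriodicSolution f g d T γ) (hlt : ∀ t, |(γ t).1| < b) :
    ∃ Y z, Arc (transform f X) (-Y) Y z ∧ (∀ s ∈ Icc (-Y) Y, z s < primitive g b) ∧
      ∀ t, (γ t).1 = 0 → |(γ t).2| = Y := by
  obtain ⟨t, ht, -⟩ := hγ.exists_fst_eq_zero H S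
  obtain ⟨r, hr, hrt⟩ := hγ.periodic.exists_mem_Ico₀ hγ.pos t
  have hcx : Continuous fun t => (γ t).1 := continuous_fst.comp hγ.continuous
  have hcy : Continuous fun t => |(γ t).2| := (continuous_snd.comp hγ.continuous).abs
  set Z := {s ∈ Icc 0 T | (γ s).1 = 0} with hZ
  have hZc : IsCompact Z := isCompact_Icc.inter_right (isClosed_eq hcx continuous_const)
  have hZne : Z.Nonempty := ⟨r, Ico_subset_Icc_self hr, by rw [← hrt]; exact ht⟩
  have hred : ∀ t, (γ t).1 = 0 → ∃ s ∈ Z, γ s = γ t := by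
    intro t ht
    obtain ⟨s, hs, hst⟩ := hγ.periodic.exists_mem_Ico₀ hγ.pos t
    exact ⟨s, ⟨Ico_subset_Icc_self hs, by rw [← hst]; exact ht⟩, hst.symm⟩
  -- The crossings with largest and smallest `|y|` both carry symmetric arcs. These are equal, so
  -- all crossings have the same `|y|`.
  obtain ⟨tM, htM, hmax⟩ := hZc.exists_isMaxOn hZne hcy.continuousOn
  obtain ⟨tm, htm, hmin⟩ := hZc.exists_isMinOn hZne hcy.continuousOn
  have hmax' : ∀ r, (γ r).1 = 0 → |(γ r).2| ≤ |(γ tM).2| := fun r hr => by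
    obtain ⟨s, hs, e⟩ := hred r hr
    rw [← e]; exact hmax hs
  have hmin' : ∀ r, (γ r).1 = 0 → |(γ tm).2| ≤ |(γ r).2| := fun r hr => by
    obtain ⟨s, hs, e⟩ := hred r hr
    rw [← e]; exact hmin hs
  obtain ⟨z, A, hA⟩ := hγ.exists_symmetric_arc H S hb hX hlt htM.2 (Or.inl hmax')
  obtain ⟨z', B, hB⟩ := hγ.exists_symmetric_arc H S hb hX hlt htm.2 (Or.inr hmin')
  have hY := (H.symmetric_arc_unique S hb hb0 hX A hA B hB).1
  exact ⟨_, z, A, hA, fun t ht => le_antisymm (hmax' t ht) (hY ▸ hmin' t ht)⟩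

/-- Inside a common bound `|x| < b` both orbits are described by the same symmetric arc, and `G` is
injective on `[0, b]`, so `y` determines `x` on the right half. -/
theorem PeriodicSolution.range_subset (H : Hyp f g d) (S : SignHyp f d a) {T' : ℝ}
    {η : ℝ → ℝ × ℝ} (hγ : PeriodicSolution f g d T γ) (hη : PeriodicSolution f g d T' η) :
    range γ ⊆ range η := by
  obtain ⟨b₁, hb₁, hb₁0, hlt₁⟩ := hγ.exists_bound
  obtain ⟨b₂, hb₂, -, hlt₂⟩ := hη.exists_bound
  obtain ⟨b, hb, hb0, hγb, hηb⟩ : ∃ b ∈ symInterval d, 0 < b ∧ (∀ t, |(γ t).1| < b) ∧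
      ∀ t, |(η t).1| < b := by
    refine ⟨max b₁ b₂, ?_, lt_max_of_lt_left hb₁0, fun t => lt_max_of_lt_left (hlt₁ t),
      fun t => lt_max_of_lt_right (hlt₂ t)⟩
    rcases max_choice b₁ b₂ with h | h <;> rw [h] <;> assumption
  obtain ⟨X, hX⟩ := H.exists_potentialInverse hb0 hb
  obtain ⟨Y, z, A, hA, hYγ⟩ := hγ.exists_arc H S hb hb0 hX hγb
  obtain ⟨Y', z', B, hB, hYη⟩ := hη.exists_arc H S hb hb0 hX hηb
  obtain ⟨rfl, -⟩ := H.symmetric_arc_unique S hb hb0 hX A hA B hB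
  have hGi := (H.strictMonoOn_G hb).injOn
  -- Every passage through `x > 0` runs over the whole arc `z`, whichever solution and passage are
  -- chosen.
  have pass : ∀ {θ : ℝ → ℝ × ℝ} {T₀ : ℝ}, PeriodicSolution f g d T₀ θ → (∀ t, |(θ t).1| < b) →
      (∀ t, (θ t).1 = 0 → |(θ t).2| = Y) → ∀ {t₀ t₁}, RightPassage θ t₀ t₁ →
      (∀ t ∈ Ioo t₀ t₁, -(θ t).2 ∈ Ioo (-Y) Y ∧ z (-(θ t).2) = primitive g (θ t).1) ∧
      ∀ s ∈ Ioo (-Y) Y, ∃ t ∈ Ioo t₀ t₁, -(θ t).2 = s := by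
    intro θ T₀ hθ hθb hYθ t₀ t₁ P
    obtain ⟨ζ, C, hC, h1, h2⟩ := P.exists_arc H hb hX hθ hθb
    have e0 : (θ t₀).2 = Y := by
      have := hYθ t₀ P.left
      rwa [abs_of_pos P.start] at this
    have e1 : -(θ t₁).2 = Y := by
      have := hYθ t₁ P.right
      rwa [abs_of_neg P.finish] at this
    rw [e0, e1] at C hC h1 h2
    have he := (H.symmetric_arc_unique S hb hb0 hX A hA C hC).2
    exact ⟨fun t ht => ⟨(h1 t ht).1, (he (Ioo_subset_Icc_self (h1 t ht).1)).trans (h1 t ht).2⟩, h2⟩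
  have half : ∀ {θ ϑ : ℝ → ℝ × ℝ} {T₀ T₁ : ℝ}, PeriodicSolution f g d T₀ θ →
      (∀ t, |(θ t).1| < b) → (∀ t, (θ t).1 = 0 → |(θ t).2| = Y) → PeriodicSolution f g d T₁ ϑ →
      (∀ t, |(ϑ t).1| < b) → (∀ t, (ϑ t).1 = 0 → |(ϑ t).2| = Y) →
      ∀ t, 0 < (θ t).1 → ∃ r, ϑ r = θ t := by
    intro θ ϑ T₀ T₁ hθ hθb hYθ hϑ hϑb hYϑ t ht
    obtain ⟨t₀, t₁, htt, P⟩ := hθ.exists_rightPassage H S ht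
    obtain ⟨r₀, hr₀, hr₀'⟩ := hϑ.exists_fst_eq_zero H S
    obtain ⟨r₁, Q⟩ := hϑ.exists_rightPassage_from H S hr₀ hr₀'
    obtain ⟨h1, h2⟩ := (pass hθ hθb hYθ P).1 t htt
    obtain ⟨r, hr, hrs⟩ := (pass hϑ hϑb hYϑ Q).2 _ h1
    obtain ⟨-, h3⟩ := (pass hϑ hϑb hYϑ Q).1 r hr
    rw [hrs, h2] at h3
    refine ⟨r, Prod.ext ?_ (neg_inj.1 hrs)⟩
    exact (hGi ⟨ht.le, ((le_abs_self _).trans_lt (hθb t)).le⟩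
      ⟨(Q.pos r hr).le, ((le_abs_self _).trans_lt (hϑb r)).le⟩ h3).symm
  have nb : ∀ {θ : ℝ → ℝ × ℝ}, (∀ t, |(θ t).1| < b) → ∀ t, |(-θ t).1| < b := fun h t => by
    rw [Prod.fst_neg, abs_neg]; exact h t
  have nY : ∀ {θ : ℝ → ℝ × ℝ}, (∀ t, (θ t).1 = 0 → |(θ t).2| = Y) →
      ∀ t, (-θ t).1 = 0 → |(-θ t).2| = Y := fun h t ht => by
    rw [Prod.snd_neg, abs_neg]; exact h t (neg_eq_zero.1 ht)
  rintro _ ⟨t, rfl⟩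
  -- Points with `x < 0` are handled by reflecting both solutions; on the axis the only candidates
  -- are `(0, Y)` and `(0, -Y)`, and both are attained.
  rcases lt_trichotomy (γ t).1 0 with h | h | h
  · obtain ⟨r, hr⟩ := half (hγ.neg H) (nb hγb) (nY hYγ) (hη.neg H) (nb hηb) (nY hYη) t
      (by rw [Prod.fst_neg]; linarith)
    exact ⟨r, neg_inj.1 hr⟩
  · obtain ⟨r₀, hr₀, hr₀'⟩ := hη.exists_fst_eq_zero H S
    obtain ⟨r₁, Q⟩ := hη.exists_rightPassage_from H S hr₀ hr₀'
    have e0 := hYη r₀ hr₀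
    have e1 := hYη r₁ Q.right
    rw [abs_of_pos hr₀'] at e0
    rw [abs_of_neg Q.finish] at e1
    have e2 := hYγ t h
    rcases lt_or_gt_of_ne (hγ.snd_ne_zero H S h) with hy | hy
    · rw [abs_of_neg hy] at e2
      exact ⟨r₁, Prod.ext (by rw [Q.right, h]) (by linarith)⟩
    · rw [abs_of_pos hy] at e2
      exact ⟨r₀, Prod.ext (by rw [hr₀, h]) (by linarith)⟩
  · obtain ⟨r, hr⟩ := half hγ hγb hYγ hη hηb hYη t h
    exact ⟨r, hr⟩

end

/-! ### Uniqueness of the limit cycle and passage to the phase plane -/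

section

variable {f g : ℝ → ℝ} {d : EReal} {a α : ℝ}

theorem IsPeriodicOrbit.exists_periodicSolution {C : Set (ℝ × ℝ)}
    (h : IsPeriodicOrbit (lienardField f g) (strip d) C) :
    ∃ T γ, PeriodicSolution f g d T γ ∧ C = range γ := by
  obtain ⟨γ, hγ, ⟨T, hT, hper⟩, hne, rfl⟩ := h
  exact ⟨T, γ, ⟨hT, fun t => (hγ t).1, fun t => (hγ t).2, hper, hne⟩, rfl⟩

theorem Hyp.periodicOrbit_unique (H : Hyp f g d) (S : SignHyp f d a) {C C' : Set (ℝ × ℝ)}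
    (h : IsPeriodicOrbit (lienardField f g) (strip d) C)
    (h' : IsPeriodicOrbit (lienardField f g) (strip d) C') : C = C' := by
  obtain ⟨T, γ, hγ, rfl⟩ := h.exists_periodicSolution
  obtain ⟨T', η, hη, rfl⟩ := h'.exists_periodicSolution
  exact (hγ.range_subset H S hη).antisymm (hη.range_subset H S hγ)

theorem Hyp.image_toPhase (H : Hyp f g d) {C : Set (ℝ × ℝ)}
    (h : IsPeriodicOrbit (lienardField f g) (strip d) C) :
    IsPeriodicOrbit (phaseField f g) (strip d)
      ((fun P : ℝ × ℝ => (P.1, P.2 - primitive f P.1)) '' C) := by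
  obtain ⟨γ, hγ, ⟨T, hT, hper⟩, ⟨s, t, hne⟩, rfl⟩ := h
  refine ⟨fun t => ((γ t).1, (γ t).2 - primitive f (γ t).1), fun t => ⟨(hγ t).1, ?_⟩,
    ⟨T, hT, fun t => by simp only [hper t]⟩, ⟨s, t, fun h => hne ?_⟩, ?_⟩
  · have hx : HasDerivAt (fun t => (γ t).1) ((γ t).2 - primitive f (γ t).1) t := (hγ t).2.fst
    have hy : HasDerivAt (fun t => (γ t).2) (-g (γ t).1) t := (hγ t).2.snd
    have hF := (H.hasDerivAt_F (hγ t).1).comp t hx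
    refine (hx.prodMk (hy.sub hF)).congr_deriv ?_
    ext
    · rfl
    · simp only [phaseField]; ring
  · have h1 := congrArg Prod.fst h
    have h2 := congrArg Prod.snd h
    simp only at h1 h2
    rw [h1] at h2
    exact Prod.ext h1 (sub_left_inj.1 h2)
  · rw [← range_comp]; rfl

theorem Hyp.image_fromPhase (H : Hyp f g d) {C : Set (ℝ × ℝ)}
    (h : IsPeriodicOrbit (phaseField f g) (strip d) C) :
    IsPeriodicOrbit (lienardField f g) (strip d)
      ((fun P : ℝ × ℝ => (P.1, P.2 + primitive f P.1)) '' C) := by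
  obtain ⟨γ, hγ, ⟨T, hT, hper⟩, ⟨s, t, hne⟩, rfl⟩ := h
  refine ⟨fun t => ((γ t).1, (γ t).2 + primitive f (γ t).1), fun t => ⟨(hγ t).1, ?_⟩,
    ⟨T, hT, fun t => by simp only [hper t]⟩, ⟨s, t, fun h => hne ?_⟩, ?_⟩
  · have hx : HasDerivAt (fun t => (γ t).1) (γ t).2 t := (hγ t).2.fst
    have hy : HasDerivAt (fun t => (γ t).2) (-f (γ t).1 * (γ t).2 - g (γ t).1) t := (hγ t).2.snd
    have hF := (H.hasDerivAt_F (hγ t).1).comp t hx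
    refine (hx.prodMk (hy.add hF)).congr_deriv ?_
    ext
    · simp only [lienardField]; ring
    · simp only [lienardField]; ring
  · have h1 := congrArg Prod.fst h
    have h2 := congrArg Prod.snd h
    simp only at h1 h2
    rw [h1] at h2
    exact Prod.ext h1 (add_left_inj _ |>.1 h2)
  · rw [← range_comp]; rfl

theorem IsPeriodicOrbit.exists_amplitude {V : ℝ × ℝ → ℝ × ℝ} {U C : Set (ℝ × ℝ)}
    (h : IsPeriodicOrbit V U C) (hα : ∀ P ∈ C, |P.1| ≤ α) : ∃ A, IsAmplitude C A ∧ A ≤ α := by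
  obtain ⟨γ, hγ, ⟨T, hT, hper⟩, -, rfl⟩ := h
  have hc : Continuous γ := continuous_iff_continuousAt.2 fun t => (hγ t).2.continuousAt
  obtain ⟨tm, -, hmax⟩ := isCompact_Icc.exists_isMaxOn (nonempty_Icc.2 hT.le)
    ((continuous_fst.comp hc).abs.continuousOn (s := Icc 0 T))
  refine ⟨|(γ tm).1|, ⟨⟨γ tm, mem_range_self tm, rfl⟩, ?_⟩, hα _ (mem_range_self tm)⟩
  rintro _ ⟨_, ⟨t, rfl⟩, rfl⟩
  obtain ⟨r, hr, hr'⟩ := hper.exists_mem_Ico₀ hT t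
  dsimp only
  rw [hr']
  exact hmax (Ico_subset_Icc_self hr)

/-- Isolation costs nothing: with only one periodic orbit in `U`, the whole plane serves as the
neighbourhood. -/
theorem existsUnique_limitCycle {V : ℝ × ℝ → ℝ × ℝ} {U C : Set (ℝ × ℝ)}
    (h : IsPeriodicOrbit V U C) (hα : ∀ P ∈ C, |P.1| ≤ α)
    (huniq : ∀ C', IsPeriodicOrbit V U C' → C' = C) :
    (∃! C, IsLimitCycle V U C) ∧ ∀ C, IsLimitCycle V U C → ∃ A, IsAmplitude C A ∧ A ≤ α := by
  refine ⟨⟨C, ⟨h, univ, isOpen_univ, subset_univ _, fun C' h' _ => huniq C' h'⟩,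
    fun C' h' => huniq C' h'.1⟩, fun C' h' => ?_⟩
  rw [huniq C' h'.1]
  exact h.exists_amplitude hα

end

end Lienard

end

theorem mainTheorem3 (f g : ℝ → ℝ) (d : EReal) (a αbar : ℝ)
    (hf : ContinuousOn f (Lienard.symInterval d))
    (hg : ContinuousOn g (Lienard.symInterval d))
    (hFodd : ∀ x ∈ Lienard.symInterval d,
      Lienard.primitive f (-x) = -Lienard.primitive f x)
    (hgodd : ∀ x ∈ Lienard.symInterval d, g (-x) = -g x)
    (hgpos : ∀ x ∈ Lienard.symInterval d, 0 < x → 0 < g x)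
    (ha : 0 < a) (had : (a : EReal) < d)
    (hFzero : ∀ x ∈ Lienard.symInterval d,
      Lienard.primitive f x = 0 ↔ x = 0 ∨ x = a ∨ x = -a)
    (hαbar : Lienard.IsAlphaBar f g d αbar)
    (hFinc : StrictMonoOn (Lienard.primitive f) (Set.Ioc a αbar))
    (hFmono : MonotoneOn (Lienard.primitive f) {x : ℝ | αbar < x ∧ (x : EReal) < d}) :
    ((∃! C, Lienard.IsLimitCycle (Lienard.lienardField f g) (Lienard.strip d) C) ∧
      ∀ C, Lienard.IsLimitCycle (Lienard.lienardField f g) (Lienard.strip d) C →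
        ∃ A, Lienard.IsAmplitude C A ∧ A ≤ αbar) ∧
    ((∃! C, Lienard.IsLimitCycle (Lienard.phaseField f g) (Lienard.strip d) C) ∧
      ∀ C, Lienard.IsLimitCycle (Lienard.phaseField f g) (Lienard.strip d) C →
        ∃ A, Lienard.IsAmplitude C A ∧ A ≤ αbar) := by
  have H : Lienard.Hyp f g d := ⟨hf, hg, hFodd, hgodd, hgpos⟩
  obtain ⟨⟨α', α'', hα', -, hmax⟩, yp, ym, hp, hm, h1, h2⟩ := hαbar
  have hαd : αbar ∈ Lienard.symInterval d := by
    obtain ⟨-, T, γ, ⟨hT, hγ⟩, -, hγT, -⟩ := hp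
    have := (hγ T ⟨hT.le, le_rfl⟩).1
    rwa [hγT] at this
  have had' : a ∈ Lienard.symInterval d := (Lienard.mem_symInterval_iff_of_nonneg ha.le).2 had
  obtain ⟨haα, S⟩ := H.signHyp ha had' hFzero hα' (hmax ▸ le_max_left _ _) hαd hFinc hFmono
  obtain ⟨C, hC, hCα⟩ := H.exists_periodicOrbit S haα hp hm h1 h2
  refine ⟨Lienard.existsUnique_limitCycle hC hCα fun C' h => H.periodicOrbit_unique S h hC,
    Lienard.existsUnique_limitCycle (H.image_toPhase hC) ?_ fun C' h => ?_⟩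
  · rintro _ ⟨P, hP, rfl⟩
    exact hCα P hP
  -- A periodic orbit of the phase plane, carried to the Liénard plane, must be `C`; carrying it
  -- back recovers it as the image of `C`.
  · rw [← H.periodicOrbit_unique S (H.image_fromPhase h) hC, Set.image_image]
    simp
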